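/- Let $n\ge 0$ be an integer and $q>0$ a real number. Let $\Delta_{-1}=0$, $\Delta_0=1$, $\Delta_{k+1}=q\Delta_k-\Delta_{k-1}$, assume $\Delta_k(q)\neq 0$ for $1\le k\le n-1$, and put $\mu_k=\Delta_{k-1}(q)/\Delta_k(q)$. A half-diagram on $m$ points is a partition of $\{1,\dots,m\}$ into sets of one (through-strings) or two (pairs) elements such that there are no $i<k<j<l$ with $i,j$ paired and $k,l$ paired, and no $i<k<j$ with $i,j$ paired and $k$ a through-string. Let $U(m)$ be the complex vector space with basis $\xi_{\mathfrak a}$, $\mathfrak a$ a half-diagram on $m$ points, and let $TL_m$ be the Temperley–Lieb algebra with basis $e_{\mathfrak p}$, $\mathfrak p$ a noncrossing pairing of $\{1,\dots,2m\}$ (that is, a half-diagram on $2m$ points without through-strings). $TL_m$ acts on $U(m)$ by concatenation: identify the $i$th point of $\mathfrak a$ with the point $2m-i+1$ of $\mathfrak p$; if an edge path joins two through-strings of $\mathfrak a$, then $e_{\mathfrak p}\xi_{\mathfrak a}=0$, and otherwise $e_{\mathfrak p}\xi_{\mathfrak a}=q^c\xi_{\mathfrak b}$, where $c$ is the number of closed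 loops and $\mathfrak b$ is the half-diagram on the points $1,\dots,m$ of $\mathfrak p$ that remains. Let $\langle\cdot,\cdot\rangle$ be the sesquilinear form on $U(m)$ for which $\langle\xi_{\mathfrak a},\xi_{\mathfrak b}\rangle$ is obtained by identifying the $i$th points of $\mathfrak a$ and $\mathfrak b$ for all $i$: it is $0$ if an edge path joins two through-strings of the same one of the two half-diagrams, and $q^c$ with $c$ the number of closed loops otherwise. For $1\le i<m$ let $e_i\in TL_m$ be the basis element whose diagram pairs $i$ with $i+1$, $2m-i$ with $2m-i+1$, and every other $j$ with $2m-j+1$. Regard a half-diagram as a bracket sequence, with an opening bracket at each through-string and at the smaller point of each pair and a closing bracket at the larger point of each pair; let $h_i(\mathfrak a)$ be the number of opening minus the number of closing brackets among the first $i$. If $\mathfrak a$ has a closing bracket at $i$ and an opening bracket at $i+1$, let $\Diamond_i(\mathfrak a)$ be the half-diagram obtained by exchanging these two brackets. The second basis $\xi'_{\mathfrak a}$ of $U(m)$ is defined by $\xi'_{\mathfrak a}=\xi_{\mathfrak a}$ if $\mathfrak a$ is not of the form $\Diamond_i(\mathfrak b)$ (that is, $\mathfrak a$ is minimal among the half-diagrams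 with its number of through-strings) and $\xi'_{\Diamond_i(\mathfrak a)}=(e_i-\mu_{h_i(\mathfrak a)+1})\xi'_{\mathfrak a}$. For a noncrossing pairing $\mathfrak p$ of $\{1,\dots,2n\}$ let $e'_{\mathfrak p}\in TL_n$ be the element that corresponds to $\xi'_{\mathfrak p}\in U(2n)$ under $e_{\mathfrak r}\leftrightarrow\xi_{\mathfrak r}$. For half-diagrams $\mathfrak a,\mathfrak b$ on $n$ points with the same number of through-strings, $\mathfrak a\otimes\mathfrak b$ is the noncrossing pairing of $\{1,\dots,2n\}$ whose point $i$ is the $i$th point of $\mathfrak a$ and whose point $2n-i+1$ is the $i$th point of $\mathfrak b$, for $1\le i\le n$, the through-strings of $\mathfrak a$ and $\mathfrak b$ being connected in order. Then, for all half-diagrams $\mathfrak a,\mathfrak b$ on $n$ points with the same number of through-strings: (i) $e'_{\mathfrak a\otimes\mathfrak b}\,\xi'_{\mathfrak c}=0$ for every half-diagram $\mathfrak c\neq\mathfrak b$ on $n$ points (with any number of through-strings); (ii) $e'_{\mathfrak a\otimes\mathfrak b}\,\xi'_{\mathfrak b}=\langle\xi'_{\mathfrak b},\xi'_{\mathfrak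 b}\rangle\,\xi'_{\mathfrak a}$. -/

import Mathlib

namespace TemperleyLieb

/-- A noncrossing half-diagram on `n` points (the points `1, …, n` are `0, …, n - 1` here), given
by its partner involution: the fixed points are the points with a through-string. -/
@[ext] structure HalfDiagram (n : ℕ) where
  partner : Fin n → Fin n
  partner_partner : ∀ i, partner (partner i) = i
  noncrossing : ∀ i j k l, i < k → k < j → j < l → partner i = j → partner k ≠ l
  noncrossing_through : ∀ i j k, i < k → k < j → partner i = j → partner k ≠ k

/-- A noncrossing pairing (full diagram) on `2 * n` points: a half-diagram on `2 * n` points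
without through-strings. -/
def Pairing (n : ℕ) : Type := {p : HalfDiagram (2 * n) // ∀ x, p.partner x ≠ x}

/-- The points of a half-diagram with a through-string. -/
def HalfDiagram.through {n : ℕ} (a : HalfDiagram n) : Finset (Fin n) :=
  Finset.univ.filter fun i => a.partner i = i

/-- `U(n)`: formal complex linear combinations of half-diagrams on `n` points. -/
abbrev U (n : ℕ) : Type := HalfDiagram n →₀ ℂ

/-- `TL_n`: formal complex linear combinations of noncrossing pairings on `2 * n` points. -/
abbrev TL (n : ℕ) : Type := Pairing n →₀ ℂ

/-- The `i`-th point on the left side of a full diagram. -/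
def leftPt {n : ℕ} (i : Fin n) : Fin (2 * n) := ⟨i, by omega⟩

/-- The `i`-th point from the top on the right side of a full diagram: in the numbering from `1`
to `2 * n`, the point `2 * n - i + 1`. -/
def rightPt {n : ℕ} (i : Fin n) : Fin (2 * n) := ⟨2 * n - 1 - i, by omega⟩

/-! ### The action of `TL_n` on `U(n)` -/

/-- The concatenation of a full diagram `p` and a half-diagram `a`, on the points of `p`: the
`i`-th point of `a` is identified with the `i`-th point on the right of `p`. Its connected
components are the edge paths and closed loops of the concatenation. -/
def concatGraph {n : ℕ} (p : Pairing n) (a : HalfDiagram n) : SimpleGraph (Fin (2 * n)) :=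
  SimpleGraph.fromRel fun x y =>
    p.1.partner x = y ∨ ∃ i : Fin n, x = rightPt i ∧ y = rightPt (a.partner i)

/-- Some edge path of the concatenation joins two different through-strings of `a`. -/
def concatJoinsThrough {n : ℕ} (p : Pairing n) (a : HalfDiagram n) : Prop :=
  ∃ s t : Fin n, s ≠ t ∧ a.partner s = s ∧ a.partner t = t ∧
    (concatGraph p a).Reachable (rightPt s) (rightPt t)

/-- The number of closed loops of the concatenation: the components which contain neither a left
point nor a through-string. -/
noncomputable def concatLoops {n : ℕ} (p : Pairing n) (a : HalfDiagram n) : ℕ :=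
  Set.ncard {K : (concatGraph p a).ConnectedComponent |
    (∀ i : Fin n, (concatGraph p a).connectedComponentMk (leftPt i) ≠ K) ∧
    ∀ s : Fin n, a.partner s = s → (concatGraph p a).connectedComponentMk (rightPt s) ≠ K}

/-- `b` is the half-diagram left by the concatenation after deletion of the closed loops and of the
identified points: two points are paired if an edge path joins them. -/
def IsConcat {n : ℕ} (p : Pairing n) (a b : HalfDiagram n) : Prop :=
  ∀ i j : Fin n, i ≠ j →
    (b.partner i = j ↔ (concatGraph p a).Reachable (leftPt i) (leftPt j))

open Classical in
/-- The action of a basis element on a basis element: `0` if two through-strings are joined, and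
`q ^ c • ξ_b` otherwise, with `c` the number of closed loops and `b` the (unique) half-diagram
left by the concatenation. -/
noncomputable def actBasis (q : ℝ) {n : ℕ} (p : Pairing n) (a : HalfDiagram n) : U n :=
  if h : ¬ concatJoinsThrough p a ∧ ∃ b, IsConcat p a b then
    Finsupp.single h.2.choose ((q : ℂ) ^ concatLoops p a)
  else 0

/-- The action of `TL_n` on `U(n)`, extended linearly in both arguments. -/
noncomputable def act (q : ℝ) {n : ℕ} : TL n →ₗ[ℂ] U n →ₗ[ℂ] U n :=
  Finsupp.linearCombination ℂ fun p => Finsupp.linearCombination ℂ fun a => actBasis q p a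

/-! ### The sesquilinear form on `U(n)` -/

/-- Two half-diagrams glued along their points. -/
def glueGraph {n : ℕ} (a b : HalfDiagram n) : SimpleGraph (Fin n) :=
  SimpleGraph.fromRel fun x y => a.partner x = y ∨ b.partner x = y

/-- Some edge path of the glued diagram joins two different through-strings of the same side. -/
def glueJoinsThrough {n : ℕ} (a b : HalfDiagram n) : Prop :=
  ∃ s t : Fin n, s ≠ t ∧ (glueGraph a b).Reachable s t ∧
    ((a.partner s = s ∧ a.partner t = t) ∨ (b.partner s = s ∧ b.partner t = t))

/-- The number of closed loops of the glued diagram: the components without a through-string. -/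
noncomputable def glueLoops {n : ℕ} (a b : HalfDiagram n) : ℕ :=
  Set.ncard {K : (glueGraph a b).ConnectedComponent |
    ∀ s : Fin n, (a.partner s = s ∨ b.partner s = s) →
      (glueGraph a b).connectedComponentMk s ≠ K}

open Classical in
/-- The value `⟨ξ_a, ξ_b⟩`. -/
noncomputable def formBasis (q : ℝ) {n : ℕ} (a b : HalfDiagram n) : ℂ :=
  if glueJoinsThrough a b then 0 else (q : ℂ) ^ glueLoops a b

/-- The sesquilinear form `⟨x, y⟩` on `U(n)`, linear in `x` and conjugate linear in `y`. -/
noncomputable def form (q : ℝ) {n : ℕ} (x y : U n) : ℂ :=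
  x.sum fun a s => y.sum fun b t => s * (starRingEnd ℂ) t * formBasis q a b

/-! ### The generators -/

/-- The diagram of the generator which pairs the adjacent left points with indices `i`, `i + 1`
(counted from `0`), the corresponding right points, and every other point with the point on the
opposite side. -/
def genDiagram {n : ℕ} (i : ℕ) (hi : i + 1 < n) : Pairing n :=
  ⟨{ partner := fun x =>
      ⟨if x.val = i then i + 1
        else if x.val = i + 1 then i
        else if x.val = 2 * n - 1 - i then 2 * n - 2 - i
        else if x.val = 2 * n - 2 - i then 2 * n - 1 - i
        else 2 * n - 1 - x.val, by have hx := x.isLt; split_ifs <;> omega⟩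
     partner_partner := by
      intro x
      apply Fin.ext
      have hx := x.isLt
      dsimp only
      split_ifs <;> omega
     noncrossing := by
      intro x y z w h1 h2 h3 h4 h5
      have hx := x.isLt
      have hw := w.isLt
      rw [Fin.lt_def] at h1 h2 h3
      have h4' := congrArg Fin.val h4
      have h5' := congrArg Fin.val h5
      clear h4 h5
      dsimp only at h4' h5'
      split_ifs at h4' h5' <;> omega
     noncrossing_through := by
      intro x y z h1 h2 h4 h5
      have hx := x.isLt
      have hy := y.isLt
      rw [Fin.lt_def] at h1 h2
      have h4' := congrArg Fin.val h4
      have h5' := congrArg Fin.val h5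
      clear h4 h5
      dsimp only at h4' h5'
      split_ifs at h4' h5' <;> omega }, by
    intro x h
    have hx := x.isLt
    have h' := congrArg Fin.val h
    clear h
    dsimp only at h'
    split_ifs at h' <;> omega⟩

/-! ### Bracket sequences, heights and box addition -/

/-- The `i`-th bracket is an opening bracket: `i` has a through-string or a greater partner. -/
def HalfDiagram.Opens {n : ℕ} (a : HalfDiagram n) (i : Fin n) : Prop := i ≤ a.partner i

instance {n : ℕ} (a : HalfDiagram n) (i : Fin n) : Decidable (a.Opens i) :=
  inferInstanceAs (Decidable (i ≤ a.partner i))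

/-- The height after `k` steps: opening brackets minus closing brackets among the first `k`. -/
def HalfDiagram.height {n : ℕ} (a : HalfDiagram n) (k : ℕ) : ℤ :=
  ∑ i : Fin n, if i.val < k then (if a.Opens i then 1 else -1) else 0

/-- `a` is obtained from `b`, which has a closing bracket at index `i` and an opening bracket at
index `i + 1` (counted from `0`), by exchanging these two brackets: box addition at the
position after `i + 1` steps. -/
structure IsBoxAddition {n : ℕ} (b : HalfDiagram n) (i : ℕ) (hi : i + 1 < n)
    (a : HalfDiagram n) : Prop where
  close_left : ¬ b.Opens ⟨i, by omega⟩
  open_right : b.Opens ⟨i + 1, hi⟩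
  open_left : a.Opens ⟨i, by omega⟩
  close_right : ¬ a.Opens ⟨i + 1, hi⟩
  other : ∀ j : Fin n, j.val ≠ i → j.val ≠ i + 1 → (a.Opens j ↔ b.Opens j)

/-- A way to write `a` as a box addition. -/
structure BoxRemoval {n : ℕ} (a : HalfDiagram n) where
  base : HalfDiagram n
  idx : ℕ
  idx_lt : idx + 1 < n
  isBoxAddition : IsBoxAddition base idx idx_lt a

/-- The sum of the indices of the closing brackets; box addition increases it. -/
def HalfDiagram.closeSum {n : ℕ} (a : HalfDiagram n) : ℕ :=
  ∑ i : Fin n, if a.Opens i then 0 else i.val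

theorem BoxRemoval.closeSum_lt {n : ℕ} {a : HalfDiagram n} (r : BoxRemoval a) :
    r.base.closeSum < a.closeSum := by
  obtain ⟨b, i, hi, h⟩ := r
  dsimp only
  unfold HalfDiagram.closeSum
  set x : Fin n := ⟨i, by omega⟩ with hx
  set y : Fin n := ⟨i + 1, hi⟩ with hy
  have hxy : y ∈ Finset.univ.erase x := by
    simp [hx, hy, Fin.ext_iff]
  rw [← Finset.add_sum_erase _ _ (Finset.mem_univ x), ← Finset.add_sum_erase _ _ hxy,
    ← Finset.add_sum_erase (Finset.univ) (fun j : Fin n => if a.Opens j then 0 else j.val)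
      (Finset.mem_univ x), ← Finset.add_sum_erase _ _ hxy,
    if_neg h.close_left, if_pos h.open_right, if_pos h.open_left, if_neg h.close_right]
  have hs : ∑ j ∈ (Finset.univ.erase x).erase y, (if b.Opens j then 0 else j.val)
      = ∑ j ∈ (Finset.univ.erase x).erase y, (if a.Opens j then 0 else j.val) := by
    apply Finset.sum_congr rfl
    intro j hj
    simp only [Finset.mem_erase, Finset.mem_univ, and_true, hx, hy, ne_eq, Fin.ext_iff] at hj
    simp only [h.other j hj.2 hj.1]
  rw [hs]
  simp [hx, hy]

/-! ### The second basis -/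

/-- The Chebyshev polynomials evaluated at `q`: `Δ_{-1} = 0`, `Δ_0 = 1` and
`Δ_{k+1} = q Δ_k - Δ_{k-1}`. -/
noncomputable def chebDelta (q : ℝ) (k : ℤ) : ℝ := (Polynomial.Chebyshev.S ℝ k).eval q

/-- `μ_k = Δ_{k-1} / Δ_k`. -/
noncomputable def chebMu (q : ℝ) (k : ℤ) : ℝ := chebDelta q (k - 1) / chebDelta q k

open Classical in
/-- The second basis of `U(n)`. If `a` is the result of a box addition to `b` at position `i`, then
`ξ'_a = (e_i - μ_{h_i(b)+1}) ξ'_b` (all ways to write `a` as a box addition give the same vector;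
one of them is picked here). If `a` is not the result of a box addition, it is the minimal
half-diagram with its number of through-strings, and `ξ'_a = ξ_a`. -/
noncomputable def xiPrime (q : ℝ) {n : ℕ} (a : HalfDiagram n) : U n :=
  if h : Nonempty (BoxRemoval a) then
    act q (Finsupp.single (genDiagram h.some.idx h.some.idx_lt) 1) (xiPrime q h.some.base)
      - (chebMu q (h.some.base.height (h.some.idx + 1) + 1) : ℂ) • xiPrime q h.some.base
  else Finsupp.single a 1
termination_by a.closeSum
decreasing_by all_goals exact h.some.closeSum_lt

/-- The second basis of `TL_n`: the element of `TL_n` which corresponds to `ξ'_p ∈ U(2n)`, a linear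
combination of half-diagrams without through-strings, that is, of pairings. -/
noncomputable def ePrime (q : ℝ) {n : ℕ} (p : Pairing n) : TL n :=
  Finsupp.subtypeDomain (fun d : HalfDiagram (2 * n) => ∀ x, d.partner x ≠ x) (xiPrime q p.1)

/-! ### The full diagram `a ⊗ b` -/

/-- The order isomorphism between the through-strings of two half-diagrams with equally many. -/
def throughIso {n : ℕ} {a b : HalfDiagram n} (h : a.through.card = b.through.card) :
    a.through ≃o b.through :=
  (a.through.orderIsoOfFin h).symm.trans (b.through.orderIsoOfFin rfl)

/-- The partner function of `a ⊗ b`: the left points are paired as in `a`, the right points as in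
`b`, and the through-strings of `a` and of `b` are connected in order. -/
def tensorPartner {n : ℕ} (a b : HalfDiagram n) (h : a.through.card = b.through.card)
    (x : Fin (2 * n)) : Fin (2 * n) :=
  if hx : x.val < n then
    if ha : (⟨x.val, hx⟩ : Fin n) ∈ a.through then rightPt (throughIso h ⟨⟨x.val, hx⟩, ha⟩).1
    else leftPt (a.partner ⟨x.val, hx⟩)
  else
    if hb : (⟨2 * n - 1 - x.val, by omega⟩ : Fin n) ∈ b.through then
      leftPt ((throughIso h).symm ⟨⟨2 * n - 1 - x.val, by omega⟩, hb⟩).1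
    else rightPt (b.partner ⟨2 * n - 1 - x.val, by omega⟩)

theorem eq_leftPt_or_eq_rightPt {n : ℕ} (x : Fin (2 * n)) :
    (∃ i : Fin n, x = leftPt i) ∨ ∃ i : Fin n, x = rightPt i := by
  by_cases hx : x.val < n
  · exact Or.inl ⟨⟨x.val, hx⟩, rfl⟩
  · refine Or.inr ⟨⟨2 * n - 1 - x.val, by omega⟩, ?_⟩
    apply Fin.ext
    have := x.isLt
    simp only [rightPt]
    omega

theorem leftPt_lt_leftPt {n : ℕ} {i j : Fin n} : leftPt i < leftPt j ↔ i < j := Iff.rfl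

theorem rightPt_lt_rightPt {n : ℕ} {i j : Fin n} : rightPt i < rightPt j ↔ j < i := by
  simp only [rightPt, Fin.lt_def]
  omega

theorem leftPt_lt_rightPt {n : ℕ} {i j : Fin n} : leftPt i < rightPt j := by
  simp only [leftPt, rightPt, Fin.lt_def]
  omega

theorem leftPt_inj {n : ℕ} {i j : Fin n} : leftPt i = leftPt j ↔ i = j := by
  simp [leftPt, Fin.ext_iff]

theorem rightPt_inj {n : ℕ} {i j : Fin n} : rightPt i = rightPt j ↔ i = j := by
  simp only [rightPt, Fin.ext_iff]
  omega

theorem HalfDiagram.mem_through {n : ℕ} {a : HalfDiagram n} {i : Fin n} :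
    i ∈ a.through ↔ a.partner i = i := by
  simp [HalfDiagram.through]

section
variable {n : ℕ} {a b : HalfDiagram n} (h : a.through.card = b.through.card)

theorem tensorPartner_leftPt_of_mem {i : Fin n} (hi : i ∈ a.through) :
    tensorPartner a b h (leftPt i) = rightPt (throughIso h ⟨i, hi⟩).1 := by
  simp [tensorPartner, leftPt, hi]

theorem tensorPartner_leftPt_of_notMem {i : Fin n} (hi : i ∉ a.through) :
    tensorPartner a b h (leftPt i) = leftPt (a.partner i) := by
  simp [tensorPartner, leftPt, hi]

theorem rightPt_sub {i : Fin n} (hx : 2 * n - 1 - (rightPt i).val < n) :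
    (⟨2 * n - 1 - (rightPt i).val, hx⟩ : Fin n) = i := by
  apply Fin.ext
  simp only [rightPt]
  omega

theorem not_rightPt_lt {i : Fin n} : ¬ (rightPt i).val < n := by
  simp only [rightPt]
  omega

theorem tensorPartner_rightPt_of_mem {i : Fin n} (hi : i ∈ b.through) :
    tensorPartner a b h (rightPt i) = leftPt ((throughIso h).symm ⟨i, hi⟩).1 := by
  simp [tensorPartner, not_rightPt_lt, rightPt_sub, hi]

theorem tensorPartner_rightPt_of_notMem {i : Fin n} (hi : i ∉ b.through) :
    tensorPartner a b h (rightPt i) = rightPt (b.partner i) := by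
  simp [tensorPartner, not_rightPt_lt, rightPt_sub, hi]

theorem HalfDiagram.partner_notMem {i : Fin n} (hi : i ∉ a.through) :
    a.partner i ∉ a.through := by
  rw [HalfDiagram.mem_through] at hi ⊢
  rw [a.partner_partner]
  exact fun h => hi h.symm

theorem tensorPartner_tensorPartner (x : Fin (2 * n)) :
    tensorPartner a b h (tensorPartner a b h x) = x := by
  rcases eq_leftPt_or_eq_rightPt x with ⟨i, rfl⟩ | ⟨i, rfl⟩
  · by_cases hi : i ∈ a.through
    · rw [tensorPartner_leftPt_of_mem h hi,
        tensorPartner_rightPt_of_mem h (throughIso h ⟨i, hi⟩).2]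
      simp
    · rw [tensorPartner_leftPt_of_notMem h hi,
        tensorPartner_leftPt_of_notMem h (HalfDiagram.partner_notMem hi), a.partner_partner]
  · by_cases hi : i ∈ b.through
    · rw [tensorPartner_rightPt_of_mem h hi,
        tensorPartner_leftPt_of_mem h ((throughIso h).symm ⟨i, hi⟩).2]
      simp
    · rw [tensorPartner_rightPt_of_notMem h hi,
        tensorPartner_rightPt_of_notMem h (HalfDiagram.partner_notMem hi), b.partner_partner]

theorem tensorPartner_ne (x : Fin (2 * n)) : tensorPartner a b h x ≠ x := by
  rcases eq_leftPt_or_eq_rightPt x with ⟨i, rfl⟩ | ⟨i, rfl⟩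
  · by_cases hi : i ∈ a.through
    · rw [tensorPartner_leftPt_of_mem h hi]
      exact leftPt_lt_rightPt.ne'
    · rw [tensorPartner_leftPt_of_notMem h hi]
      exact fun h' => hi (HalfDiagram.mem_through.2 (leftPt_inj.1 h'))
  · by_cases hi : i ∈ b.through
    · rw [tensorPartner_rightPt_of_mem h hi]
      exact leftPt_lt_rightPt.ne
    · rw [tensorPartner_rightPt_of_notMem h hi]
      exact fun h' => hi (HalfDiagram.mem_through.2 (rightPt_inj.1 h'))

theorem tensorPartner_noncrossing (x y : Fin (2 * n)) (h1 : x < y)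
    (h2 : y < tensorPartner a b h x) :
    ¬ tensorPartner a b h x < tensorPartner a b h y := by
  intro h3
  rcases eq_leftPt_or_eq_rightPt x with ⟨i, rfl⟩ | ⟨i, rfl⟩
  · by_cases hi : i ∈ a.through
    · rw [tensorPartner_leftPt_of_mem h hi] at h2 h3
      rcases eq_leftPt_or_eq_rightPt y with ⟨k, rfl⟩ | ⟨k, rfl⟩
      · by_cases hk : k ∈ a.through
        · rw [tensorPartner_leftPt_of_mem h hk, rightPt_lt_rightPt, Subtype.coe_lt_coe,
            OrderIso.lt_iff_lt, Subtype.mk_lt_mk] at h3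
          exact absurd (leftPt_lt_leftPt.1 h1) h3.not_gt
        · rw [tensorPartner_leftPt_of_notMem h hk] at h3
          exact absurd h3 leftPt_lt_rightPt.not_gt
      · by_cases hk : k ∈ b.through
        · rw [tensorPartner_rightPt_of_mem h hk] at h3
          exact absurd h3 leftPt_lt_rightPt.not_gt
        · rw [tensorPartner_rightPt_of_notMem h hk, rightPt_lt_rightPt] at h3
          rw [rightPt_lt_rightPt] at h2
          exact b.noncrossing_through _ _ _ h3 h2 (b.partner_partner k)
            (HalfDiagram.mem_through.1 (throughIso h ⟨i, hi⟩).2)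
    · rw [tensorPartner_leftPt_of_notMem h hi] at h2 h3
      rcases eq_leftPt_or_eq_rightPt y with ⟨k, rfl⟩ | ⟨k, rfl⟩
      · rw [leftPt_lt_leftPt] at h1 h2
        by_cases hk : k ∈ a.through
        · exact a.noncrossing_through _ _ _ h1 h2 rfl (HalfDiagram.mem_through.1 hk)
        · rw [tensorPartner_leftPt_of_notMem h hk, leftPt_lt_leftPt] at h3
          exact a.noncrossing _ _ _ _ h1 h2 h3 rfl rfl
      · exact absurd h2 leftPt_lt_rightPt.not_gt
  · rcases eq_leftPt_or_eq_rightPt y with ⟨k, rfl⟩ | ⟨k, rfl⟩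
    · exact absurd h1 leftPt_lt_rightPt.not_gt
    · by_cases hi : i ∈ b.through
      · rw [tensorPartner_rightPt_of_mem h hi] at h2
        exact absurd h2 leftPt_lt_rightPt.not_gt
      · rw [tensorPartner_rightPt_of_notMem h hi] at h2 h3
        rw [rightPt_lt_rightPt] at h1 h2
        by_cases hk : k ∈ b.through
        · exact b.noncrossing_through _ _ _ h2 h1 (b.partner_partner i)
            (HalfDiagram.mem_through.1 hk)
        · rw [tensorPartner_rightPt_of_notMem h hk, rightPt_lt_rightPt] at h3
          exact b.noncrossing _ _ _ _ h3 h2 h1 (b.partner_partner k) (b.partner_partner i)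

end

/-- The full diagram `a ⊗ b`. -/
def tensor {n : ℕ} (a b : HalfDiagram n) (h : a.through.card = b.through.card) : Pairing n :=
  ⟨{ partner := tensorPartner a b h
     partner_partner := tensorPartner_tensorPartner h
     noncrossing := by
      rintro x _ y _ h1 h2 h3 rfl rfl
      exact tensorPartner_noncrossing h x y h1 h2 h3
     noncrossing_through := fun _ _ y _ _ _ => tensorPartner_ne h y }, tensorPartner_ne h⟩

end TemperleyLieb

/-! Both claims follow from one rank-one formula, `act_xiPrime_tensor`: e'_{a⊗b} x = ⟨x, ξ'_b⟩ ξ'_a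
for every x in U(n). Claim (ii) is the case x = ξ'_b, and claim (i) adds the orthogonality of the
second basis, `form_xiPrime_of_ne`.

The generators act locally on the second basis, according to the shape of the bracket path at i. At
a valley, e_i ξ'_a is the vector of the box addition plus a multiple of ξ'_a. At a peak that carries
a box, e_i maps ξ'_a to a combination of ξ'_a and the vector without the box. At a peak standing on
height 0 it is multiplication by q, and on a slope it is 0. The slope case, `gen_xiPrime_slope`, is
the heart of the matter: induction over boxes and the relation e_i e_j e_i = e_i for neighbours
reduce it to μ_{h+1}(q - μ_h) = 1, the Chebyshev recursion. All heights that occur are at most n,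
even for pairings of 2n points, so the non-vanishing of Δ_1, …, Δ_{n-1} is enough.

For orthogonality, the generators are self-adjoint (`form_gen`), so a box can be moved from one
argument of the form to the other. What remains is the case of a minimal half-diagram m, settled by
`map_xiPrime_eq_zero`: a linear map that absorbs the generators in the way ξ_m does is zero at every
ξ'_c with c ≠ m.

For the rank-one formula, the word of a ⊗ b is the word of a followed by the reversed and exchanged
word of b. A box added to a or to b is therefore a box added to a ⊗ b, and it amounts to
multiplication by a generator from the left or from the right. This reduces the formula to a = b = m
minimal. There `map_xiPrime_eq_zero` treats ξ'_c with c ≠ m, and on ξ_m itself only the leading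
diagram m ⊗ m survives, since all other diagrams in e'_{m⊗m} join two through-strings of m
(`joins_of_ne_tensor`).

The diagrammatic facts (relations between generators, self-adjointness, the two multiplications) are
checked in a colour model. For q = N, a half-diagram becomes the indicator function of the
colourings by N colours that are constant on pairs and injective on through-strings. Concatenation
becomes summation over the colours of the identified points, and a closed loop contributes N. The
model is faithful for N ≥ n (`colour_injective`), and both sides of each identity are polynomial in
q, so the identity holds for all q. -/

namespace TemperleyLieb

/-! ### Bracket words and heights -/

/-- The bracket word of a half-diagram: there is an opening bracket at index `k`. -/
def HalfDiagram.up {n : ℕ} (a : HalfDiagram n) (k : ℕ) : Prop := ∃ h : k < n, a.Opens ⟨k, h⟩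

theorem HalfDiagram.up_val {n : ℕ} (a : HalfDiagram n) (i : Fin n) : a.up i ↔ a.Opens i :=
  ⟨fun h => h.2, fun h => ⟨i.2, h⟩⟩

theorem HalfDiagram.up_of_lt {n : ℕ} (a : HalfDiagram n) {k : ℕ} (hk : k < n) :
    a.up k ↔ a.Opens ⟨k, hk⟩ := a.up_val ⟨k, hk⟩

/-- The contribution of a bracket to the height. -/
def HalfDiagram.sign {n : ℕ} (a : HalfDiagram n) (i : Fin n) : ℤ := if a.Opens i then 1 else -1

theorem HalfDiagram.opens_partner {n : ℕ} {a : HalfDiagram n} {i : Fin n} (h : ¬ a.Opens i) :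
    a.Opens (a.partner i) := by
  unfold HalfDiagram.Opens at *
  rw [a.partner_partner]
  exact (not_le.1 h).le

theorem HalfDiagram.partner_lt {n : ℕ} {a : HalfDiagram n} {i : Fin n} (h : ¬ a.Opens i) :
    a.partner i < i := not_le.1 h

theorem HalfDiagram.partner_injective {n : ℕ} (a : HalfDiagram n) :
    Function.Injective a.partner :=
  (show Function.Involutive a.partner from a.partner_partner).injective

/-- Each closing bracket in `S` is compensated by its own opening partner, which also lies in `S`.
-/
theorem HalfDiagram.sum_sign_nonneg {n : ℕ} (a : HalfDiagram n) (S : Finset (Fin n))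
    (hS : ∀ x ∈ S, ¬ a.Opens x → a.partner x ∈ S) : 0 ≤ ∑ x ∈ S, a.sign x := by
  unfold HalfDiagram.sign
  rw [Finset.sum_ite, Finset.sum_const, Finset.sum_const]
  have : (S.filter fun x => ¬ a.Opens x).card ≤ (S.filter fun x => a.Opens x).card := by
    apply Finset.card_le_card_of_injOn a.partner
    · intro x hx
      rw [Finset.mem_coe, Finset.mem_filter] at hx ⊢
      exact ⟨hS x hx.1 hx.2, HalfDiagram.opens_partner hx.2⟩
    · exact a.partner_injective.injOn
  simp only [nsmul_eq_mul, mul_one, mul_neg]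
  omega

/-- The two brackets of a pair cancel, and only through-strings contribute. -/
theorem HalfDiagram.sum_sign_eq {n : ℕ} (a : HalfDiagram n) (S : Finset (Fin n))
    (hS : ∀ x ∈ S, a.partner x ∈ S) :
    ∑ x ∈ S, a.sign x = (S.filter fun x => a.partner x = x).card := by
  rw [Finset.card_filter, Nat.cast_sum, ← sub_eq_zero, ← Finset.sum_sub_distrib]
  refine Finset.sum_involution (fun x _ => a.partner x) ?_ ?_ (fun x hx => hS x hx)
    (fun x _ => a.partner_partner x)
  · intro x _
    by_cases hx : a.partner x = x
    · simp [HalfDiagram.sign, HalfDiagram.Opens, hx]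
    · have hx' : ¬ x = a.partner x := fun h => hx h.symm
      simp only [HalfDiagram.sign, HalfDiagram.Opens, a.partner_partner, hx, hx', if_false]
      rcases lt_or_gt_of_ne hx with h | h
      · simp [h.le, h.not_ge]
      · simp [h.le, h.not_ge]
  · intro x _ h h'
    apply h
    simp [HalfDiagram.sign, HalfDiagram.Opens, h']

theorem HalfDiagram.height_eq_sum {n : ℕ} (a : HalfDiagram n) (k : ℕ) :
    a.height k = ∑ x ∈ Finset.univ.filter (fun x : Fin n => x.val < k), a.sign x := by
  unfold HalfDiagram.height HalfDiagram.sign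
  rw [Finset.sum_filter]

theorem HalfDiagram.height_add_sum {n : ℕ} (a : HalfDiagram n) {k l : ℕ} (h : k ≤ l) :
    a.height l = a.height k +
      ∑ x ∈ Finset.univ.filter (fun x : Fin n => k ≤ x.val ∧ x.val < l), a.sign x := by
  rw [a.height_eq_sum, a.height_eq_sum, ← Finset.sum_union]
  · congr 1
    ext x
    simp only [Finset.mem_filter, Finset.mem_univ, true_and, Finset.mem_union]
    omega
  · rw [Finset.disjoint_left]
    intro x
    simp only [Finset.mem_filter, Finset.mem_univ, true_and]
    omega

theorem HalfDiagram.height_zero {n : ℕ} (a : HalfDiagram n) : a.height 0 = 0 := by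
  simp [HalfDiagram.height]

theorem HalfDiagram.height_succ_val {n : ℕ} (a : HalfDiagram n) (i : Fin n) :
    a.height (i + 1) = a.height i + a.sign i := by
  rw [a.height_add_sum (Nat.le_succ i)]
  congr 1
  rw [Finset.sum_eq_single_of_mem i]
  · simp
  · intro x hx hxi
    simp only [Finset.mem_filter, Finset.mem_univ, true_and] at hx
    exact absurd (Fin.ext (by omega)) hxi

theorem HalfDiagram.height_succ_of_up {n : ℕ} (a : HalfDiagram n) {k : ℕ} (h : a.up k) :
    a.height (k + 1) = a.height k + 1 := by
  rw [a.height_succ_val ⟨k, h.1⟩, HalfDiagram.sign, if_pos h.2]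

theorem HalfDiagram.height_succ_of_not_up {n : ℕ} (a : HalfDiagram n) {k : ℕ} (hk : k < n)
    (h : ¬ a.up k) : a.height (k + 1) = a.height k - 1 := by
  rw [a.height_succ_val ⟨k, hk⟩, HalfDiagram.sign, if_neg fun h' => h ⟨hk, h'⟩]
  rfl

theorem HalfDiagram.height_nonneg {n : ℕ} (a : HalfDiagram n) (k : ℕ) : 0 ≤ a.height k := by
  rw [a.height_eq_sum]
  apply a.sum_sign_nonneg
  intro x hx h
  have := a.partner_lt h
  simp only [Finset.mem_filter, Finset.mem_univ, true_and] at hx ⊢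
  exact lt_trans this hx

theorem HalfDiagram.height_total {n : ℕ} (a : HalfDiagram n) :
    a.height n = a.through.card := by
  rw [a.height_eq_sum, Finset.filter_true_of_mem fun x _ => x.2]
  exact a.sum_sign_eq _ fun _ _ => Finset.mem_univ _

theorem HalfDiagram.height_le_self {n : ℕ} (a : HalfDiagram n) (k : ℕ) : a.height k ≤ k := by
  induction k with
  | zero => simp [a.height_zero]
  | succ k ih =>
    by_cases hk : k < n
    · by_cases h : a.up k
      · rw [a.height_succ_of_up h]; push_cast; omega
      · rw [a.height_succ_of_not_up hk h]; push_cast; omega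
    · rw [a.height_add_sum (Nat.le_succ k), Finset.filter_false_of_mem]
      · push_cast; simp; omega
      · intro x _; omega

theorem HalfDiagram.height_le_of_le {n : ℕ} (a : HalfDiagram n) {k : ℕ} (hk : n ≤ k) :
    a.height k = a.height n := by
  rw [a.height_add_sum hk, Finset.filter_false_of_mem]
  · simp
  · intro x _; omega

theorem HalfDiagram.height_le {n : ℕ} (a : HalfDiagram n) (k : ℕ) : a.height k ≤ n := by
  rcases le_total k n with h | h
  · have := a.height_le_self k; omega
  · rw [a.height_le_of_le h]; exact a.height_le_self n

theorem HalfDiagram.height_le_add {n : ℕ} (a : HalfDiagram n) (k j : ℕ) (hk : k + j ≤ n) :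
    a.height k ≤ a.height (k + j) + j := by
  induction j with
  | zero => simp
  | succ j ih =>
    have := ih (by omega)
    by_cases h : a.up (k + j)
    · rw [← add_assoc, a.height_succ_of_up h]; push_cast; omega
    · rw [← add_assoc, a.height_succ_of_not_up (by omega) h]; push_cast; omega

/-- The string opened at `i` is still open before `k`. By planarity every bracket that closes
strictly between them was also opened there, so the part in between cannot lower the height. -/
theorem HalfDiagram.height_lt_of_inside {n : ℕ} (a : HalfDiagram n) {i : Fin n} {k : ℕ}
    (hik : i.val < k) (h : a.partner i = i ∨ k ≤ (a.partner i).val) :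
    a.height i + 1 ≤ a.height k := by
  have hi : a.sign i = 1 := by
    rw [HalfDiagram.sign, if_pos]
    rcases h with h | h
    · exact h.ge
    · exact Fin.le_def.2 (by omega)
  have h1 := a.height_succ_val i
  rw [hi] at h1
  rw [← h1, a.height_add_sum (show i.val + 1 ≤ k from hik)]
  have : 0 ≤ ∑ x ∈ Finset.univ.filter (fun x : Fin n => i.val + 1 ≤ x.val ∧ x.val < k),
      a.sign x := by
    apply a.sum_sign_nonneg
    intro x hx hx'
    have hlt := a.partner_lt hx'
    simp only [Finset.mem_filter, Finset.mem_univ, true_and, Fin.lt_def] at hx hlt ⊢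
    refine ⟨?_, by omega⟩
    by_contra hc
    rcases Nat.lt_or_eq_of_le (show (a.partner x).val ≤ i.val by omega) with h2 | h2
    · rcases h with h | h
      · exact a.noncrossing_through _ _ _ (Fin.lt_def.2 h2) (Fin.lt_def.2 (by omega))
          (a.partner_partner x) h
      · exact a.noncrossing _ _ _ _ (Fin.lt_def.2 h2) (Fin.lt_def.2 (by omega))
          (Fin.lt_def.2 (by omega)) (a.partner_partner x) (rfl : a.partner i = a.partner i)
    · have h3 : a.partner x = i := Fin.ext h2
      have h4 : a.partner i = x := by rw [← h3, a.partner_partner]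
      rw [h4] at h
      rcases h with h | h
      · subst h; omega
      · omega
  omega

/-- By planarity the points from `i` to its partner are paired among themselves, so their signs
cancel. -/
theorem HalfDiagram.height_partner {n : ℕ} (a : HalfDiagram n) {i : Fin n}
    (h : i < a.partner i) : a.height ((a.partner i).val + 1) = a.height i := by
  rw [a.height_add_sum (show i.val ≤ (a.partner i).val + 1 by rw [Fin.lt_def] at h; omega)]
  have hS : ∀ x ∈ Finset.univ.filter (fun x : Fin n => i.val ≤ x.val ∧
      x.val < (a.partner i).val + 1), a.partner x ∈ Finset.univ.filter
      (fun x : Fin n => i.val ≤ x.val ∧ x.val < (a.partner i).val + 1) ∧ a.partner x ≠ x := by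
    intro x hx
    simp only [Finset.mem_filter, Finset.mem_univ, true_and] at hx ⊢
    by_cases h1 : x = i
    · subst h1
      exact ⟨by rw [Fin.lt_def] at h; omega, h.ne'⟩
    by_cases h2 : x = a.partner i
    · subst h2
      rw [a.partner_partner]
      exact ⟨by rw [Fin.lt_def] at h; omega, h.ne⟩
    have h1' : i < x := lt_of_le_of_ne (Fin.le_def.2 hx.1) (Ne.symm h1)
    have h2' : x < a.partner i := lt_of_le_of_ne (Fin.le_def.2 (by omega)) h2
    refine ⟨⟨?_, ?_⟩, a.noncrossing_through _ _ _ h1' h2' rfl⟩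
    · by_contra hc
      exact a.noncrossing (a.partner x) x i (a.partner i) (Fin.lt_def.2 (by omega)) h1' h2'
        (a.partner_partner x) rfl
    · by_contra hc
      exact a.noncrossing i (a.partner i) x (a.partner x) h1' h2' (Fin.lt_def.2 (by omega))
        rfl rfl
  rw [a.sum_sign_eq _ fun x hx => (hS x hx).1, Finset.filter_false_of_mem fun x hx => (hS x hx).2]
  simp

theorem HalfDiagram.height_congr {n : ℕ} {a b : HalfDiagram n} {k : ℕ}
    (h : ∀ j < k, a.up j ↔ b.up j) : a.height k = b.height k := by
  rw [a.height_eq_sum, b.height_eq_sum]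
  apply Finset.sum_congr rfl
  intro x hx
  simp only [Finset.mem_filter, Finset.mem_univ, true_and] at hx
  have := h x hx
  rw [a.up_val, b.up_val] at this
  simp only [HalfDiagram.sign, this]

/-- Heights depend only on the word, and they locate partners: after the partner of `i` the height
is back at its value before `i`, while a string that is still open keeps the height above that
value. Hence neither diagram can close the string at `i` later than the other does. -/
theorem HalfDiagram.ext_up {n : ℕ} {a b : HalfDiagram n}
    (h : ∀ j < n, a.up j ↔ b.up j) : a = b := by
  have key : ∀ a b : HalfDiagram n, (∀ j < n, a.up j ↔ b.up j) → ∀ i, i < a.partner i →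
      i < b.partner i ∧ b.partner i ≤ a.partner i := by
    intro a b h i hi
    have hh : ∀ k ≤ n, a.height k = b.height k := fun k hk =>
      HalfDiagram.height_congr fun j hj => h j (by omega)
    have h1 := a.height_partner hi
    rw [hh _ (by omega), hh _ (by omega)] at h1
    have h2 : b.Opens i := (b.up_val i).1 ((h i i.2).1 ((a.up_val i).2 hi.le))
    have h3 : ¬ (b.partner i = i ∨ (a.partner i).val + 1 ≤ (b.partner i).val) := by
      intro h3
      have := b.height_lt_of_inside (k := (a.partner i).val + 1)
        (by rw [Fin.lt_def] at hi; omega) h3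
      omega
    push Not at h3
    exact ⟨lt_of_le_of_ne h2 (Ne.symm h3.1), Fin.le_def.2 (by omega)⟩
  have key2 : ∀ i, i < a.partner i → b.partner i = a.partner i := fun i hi =>
    le_antisymm (key a b h i hi).2 (key b a (fun j hj => (h j hj).symm) i (key a b h i hi).1).2
  ext1
  funext i
  rcases lt_trichotomy i (a.partner i) with hi | hi | hi
  · exact (key2 i hi).symm
  · rcases lt_trichotomy i (b.partner i) with hi' | hi' | hi'
    · exact absurd (key b a (fun j hj => (h j hj).symm) i hi').1 (by rw [← hi]; exact lt_irrefl i)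
    · rw [← hi, ← hi']
    · have : b.Opens i := (b.up_val i).1 ((h i i.2).1 ((a.up_val i).2 hi.le))
      exact absurd this hi'.not_ge
  · have := key2 (a.partner i) (by rwa [a.partner_partner])
    rw [a.partner_partner] at this
    rw [← b.partner_partner (a.partner i), this]

/-- Were the closing bracket at `i + 1` opened before `i`, its arc would cover `i`, which could then
neither be a through-string nor be paired with a point beyond `i + 1`. -/
theorem HalfDiagram.partner_of_peak {n : ℕ} (a : HalfDiagram n) {i : ℕ} (hi : i + 1 < n)
    (h1 : a.up i) (h2 : ¬ a.up (i + 1)) :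
    a.partner ⟨i, by omega⟩ = ⟨i + 1, hi⟩ := by
  rw [a.up_of_lt (by omega)] at h1
  rw [a.up_of_lt hi] at h2
  have h3 := a.partner_lt h2
  set y : Fin n := ⟨i + 1, hi⟩ with hy
  set x : Fin n := ⟨i, by omega⟩ with hx
  have hxy : x < y := Fin.lt_def.2 (by simp [hx, hy])
  rcases eq_or_ne (a.partner y) x with h | h
  · rw [← h, a.partner_partner]
  · have h4 : a.partner y < x := by
      rw [Fin.lt_def] at *
      have := Fin.val_ne_of_ne h
      simp only [hx, hy] at *
      omega
    exfalso
    rcases eq_or_lt_of_le (show x ≤ a.partner x from h1) with h5 | h5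
    · exact a.noncrossing_through _ _ _ h4 hxy (a.partner_partner y) h5.symm
    · have h6 : a.partner x ≠ y := fun h' => h (by rw [← h', a.partner_partner])
      refine a.noncrossing _ _ _ _ h4 hxy ?_ (a.partner_partner y) (rfl : a.partner x = _)
      rw [Fin.lt_def] at *
      have := Fin.val_ne_of_ne h6
      simp only [hx, hy] at *
      omega

theorem HalfDiagram.up_of_partner {n : ℕ} (a : HalfDiagram n) {i : ℕ} (hi : i + 1 < n)
    (h : a.partner ⟨i, by omega⟩ = ⟨i + 1, hi⟩) : a.up i ∧ ¬ a.up (i + 1) := by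
  rw [a.up_of_lt (by omega), a.up_of_lt hi]
  unfold HalfDiagram.Opens
  rw [← h, a.partner_partner, h]
  simp [Fin.le_def]

/-! ### Box additions in terms of words -/

theorem isBoxAddition_iff {n : ℕ} {b a : HalfDiagram n} {i : ℕ} (hi : i + 1 < n) :
    IsBoxAddition b i hi a ↔ ¬ b.up i ∧ b.up (i + 1) ∧ a.up i ∧ ¬ a.up (i + 1) ∧
      ∀ j, j ≠ i → j ≠ i + 1 → (a.up j ↔ b.up j) := by
  constructor
  · intro h
    refine ⟨fun h' => h.close_left h'.2, ⟨hi, h.open_right⟩, ⟨by omega, h.open_left⟩,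
      fun h' => h.close_right h'.2, fun j h1 h2 => ?_⟩
    by_cases hj : j < n
    · rw [a.up_of_lt hj, b.up_of_lt hj]; exact h.other ⟨j, hj⟩ h1 h2
    · exact ⟨fun h => absurd h.1 hj, fun h => absurd h.1 hj⟩
  · rintro ⟨h1, h2, h3, h4, h5⟩
    refine ⟨fun h' => h1 ⟨by omega, h'⟩, h2.2, h3.2, fun h' => h4 ⟨hi, h'⟩, fun j h h' => ?_⟩
    rw [← a.up_val, ← b.up_val]; exact h5 j h h'

theorem IsBoxAddition.height {n : ℕ} {b a : HalfDiagram n} {i : ℕ} {hi : i + 1 < n}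
    (h : IsBoxAddition b i hi a) {k : ℕ} (hk : k ≠ i + 1) : a.height k = b.height k := by
  rw [isBoxAddition_iff] at h
  obtain ⟨h1, h2, h3, h4, h5⟩ := h
  have e : a.height i = b.height i :=
    HalfDiagram.height_congr fun j hj => h5 j (by omega) (by omega)
  rcases Nat.lt_or_ge i k with hik | hik
  · have e2 : a.height (i + 2) = b.height (i + 2) := by
      rw [a.height_succ_of_not_up hi h4, b.height_succ_of_up h2, a.height_succ_of_up h3,
        b.height_succ_of_not_up (by omega) h1, e]
      ring
    rw [a.height_add_sum (show i + 2 ≤ k by omega), b.height_add_sum (show i + 2 ≤ k by omega), e2]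
    congr 1
    apply Finset.sum_congr rfl
    intro x hx
    simp only [Finset.mem_filter, Finset.mem_univ, true_and] at hx
    have := h5 x (by omega) (by omega)
    rw [a.up_val, b.up_val] at this
    simp only [HalfDiagram.sign, this]
  · exact HalfDiagram.height_congr fun j hj => h5 j (by omega) (by omega)

theorem IsBoxAddition.height_mid {n : ℕ} {b a : HalfDiagram n} {i : ℕ} {hi : i + 1 < n}
    (h : IsBoxAddition b i hi a) : a.height (i + 1) = b.height (i + 1) + 2 := by
  have h0 := h.height (k := i) (by omega)
  rw [isBoxAddition_iff] at h
  obtain ⟨h1, h2, h3, h4, h5⟩ := h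
  rw [a.height_succ_of_up h3, b.height_succ_of_not_up (by omega) h1, h0]
  ring

theorem IsBoxAddition.height_left {n : ℕ} {b a : HalfDiagram n} {i : ℕ} {hi : i + 1 < n}
    (h : IsBoxAddition b i hi a) : a.height i = b.height (i + 1) + 1 := by
  have h0 := h.height (k := i) (by omega)
  rw [isBoxAddition_iff] at h
  rw [b.height_succ_of_not_up (by omega) h.1, h0]
  ring

theorem IsBoxAddition.height_base_le {n : ℕ} {b a : HalfDiagram n} {i : ℕ} {hi : i + 1 < n}
    (h : IsBoxAddition b i hi a) (k : ℕ) : b.height k ≤ a.height k := by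
  by_cases hk : k = i + 1
  · subst hk; rw [h.height_mid]; omega
  · exact (h.height hk).ge

theorem IsBoxAddition.base_unique {n : ℕ} {b b' a : HalfDiagram n} {i : ℕ} {hi : i + 1 < n}
    (h : IsBoxAddition b i hi a) (h' : IsBoxAddition b' i hi a) : b = b' := by
  rw [isBoxAddition_iff] at h h'
  apply HalfDiagram.ext_up
  intro j _
  by_cases h1 : j = i
  · subst h1; exact iff_of_false h.1 h'.1
  by_cases h2 : j = i + 1
  · subst h2; exact iff_of_true h.2.1 h'.2.1
  rw [← h.2.2.2.2 j h1 h2, h'.2.2.2.2 j h1 h2]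

theorem IsBoxAddition.result_unique {n : ℕ} {b a a' : HalfDiagram n} {i : ℕ} {hi : i + 1 < n}
    (h : IsBoxAddition b i hi a) (h' : IsBoxAddition b i hi a') : a = a' := by
  rw [isBoxAddition_iff] at h h'
  apply HalfDiagram.ext_up
  intro j _
  by_cases h1 : j = i
  · subst h1; exact iff_of_true h.2.2.1 h'.2.2.1
  by_cases h2 : j = i + 1
  · subst h2; exact iff_of_false h.2.2.2.1 h'.2.2.2.1
  rw [h.2.2.2.2 j h1 h2, h'.2.2.2.2 j h1 h2]

theorem IsBoxAddition.closeSum_lt {n : ℕ} {b a : HalfDiagram n} {i : ℕ} {hi : i + 1 < n}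
    (h : IsBoxAddition b i hi a) : b.closeSum < a.closeSum :=
  BoxRemoval.closeSum_lt ⟨b, i, hi, h⟩

theorem IsBoxAddition.card_through {n : ℕ} {b a : HalfDiagram n} {i : ℕ} {hi : i + 1 < n}
    (h : IsBoxAddition b i hi a) : a.through.card = b.through.card := by
  have := h.height (k := n) (by omega)
  rw [a.height_total, b.height_total] at this
  exact_mod_cast this


/-! ### Components of two half-diagrams glued along their points -/

theorem card_eq_card_fixed_mod_two {α : Type*} [DecidableEq α] (s : Finset α) (g : α → α)
    (hg : ∀ x, g (g x) = x) (hs : ∀ x ∈ s, g x ∈ s) :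
    (s.card : ZMod 2) = (s.filter fun x => g x = x).card := by
  rw [Finset.card_filter, Finset.card_eq_sum_ones, Nat.cast_sum, Nat.cast_sum, ← sub_eq_zero,
    ← Finset.sum_sub_distrib]
  refine Finset.sum_involution (fun x _ => g x) ?_ ?_ (fun x hx => hs x hx) (fun x _ => hg x)
  · intro x _
    by_cases hx : g x = x
    · simp [hx]
    · have hx' : ¬ x = g x := fun h => hx h.symm
      simp only [hg, hx, hx', if_false]
      decide
  · intro x _ h h'
    apply h
    simp [h']

section Glue

variable {n : ℕ} {a b : HalfDiagram n}

theorem glueGraph_reachable_left (x : Fin n) : (glueGraph a b).Reachable x (a.partner x) := by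
  by_cases h : x = a.partner x
  · rw [← h]
  · exact SimpleGraph.Adj.reachable ((SimpleGraph.fromRel_adj _ _ _).2 ⟨h, Or.inl (Or.inl rfl)⟩)

theorem glueGraph_reachable_right (x : Fin n) : (glueGraph a b).Reachable x (b.partner x) := by
  by_cases h : x = b.partner x
  · rw [← h]
  · exact SimpleGraph.Adj.reachable ((SimpleGraph.fromRel_adj _ _ _).2 ⟨h, Or.inl (Or.inr rfl)⟩)

theorem glueGraph_adj {x y : Fin n} (h : (glueGraph a b).Adj x y) :
    a.partner x = y ∨ b.partner x = y := by
  rcases ((SimpleGraph.fromRel_adj _ _ _).1 h).2 with (h | h) | (h | h)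
  · exact Or.inl h
  · exact Or.inr h
  · exact Or.inl (by rw [← h, a.partner_partner])
  · exact Or.inr (by rw [← h, b.partner_partner])

theorem glueGraph_induction {P : Fin n → Prop} (ha : ∀ x, P x → P (a.partner x))
    (hb : ∀ x, P x → P (b.partner x)) {x y : Fin n} (h : (glueGraph a b).Reachable x y)
    (hx : P x) : P y := by
  obtain ⟨w⟩ := h
  induction w with
  | nil => exact hx
  | cons hadj _ ih =>
    apply ih
    rcases glueGraph_adj hadj with h | h
    · rw [← h]; exact ha _ hx
    · rw [← h]; exact hb _ hx

open Classical in
/-- The points which an edge path joins to `x`. -/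
noncomputable def glueComponent (a b : HalfDiagram n) (x : Fin n) : Finset (Fin n) :=
  Finset.univ.filter fun y => (glueGraph a b).Reachable x y

theorem mem_glueComponent {x y : Fin n} :
    y ∈ glueComponent a b x ↔ (glueGraph a b).Reachable x y := by
  simp [glueComponent]

theorem partner_left_mem_glueComponent {x y : Fin n} :
    a.partner y ∈ glueComponent a b x ↔ y ∈ glueComponent a b x := by
  rw [mem_glueComponent, mem_glueComponent]
  exact ⟨fun h => h.trans (glueGraph_reachable_left y).symm,
    fun h => h.trans (glueGraph_reachable_left y)⟩

theorem partner_right_mem_glueComponent {x y : Fin n} :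
    b.partner y ∈ glueComponent a b x ↔ y ∈ glueComponent a b x := by
  rw [mem_glueComponent, mem_glueComponent]
  exact ⟨fun h => h.trans (glueGraph_reachable_right y).symm,
    fun h => h.trans (glueGraph_reachable_right y)⟩

/-! ### Ends of the glued paths: parity, and the rotation given by two involutions. -/

theorem card_through_glueComponent (x : Fin n) :
    (((glueComponent a b x).filter fun y => a.partner y = y).card : ZMod 2) =
      ((glueComponent a b x).filter fun y => b.partner y = y).card := by
  rw [← card_eq_card_fixed_mod_two _ _ a.partner_partner
      fun y hy => partner_left_mem_glueComponent.2 hy,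
    card_eq_card_fixed_mod_two _ _ b.partner_partner
      fun y hy => partner_right_mem_glueComponent.2 hy]

/-- Without fixed points of `a`, the component has an even number of fixed points of `b`. -/
theorem glueGraph_exists_end (ha : ∀ x, a.partner x ≠ x) {e : Fin n} (he : b.partner e = e) :
    ∃ f, f ≠ e ∧ b.partner f = f ∧ (glueGraph a b).Reachable e f := by
  by_contra hc
  push Not at hc
  have h := card_through_glueComponent (a := a) (b := b) e
  have h1 : (glueComponent a b e).filter (fun y => a.partner y = y) = ∅ :=
    Finset.filter_false_of_mem fun x _ => ha x
  have h2 : (glueComponent a b e).filter (fun y => b.partner y = y) = {e} := by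
    ext y
    rw [Finset.mem_filter, mem_glueComponent, Finset.mem_singleton]
    constructor
    · rintro ⟨hy, hy'⟩
      by_contra hne
      exact hc y hne hy' hy
    · rintro rfl
      exact ⟨SimpleGraph.Reachable.refl _, he⟩
  rw [h1, h2] at h
  simp at h

/-- The partner involution as a permutation. -/
def HalfDiagram.perm (a : HalfDiagram n) : Equiv.Perm (Fin n) :=
  Function.Involutive.toPerm a.partner a.partner_partner

/-- The component of `e` is its orbit under the dihedral group generated by the two involutions. As
`b` fixes `e`, the rotations `(a.perm * b.perm) ^ k` already reach the whole orbit. -/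
theorem glueGraph_end_eq_zpow {e f : Fin n} (he : b.partner e = e)
    (h : (glueGraph a b).Reachable e f) : ∃ k : ℤ, f = ((a.perm * b.perm) ^ k) e := by
  have hb : b.perm * b.perm = 1 := Equiv.ext b.partner_partner
  have ha : a.perm * a.perm = 1 := Equiv.ext a.partner_partner
  have hinv : (a.perm * b.perm)⁻¹ = b.perm * a.perm := by
    rw [inv_eq_iff_mul_eq_one, mul_assoc, ← mul_assoc b.perm, hb, one_mul, ha]
  have hbk : ∀ k : ℤ, b.perm * (a.perm * b.perm) ^ k = (a.perm * b.perm) ^ (-k) * b.perm := by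
    intro k
    have : SemiconjBy b.perm (a.perm * b.perm) (a.perm * b.perm)⁻¹ := by
      unfold SemiconjBy
      rw [hinv, mul_assoc]
    have := this.zpow_right k
    rw [inv_zpow', SemiconjBy] at this
    exact this
  have hbe : b.perm e = e := he
  have hbk' : ∀ k : ℤ, b.partner (((a.perm * b.perm) ^ k) e) = ((a.perm * b.perm) ^ (-k)) e := by
    intro k
    have := congrArg (fun g : Equiv.Perm (Fin n) => g e) (hbk k)
    simp only [Equiv.Perm.mul_apply, hbe] at this
    exact this
  refine glueGraph_induction (P := fun f => ∃ k : ℤ, f = ((a.perm * b.perm) ^ k) e) ?_ ?_ h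
    ⟨0, rfl⟩
  · rintro _ ⟨k, rfl⟩
    refine ⟨1 + -k, ?_⟩
    rw [zpow_add, zpow_one, Equiv.Perm.mul_apply, ← hbk', Equiv.Perm.mul_apply]
    change _ = a.partner (b.partner (b.partner _))
    rw [b.partner_partner]
  · rintro _ ⟨k, rfl⟩
    exact ⟨-k, hbk' k⟩

/-- Conjugation by `b` inverts the rotation r, so b r^k e = r^{-k} e, and a fixed point has r^k e =
r^{-k} e. -/
theorem glueGraph_end_zpow_two_mul {e : Fin n} (he : b.partner e = e) {k : ℤ}
    (hf : b.partner (((a.perm * b.perm) ^ k) e) = ((a.perm * b.perm) ^ k) e) :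
    ((a.perm * b.perm) ^ (2 * k)) e = e := by
  have hb : b.perm * b.perm = 1 := Equiv.ext b.partner_partner
  have ha : a.perm * a.perm = 1 := Equiv.ext a.partner_partner
  have hinv : (a.perm * b.perm)⁻¹ = b.perm * a.perm := by
    rw [inv_eq_iff_mul_eq_one, mul_assoc, ← mul_assoc b.perm, hb, one_mul, ha]
  have : SemiconjBy b.perm (a.perm * b.perm) (a.perm * b.perm)⁻¹ := by
    unfold SemiconjBy
    rw [hinv, mul_assoc]
  have := this.zpow_right k
  rw [inv_zpow', SemiconjBy] at this
  have h2 := congrArg (fun g : Equiv.Perm (Fin n) => g e) this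
  simp only [Equiv.Perm.mul_apply] at h2
  rw [show b.perm e = e from he] at h2
  have h3 : ((a.perm * b.perm) ^ k) e = ((a.perm * b.perm) ^ (-k)) e := hf.symm.trans h2
  rw [two_mul, zpow_add, Equiv.Perm.mul_apply, h3, ← Equiv.Perm.mul_apply, ← zpow_add]
  simp

/-- A path has at most two ends: if d is the period of `e` under the rotation, the exponent k of an
end satisfies d ∣ 2k, and modulo d this has at most one solution besides 0. -/
theorem glueGraph_two_ends {e f g : Fin n} (he : b.partner e = e) (hf : b.partner f = f)
    (hg : b.partner g = g) (hef : (glueGraph a b).Reachable e f)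
    (heg : (glueGraph a b).Reachable e g) : f = e ∨ g = e ∨ f = g := by
  obtain ⟨k, rfl⟩ := glueGraph_end_eq_zpow he hef
  obtain ⟨l, rfl⟩ := glueGraph_end_eq_zpow he heg
  have hk := glueGraph_end_zpow_two_mul he hf
  have hl := glueGraph_end_zpow_two_mul he hg
  set r := a.perm * b.perm
  have key : ∀ j : ℤ, (r ^ j) e = e ↔ (Function.minimalPeriod (r • ·) e : ℤ) ∣ j := fun j =>
    MulAction.zpow_smul_eq_iff_minimalPeriod_dvd (a := r) (b := e)
  rw [key] at hk hl
  set d : ℤ := (Function.minimalPeriod (r • ·) e : ℤ)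
  by_cases h1 : d ∣ k
  · exact Or.inl ((key k).2 h1)
  by_cases h2 : d ∣ l
  · exact Or.inr (Or.inl ((key l).2 h2))
  refine Or.inr (Or.inr ?_)
  have h3 : d ∣ k - l := by
    obtain ⟨u, hu⟩ := hk
    obtain ⟨v, hv⟩ := hl
    rcases Int.even_or_odd' u with ⟨u', rfl | rfl⟩
    · exact absurd ⟨u', by linarith⟩ h1
    rcases Int.even_or_odd' v with ⟨v', rfl | rfl⟩
    · exact absurd ⟨v', by linarith⟩ h2
    exact ⟨u' - v', by linarith⟩
  have h4 := (key (k - l)).2 h3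
  calc (r ^ k) e = (r ^ l * r ^ (k - l)) e := by rw [← zpow_add]; congr 2; ring
    _ = (r ^ l) e := by rw [Equiv.Perm.mul_apply, h4]

/-! ### Planarity of the glued paths, by counting modulo 2. -/

theorem HalfDiagram.card_between_even (t : HalfDiagram n) (K : Finset (Fin n))
    (hK : ∀ x ∈ K, t.partner x ∈ K) {z : Fin n} (hz : z < t.partner z) (hzK : z ∉ K) :
    (((K.filter fun x => x < z).card : ℕ) : ZMod 2) = (K.filter fun x => x < t.partner z).card := by
  have hzK' : t.partner z ∉ K := fun h => hzK (by simpa [t.partner_partner] using hK _ h)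
  have hsplit : K.filter (fun x => x < t.partner z) = K.filter (fun x => x < z) ∪
      K.filter (fun x => z < x ∧ x < t.partner z) := by
    ext x
    simp only [Finset.mem_filter, Finset.mem_union]
    constructor
    · rintro ⟨h1, h2⟩
      rcases lt_trichotomy x z with h | h | h
      · exact Or.inl ⟨h1, h⟩
      · exact absurd (h ▸ h1) hzK
      · exact Or.inr ⟨h1, h, h2⟩
    · rintro (⟨h1, h2⟩ | ⟨h1, h2, h3⟩)
      · exact ⟨h1, h2.trans hz⟩
      · exact ⟨h1, h3⟩
  rw [hsplit, Finset.card_union_of_disjoint, Nat.cast_add, left_eq_add]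
  · have hmem : ∀ x ∈ K.filter (fun x => z < x ∧ x < t.partner z),
        t.partner x ∈ K.filter (fun x => z < x ∧ x < t.partner z) := by
      intro x hx
      rw [Finset.mem_filter] at hx ⊢
      obtain ⟨h1, h2, h3⟩ := hx
      refine ⟨hK x h1, ?_, ?_⟩
      · refine lt_of_le_of_ne (le_of_not_gt fun h => ?_) fun h => hzK (h ▸ hK x h1)
        exact t.noncrossing _ _ _ _ h h2 h3 (t.partner_partner x) rfl
      · refine lt_of_le_of_ne (le_of_not_gt fun h => ?_) fun h => hzK' (h ▸ hK x h1)
        exact t.noncrossing _ _ _ _ h2 h3 h rfl rfl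
    rw [card_eq_card_fixed_mod_two _ _ t.partner_partner hmem, Finset.filter_false_of_mem]
    · simp
    · intro x hx
      rw [Finset.mem_filter] at hx
      exact t.noncrossing_through _ _ _ hx.2.1 hx.2.2 rfl
  · rw [Finset.disjoint_left]
    intro x hx hx'
    rw [Finset.mem_filter] at hx hx'
    exact lt_asymm hx.2 hx'.2.1

theorem HalfDiagram.card_below_partner (t : HalfDiagram n) (K : Finset (Fin n))
    (hK : ∀ x ∈ K, t.partner x ∈ K) {z : Fin n} (hzK : z ∉ K) :
    (((K.filter fun x => x < z).card : ℕ) : ZMod 2) = (K.filter fun x => x < t.partner z).card := by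
  rcases lt_trichotomy z (t.partner z) with h | h | h
  · exact t.card_between_even K hK h hzK
  · rw [← h]
  · have h' := t.card_between_even K hK (z := t.partner z) (by rwa [t.partner_partner])
      fun h1 => hzK (by simpa [t.partner_partner] using hK _ h1)
    rw [t.partner_partner] at h'
    exact h'.symm

theorem HalfDiagram.card_below_through (t : HalfDiagram n) (K : Finset (Fin n))
    (hK : ∀ x ∈ K, t.partner x ∈ K) {z : Fin n} (hz : t.partner z = z) :
    (((K.filter fun x => x < z).card : ℕ) : ZMod 2) =
      (K.filter fun x => x < z ∧ t.partner x = x).card := by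
  rw [card_eq_card_fixed_mod_two _ _ t.partner_partner, Finset.filter_filter]
  intro x hx
  rw [Finset.mem_filter] at hx ⊢
  refine ⟨hK x hx.1, ?_⟩
  refine lt_of_le_of_ne (le_of_not_gt fun h => ?_) fun h => ?_
  · exact t.noncrossing_through _ _ _ hx.2 h rfl hz
  · rw [← h, t.partner_partner] at hz
    exact absurd (hz.trans h) hx.2.ne

/-- A Jordan curve argument modulo 2. Let `K` be the component of `i` and `j`. Passing from a point
outside `K` to a partner does not change the parity of the number of points of `K` to the left, so
this parity is constant on the component of `k`. At a through-string of `b` it equals the parity of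
the number of ends of `K` to the left: one at `k`, two at `l`. -/
theorem glueGraph_noncrossing {i j k l : Fin n} (hik : i < k) (hkj : k < j) (hjl : j < l)
    (hi : b.partner i = i) (hj : b.partner j = j) (hk : b.partner k = k) (hl : b.partner l = l)
    (hij : (glueGraph a b).Reachable i j) : ¬ (glueGraph a b).Reachable k l := by
  intro hkl
  have hnot : k ∉ glueComponent a b i := by
    rw [mem_glueComponent]
    intro hik'
    rcases glueGraph_two_ends hi hj hk hij hik' with h | h | h
    · exact (hik.trans hkj).ne' h
    · exact hik.ne' h
    · exact hkj.ne' h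
  set K := glueComponent a b i with hKdef
  have hKa : ∀ x ∈ K, a.partner x ∈ K := fun x hx => partner_left_mem_glueComponent.2 hx
  have hKb : ∀ x ∈ K, b.partner x ∈ K := fun x hx => partner_right_mem_glueComponent.2 hx
  have hmain := glueGraph_induction (P := fun z => z ∉ K ∧
    (((K.filter fun x => x < k).card : ℕ) : ZMod 2) = (K.filter fun x => x < z).card)
    (fun x hx => ⟨fun h => hx.1 (partner_left_mem_glueComponent.1 h),
      hx.2.trans (a.card_below_partner K hKa hx.1)⟩)
    (fun x hx => ⟨fun h => hx.1 (partner_right_mem_glueComponent.1 h),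
      hx.2.trans (b.card_below_partner K hKb hx.1)⟩) hkl ⟨hnot, rfl⟩
  have h2 := hmain.2
  rw [b.card_below_through K hKb hk, b.card_below_through K hKb hl] at h2
  have hends : ∀ x ∈ K, b.partner x = x → x = i ∨ x = j := by
    intro x hx hx'
    rcases glueGraph_two_ends hi hj hx' hij (mem_glueComponent.1 hx) with h | h | h
    · exact absurd h (hik.trans hkj).ne'
    · exact Or.inl h
    · exact Or.inr h.symm
  have hiK : i ∈ K := mem_glueComponent.2 (SimpleGraph.Reachable.refl _)
  have hjK : j ∈ K := mem_glueComponent.2 hij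
  have e1 : K.filter (fun x => x < k ∧ b.partner x = x) = {i} := by
    ext x
    rw [Finset.mem_filter, Finset.mem_singleton]
    constructor
    · rintro ⟨hx, hxk, hx'⟩
      rcases hends x hx hx' with h | h
      · exact h
      · exact absurd (h ▸ hxk) hkj.not_gt
    · rintro rfl
      exact ⟨hiK, hik, hi⟩
  have e2 : K.filter (fun x => x < l ∧ b.partner x = x) = {i, j} := by
    ext x
    rw [Finset.mem_filter, Finset.mem_insert, Finset.mem_singleton]
    constructor
    · rintro ⟨hx, hxk, hx'⟩
      exact hends x hx hx'
    · rintro (rfl | rfl)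
      · exact ⟨hiK, hik.trans (hkj.trans hjl), hi⟩
      · exact ⟨hjK, hjl, hj⟩
  rw [e1, e2, Finset.card_singleton, Finset.card_pair (hik.trans hkj).ne] at h2
  exact absurd h2 (by decide)

end Glue

/-! ### The concatenation of a full diagram and a half-diagram -/

theorem leftPt_ne_rightPt {n : ℕ} {i j : Fin n} : leftPt i ≠ rightPt j := leftPt_lt_rightPt.ne

/-- The half-diagram on the points of a full diagram with through-strings at the left points and
`a` at the right points. -/
def HalfDiagram.onRight {n : ℕ} (a : HalfDiagram n) : HalfDiagram (2 * n) where
  partner x := if hx : x.val < n then x else rightPt (a.partner ⟨2 * n - 1 - x.val, by omega⟩)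
  partner_partner x := by
    rcases eq_leftPt_or_eq_rightPt x with ⟨i, rfl⟩ | ⟨i, rfl⟩
    · simp [leftPt]
    · simp [not_rightPt_lt, rightPt_sub, a.partner_partner]
  noncrossing := by
    rintro x _ y _ h1 h2 h3 rfl rfl
    rcases eq_leftPt_or_eq_rightPt x with ⟨i, rfl⟩ | ⟨i, rfl⟩
    · rw [dif_pos (show (leftPt i).val < n from i.2)] at h2
      exact lt_asymm h1 h2
    · rcases eq_leftPt_or_eq_rightPt y with ⟨k, rfl⟩ | ⟨k, rfl⟩
      · exact absurd h1 leftPt_lt_rightPt.not_gt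
      · simp only [not_rightPt_lt, dite_false, rightPt_sub, rightPt_lt_rightPt] at h1 h2 h3
        exact a.noncrossing _ _ _ _ h3 h2 h1 (a.partner_partner k) (a.partner_partner i)
  noncrossing_through := by
    rintro x _ y h1 h2 rfl h3
    rcases eq_leftPt_or_eq_rightPt x with ⟨i, rfl⟩ | ⟨i, rfl⟩
    · rw [dif_pos (show (leftPt i).val < n from i.2)] at h2
      exact lt_asymm h1 h2
    · rcases eq_leftPt_or_eq_rightPt y with ⟨k, rfl⟩ | ⟨k, rfl⟩
      · exact absurd h1 leftPt_lt_rightPt.not_gt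
      · simp only [not_rightPt_lt, dite_false, rightPt_sub, rightPt_lt_rightPt,
          rightPt_inj] at h1 h2 h3
        exact a.noncrossing_through _ _ _ h2 h1 (a.partner_partner i) h3

section Concat

variable {n : ℕ}

theorem HalfDiagram.onRight_leftPt (a : HalfDiagram n) (i : Fin n) :
    a.onRight.partner (leftPt i) = leftPt i := by
  simp [HalfDiagram.onRight, leftPt]

theorem HalfDiagram.onRight_rightPt (a : HalfDiagram n) (i : Fin n) :
    a.onRight.partner (rightPt i) = rightPt (a.partner i) := by
  simp [HalfDiagram.onRight, not_rightPt_lt, rightPt_sub]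

/-- This turns concatenation into gluing: the left points become ends of paths, like the
through-strings of `a`, and all results on glued paths apply. -/
theorem concatGraph_eq_glueGraph (p : Pairing n) (a : HalfDiagram n) :
    concatGraph p a = glueGraph p.1 a.onRight := by
  have key : ∀ x y, x ≠ y → ((p.1.partner x = y ∨
      ∃ i : Fin n, x = rightPt i ∧ y = rightPt (a.partner i)) ↔
      (p.1.partner x = y ∨ a.onRight.partner x = y)) := by
    intro x y hxy
    refine or_congr_right ?_
    constructor
    · rintro ⟨i, rfl, rfl⟩
      exact a.onRight_rightPt i
    · intro h
      rcases eq_leftPt_or_eq_rightPt x with ⟨i, rfl⟩ | ⟨i, rfl⟩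
      · rw [a.onRight_leftPt] at h
        exact absurd h hxy
      · rw [a.onRight_rightPt] at h
        exact ⟨i, rfl, h.symm⟩
  ext x y
  unfold concatGraph glueGraph
  rw [SimpleGraph.fromRel_adj, SimpleGraph.fromRel_adj]
  constructor
  · rintro ⟨h, h'⟩
    exact ⟨h, h'.imp (key x y h).1 (key y x h.symm).1⟩
  · rintro ⟨h, h'⟩
    exact ⟨h, h'.imp (key x y h).2 (key y x h.symm).2⟩

theorem HalfDiagram.onRight_through (a : HalfDiagram n) {x : Fin (2 * n)}
    (hx : a.onRight.partner x = x) :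
    (∃ i, x = leftPt i) ∨ ∃ s, x = rightPt s ∧ a.partner s = s := by
  rcases eq_leftPt_or_eq_rightPt x with ⟨i, rfl⟩ | ⟨i, rfl⟩
  · exact Or.inl ⟨i, rfl⟩
  · rw [a.onRight_rightPt, rightPt_inj] at hx
    exact Or.inr ⟨i, rfl, hx⟩

theorem HalfDiagram.onRight_rightPt_through (a : HalfDiagram n) {s : Fin n}
    (hs : a.partner s = s) : a.onRight.partner (rightPt s) = rightPt s := by
  rw [a.onRight_rightPt, hs]

variable {p : Pairing n} {a : HalfDiagram n}

theorem concatGraph_reachable_left (x : Fin (2 * n)) :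
    (concatGraph p a).Reachable x (p.1.partner x) := by
  rw [concatGraph_eq_glueGraph]
  exact glueGraph_reachable_left x

theorem concatGraph_reachable_right (i : Fin n) :
    (concatGraph p a).Reachable (rightPt i) (rightPt (a.partner i)) := by
  rw [concatGraph_eq_glueGraph, ← a.onRight_rightPt]
  exact glueGraph_reachable_right _

theorem concat_unique_left {i j k : Fin n}
    (hij : (concatGraph p a).Reachable (leftPt i) (leftPt j))
    (hik : (concatGraph p a).Reachable (leftPt i) (leftPt k)) (hj : j ≠ i) (hk : k ≠ i) :
    j = k := by
  rw [concatGraph_eq_glueGraph] at hij hik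
  rcases glueGraph_two_ends (a.onRight_leftPt _) (a.onRight_leftPt _) (a.onRight_leftPt _) hij hik
    with h | h | h
  · exact absurd (leftPt_inj.1 h) hj
  · exact absurd (leftPt_inj.1 h) hk
  · exact leftPt_inj.1 h

theorem concat_exists_end (i : Fin n) :
    (∃ j, j ≠ i ∧ (concatGraph p a).Reachable (leftPt i) (leftPt j)) ∨
      ∃ s, a.partner s = s ∧ (concatGraph p a).Reachable (leftPt i) (rightPt s) := by
  rw [concatGraph_eq_glueGraph]
  obtain ⟨f, h1, h2, h3⟩ := glueGraph_exists_end p.2 (a.onRight_leftPt i)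
  rcases a.onRight_through h2 with ⟨j, rfl⟩ | ⟨s, rfl, hs⟩
  · exact Or.inl ⟨j, fun h => h1 (by rw [h]), h3⟩
  · exact Or.inr ⟨s, hs, h3⟩

theorem concat_not_left_and_through {i j s : Fin n} (hij : i ≠ j) (hs : a.partner s = s)
    (h1 : (concatGraph p a).Reachable (leftPt i) (leftPt j)) :
    ¬ (concatGraph p a).Reachable (leftPt i) (rightPt s) := by
  intro h2
  rw [concatGraph_eq_glueGraph] at h1 h2
  rcases glueGraph_two_ends (a.onRight_leftPt _) (a.onRight_leftPt _)
    (a.onRight_rightPt_through hs) h1 h2 with h | h | h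
  · exact hij (leftPt_inj.1 h).symm
  · exact leftPt_ne_rightPt h.symm
  · exact leftPt_ne_rightPt h

/-- A left point is paired with the other end of its path if that is a left point too, and otherwise
becomes a through-string. Distinct paths do not cross, which gives both planarity conditions. -/
theorem exists_isConcat (p : Pairing n) (a : HalfDiagram n) : ∃ b, IsConcat p a b := by
  classical
  set R := (concatGraph p a).Reachable with hR
  have huniq : ∀ i j k, R (leftPt i) (leftPt j) → R (leftPt i) (leftPt k) → j ≠ i → k ≠ i →
    j = k := fun i j k => concat_unique_left
  let f : Fin n → Fin n := fun i =>
    if h : ∃ j, j ≠ i ∧ R (leftPt i) (leftPt j) then h.choose else i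
  have hf1 : ∀ i j, j ≠ i → R (leftPt i) (leftPt j) → f i = j := by
    intro i j hj hR'
    have h : ∃ j, j ≠ i ∧ R (leftPt i) (leftPt j) := ⟨j, hj, hR'⟩
    simp only [f, dif_pos h]
    exact huniq i _ _ h.choose_spec.2 hR' h.choose_spec.1 hj
  have hf2 : ∀ i, f i = i ∨ (f i ≠ i ∧ R (leftPt i) (leftPt (f i))) := by
    intro i
    by_cases h : ∃ j, j ≠ i ∧ R (leftPt i) (leftPt j)
    · right
      simp only [f, dif_pos h]
      exact h.choose_spec
    · left
      simp only [f, dif_neg h]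
  have hf3 : ∀ i, f i = i → ∃ s, a.partner s = s ∧ R (leftPt i) (rightPt s) := by
    intro i hi
    rcases concat_exists_end (p := p) (a := a) i with ⟨j, hj, hj'⟩ | h
    · exact absurd ((hf1 i j hj hj').symm.trans hi) hj
    · exact h
  refine ⟨⟨f, ?_, ?_, ?_⟩, ?_⟩
  · intro i
    rcases hf2 i with h | ⟨h, h'⟩
    · rw [h, h]
    · exact hf1 _ _ h.symm h'.symm
  · rintro i j k l hik hkj hjl rfl rfl
    rcases hf2 i with h | ⟨_, h1⟩
    · rw [h] at hkj; exact lt_asymm hik hkj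
    rcases hf2 k with h | ⟨_, h2⟩
    · rw [h] at hjl; exact lt_asymm hkj hjl
    rw [hR, concatGraph_eq_glueGraph] at h1 h2
    exact glueGraph_noncrossing (leftPt_lt_leftPt.2 hik) (leftPt_lt_leftPt.2 hkj)
      (leftPt_lt_leftPt.2 hjl) (a.onRight_leftPt _) (a.onRight_leftPt _) (a.onRight_leftPt _)
      (a.onRight_leftPt _) h1 h2
  · rintro i j k hik hkj rfl hk
    rcases hf2 i with h | ⟨_, h1⟩
    · rw [h] at hkj; exact lt_asymm hik hkj
    -- The path from `k` ends at a through-string on the right, and right points come after all left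
    -- points. An arc over `k` would therefore cross this path.
    obtain ⟨s, hs, h2⟩ := hf3 k hk
    rw [hR, concatGraph_eq_glueGraph] at h1 h2
    exact glueGraph_noncrossing (leftPt_lt_leftPt.2 hik) (leftPt_lt_leftPt.2 hkj)
      leftPt_lt_rightPt (a.onRight_leftPt _) (a.onRight_leftPt _) (a.onRight_leftPt _)
      (a.onRight_rightPt_through hs) h1 h2
  · intro i j hij
    constructor
    · rintro h
      change f i = j at h
      rcases hf2 i with h' | ⟨_, h'⟩
      · exact absurd (h'.symm.trans h) hij
      · rwa [h] at h'
    · exact hf1 i j hij.symm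

theorem IsConcat.unique {b b' : HalfDiagram n} (h : IsConcat p a b) (h' : IsConcat p a b') :
    b = b' := by
  ext1
  funext i
  by_cases hi : b.partner i = i
  · by_cases hi' : b'.partner i = i
    · rw [hi, hi']
    · exact (h _ _ (Ne.symm hi')).2 ((h' _ _ (Ne.symm hi')).1 rfl)
  · exact ((h' _ _ (Ne.symm hi)).2 ((h _ _ (Ne.symm hi)).1 rfl)).symm

theorem IsConcat.through_iff {b : HalfDiagram n} (h : IsConcat p a b) (i : Fin n) :
    b.partner i = i ↔
      ∃ s, a.partner s = s ∧ (concatGraph p a).Reachable (leftPt i) (rightPt s) := by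
  constructor
  · intro hi
    rcases concat_exists_end (p := p) (a := a) i with ⟨j, hj, hj'⟩ | h'
    · exact absurd (((h i j hj.symm).2 hj').symm.trans hi) hj
    · exact h'
  · rintro ⟨s, hs, hs'⟩
    by_contra hi
    exact concat_not_left_and_through (Ne.symm hi) hs ((h _ _ (Ne.symm hi)).1 rfl) hs'

theorem concat_through_reaches_left (hj : ¬ concatJoinsThrough p a) {s : Fin n}
    (hs : a.partner s = s) : ∃ i, (concatGraph p a).Reachable (leftPt i) (rightPt s) := by
  obtain ⟨f, h1, h2, h3⟩ := glueGraph_exists_end p.2 (a.onRight_rightPt_through hs)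
  rw [← concatGraph_eq_glueGraph] at h3
  rcases a.onRight_through h2 with ⟨i, rfl⟩ | ⟨t, rfl, ht⟩
  · exact ⟨i, h3.symm⟩
  · exact absurd ⟨s, t, fun h => h1 (by rw [h]), hs, ht, h3⟩ hj

/-- Edge paths match the through-strings of `b` with those of `a`, one to one as soon as none of `a`
are joined. -/
theorem IsConcat.card_through {b : HalfDiagram n} (h : IsConcat p a b)
    (hj : ¬ concatJoinsThrough p a) : b.through.card = a.through.card := by
  apply le_antisymm
  · apply Finset.card_le_card_of_forall_subsingleton
      (fun i s => (concatGraph p a).Reachable (leftPt i) (rightPt s))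
    · intro i hi
      obtain ⟨s, hs, hs'⟩ := (h.through_iff i).1 (HalfDiagram.mem_through.1 hi)
      exact ⟨s, HalfDiagram.mem_through.2 hs, hs'⟩
    · rintro s hs i ⟨hi, his⟩ i' ⟨_, his'⟩
      by_contra hne
      have := (h i i' hne).2 (his.trans his'.symm)
      rw [HalfDiagram.mem_through.1 hi] at this
      exact hne this
  · apply Finset.card_le_card_of_forall_subsingleton
      (fun s i => (concatGraph p a).Reachable (leftPt i) (rightPt s))
    · intro s hs
      obtain ⟨i, hi⟩ := concat_through_reaches_left hj (HalfDiagram.mem_through.1 hs)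
      exact ⟨i, HalfDiagram.mem_through.2
        ((h.through_iff i).2 ⟨s, HalfDiagram.mem_through.1 hs, hi⟩), hi⟩
    · rintro i hi s ⟨hs, his⟩ s' ⟨hs', his'⟩
      by_contra hne
      exact hj ⟨s, s', hne, HalfDiagram.mem_through.1 hs, HalfDiagram.mem_through.1 hs',
        his.symm.trans his'⟩

theorem actBasis_of_joins (q : ℝ) (h : concatJoinsThrough p a) : actBasis q p a = 0 := by
  rw [actBasis, dif_neg]
  exact fun h' => h'.1 h

theorem actBasis_of_isConcat (q : ℝ) (h : ¬ concatJoinsThrough p a) {b : HalfDiagram n}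
    (hb : IsConcat p a b) :
    actBasis q p a = Finsupp.single b ((q : ℂ) ^ concatLoops p a) := by
  have h' : ¬ concatJoinsThrough p a ∧ ∃ b, IsConcat p a b := ⟨h, b, hb⟩
  rw [actBasis, dif_pos h', h'.2.choose_spec.unique hb]

end Concat


/-! ### Colourings -/

/-- A colouring of the points is compatible with a half-diagram if paired points have the same
colour and different through-strings have different colours. -/
structure Compat {n N : ℕ} (a : HalfDiagram n) (x : Fin n → Fin N) : Prop where
  pair : ∀ i, x (a.partner i) = x i
  through : ∀ s t, a.partner s = s → a.partner t = t → x s = x t → s = t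

open Classical in
/-- The indicator function of the colourings compatible with `a`. -/
noncomputable def ind {n N : ℕ} (a : HalfDiagram n) (x : Fin n → Fin N) : ℂ :=
  if Compat a x then 1 else 0

/-- The realization of `U(n)` in the functions on the colourings with `N` colours. -/
noncomputable def colour (N : ℕ) {n : ℕ} : U n →ₗ[ℂ] ((Fin n → Fin N) → ℂ) :=
  Finsupp.linearCombination ℂ fun a x => ind a x

theorem colour_single {N n : ℕ} (a : HalfDiagram n) (c : ℂ) (x : Fin n → Fin N) :
    colour N (Finsupp.single a c) x = c * ind a x := by
  simp [colour]

/-- The colouring which separates the blocks of a half-diagram. -/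
def HalfDiagram.canon {n N : ℕ} (a : HalfDiagram n) (h : n ≤ N) (i : Fin n) : Fin N :=
  Fin.castLE h (min i (a.partner i))

theorem HalfDiagram.canon_eq_iff {n N : ℕ} (a : HalfDiagram n) (h : n ≤ N) {i j : Fin n} :
    a.canon h i = a.canon h j ↔ i = j ∨ a.partner i = j := by
  unfold HalfDiagram.canon
  rw [Fin.castLE_inj]
  constructor
  · intro h'
    rcases min_choice i (a.partner i) with h1 | h1 <;>
      rcases min_choice j (a.partner j) with h2 | h2 <;> rw [h1, h2] at h'
    · exact Or.inl h'
    · exact Or.inr (by rw [h', a.partner_partner])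
    · exact Or.inr h'
    · exact Or.inl (a.partner_injective h')
  · rintro (rfl | rfl)
    · rfl
    · rw [a.partner_partner, min_comm]

theorem compat_canon_iff {n N : ℕ} (a b : HalfDiagram n) (h : n ≤ N) :
    Compat b (a.canon h) ↔ b = a := by
  constructor
  · rintro ⟨h1, h2⟩
    have h1' : ∀ i, b.partner i = i ∨ a.partner i = b.partner i := fun i => by
      rcases (a.canon_eq_iff h).1 (h1 i).symm with h' | h'
      · exact Or.inl h'.symm
      · exact Or.inr h'
    ext1
    funext i
    rcases h1' i with hi | hi
    · rcases h1' (a.partner i) with hj | hj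
      · rw [hi]
        exact h2 _ _ hi hj ((a.canon_eq_iff h).2 (Or.inr rfl))
      · rw [a.partner_partner] at hj
        rw [hj, b.partner_partner, ← hj]
    · exact hi.symm
  · rintro rfl
    refine ⟨fun i => (b.canon_eq_iff h).2 (Or.inr (b.partner_partner i)), fun s t hs _ hst => ?_⟩
    rcases (b.canon_eq_iff h).1 hst with h' | h'
    · exact h'
    · rw [← h', hs]

/-- The colouring that separates the blocks of `a` is compatible with `a` only, so evaluation there
reads off a coefficient. This makes the colour model faithful. -/
theorem colour_canon {n N : ℕ} (z : U n) (a : HalfDiagram n) (h : n ≤ N) :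
    colour N z (a.canon h) = z a := by
  classical
  induction z using Finsupp.induction_linear with
  | zero => simp
  | add z w hz hw => rw [map_add, Pi.add_apply, hz, hw, Finsupp.add_apply]
  | single b c =>
    rw [colour_single, ind, Finsupp.single_apply]
    simp only [compat_canon_iff]
    simp

theorem colour_injective {n N : ℕ} (h : n ≤ N) : Function.Injective (colour N (n := n)) := by
  intro z w hzw
  ext a
  rw [← colour_canon z a h, hzw, colour_canon]

theorem eq_of_reachable {X C : Type*} {G : SimpleGraph X} {f : X → C}
    (hf : ∀ x y, G.Adj x y → f x = f y) {x y : X} (h : G.Reachable x y) : f x = f y := by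
  obtain ⟨w⟩ := h
  induction w with
  | nil => rfl
  | cons hadj _ ih => exact (hf _ _ hadj).trans ih

/-- The colour is prescribed on components that meet `S` and free on the others; `f₀` guarantees
that the prescription is consistent. -/
theorem card_colourings {X : Type*} [Finite X] {N : ℕ} (G : SimpleGraph X) (S : Set X)
    (f₀ : X → Fin N) (hf₀ : ∀ x y, G.Adj x y → f₀ x = f₀ y) :
    Nat.card {f : X → Fin N // (∀ x y, G.Adj x y → f x = f y) ∧ ∀ s ∈ S, f s = f₀ s} =
      N ^ Set.ncard {K : G.ConnectedComponent | ∀ s ∈ S, G.connectedComponentMk s ≠ K} := by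
  classical
  rw [← Nat.card_coe_set_eq]
  have hfin : Finite G.ConnectedComponent := Quot.finite _
  rw [show N ^ Nat.card ↑{K : G.ConnectedComponent | ∀ s ∈ S, G.connectedComponentMk s ≠ K} =
    Nat.card (↑{K : G.ConnectedComponent | ∀ s ∈ S, G.connectedComponentMk s ≠ K} → Fin N) by
      rw [Nat.card_fun, Nat.card_fin]]
  refine Nat.card_congr
    { toFun := fun f K => f.1 K.1.out
      invFun := fun g => ⟨fun x => if h : ∀ s ∈ S, G.connectedComponentMk s ≠
          G.connectedComponentMk x then g ⟨G.connectedComponentMk x, h⟩ else f₀ x, ?_, ?_⟩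
      left_inv := ?_
      right_inv := ?_ }
  · intro x y hxy
    have e : G.connectedComponentMk x = G.connectedComponentMk y :=
      SimpleGraph.ConnectedComponent.sound hxy.reachable
    simp only [e, hf₀ x y hxy]
  · intro s hs
    exact dif_neg fun h => h s hs rfl
  · rintro ⟨f, hf, hf'⟩
    ext1
    funext x
    dsimp only
    split_ifs with h
    · apply eq_of_reachable hf
      exact SimpleGraph.ConnectedComponent.exact (Quot.out_eq _)
    · push Not at h
      obtain ⟨s, hs, hsx⟩ := h
      have hr := SimpleGraph.ConnectedComponent.exact hsx
      rw [← eq_of_reachable hf₀ hr, ← eq_of_reachable hf hr, hf' s hs]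
  · intro g
    funext ⟨K, hK⟩
    have e : G.connectedComponentMk (Quot.out K) = K := Quot.out_eq K
    dsimp only
    rw [dif_pos (by rw [e]; exact hK)]
    congr 1
    exact Subtype.ext e

/-! ### Colourings and the action -/

section Join

variable {n N : ℕ}

/-- The colouring of the points of a full diagram by colourings of its left and right points. -/
def joinCol (x y : Fin n → Fin N) (v : Fin (2 * n)) : Fin N :=
  if h : v.val < n then x ⟨v.val, h⟩ else y ⟨2 * n - 1 - v.val, by omega⟩

theorem joinCol_left (x y : Fin n → Fin N) (i : Fin n) : joinCol x y (leftPt i) = x i := by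
  simp [joinCol, leftPt]

theorem joinCol_right (x y : Fin n → Fin N) (i : Fin n) : joinCol x y (rightPt i) = y i := by
  simp [joinCol, not_rightPt_lt, rightPt_sub]

theorem forall_left_right {P : Fin (2 * n) → Prop} :
    (∀ v, P v) ↔ (∀ i, P (leftPt i)) ∧ ∀ i, P (rightPt i) := by
  refine ⟨fun h => ⟨fun i => h _, fun i => h _⟩, fun h v => ?_⟩
  rcases eq_leftPt_or_eq_rightPt v with ⟨i, rfl⟩ | ⟨i, rfl⟩
  · exact h.1 i
  · exact h.2 i

theorem compat_pairing_iff (p : Pairing n) (f : Fin (2 * n) → Fin N) :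
    Compat p.1 f ↔ ∀ v, f (p.1.partner v) = f v :=
  ⟨fun h => h.pair, fun h => ⟨h, fun s _ hs => absurd hs (p.2 s)⟩⟩

theorem concat_const_iff (p : Pairing n) (a : HalfDiagram n) (f : Fin (2 * n) → Fin N) :
    (∀ u v, (concatGraph p a).Adj u v → f u = f v) ↔
      (∀ v, f (p.1.partner v) = f v) ∧ ∀ i, f (rightPt (a.partner i)) = f (rightPt i) := by
  constructor
  · intro h
    exact ⟨fun v => (eq_of_reachable h (concatGraph_reachable_left v)).symm,
      fun i => (eq_of_reachable h (concatGraph_reachable_right i)).symm⟩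
  · rintro ⟨h1, h2⟩ u v huv
    rw [concatGraph_eq_glueGraph] at huv
    rcases glueGraph_adj huv with rfl | rfl
    · exact (h1 u).symm
    · rcases eq_leftPt_or_eq_rightPt u with ⟨i, rfl⟩ | ⟨i, rfl⟩
      · rw [a.onRight_leftPt]
      · rw [a.onRight_rightPt, h2]

variable {p : Pairing n} {a b : HalfDiagram n}

theorem IsConcat.compat (hb : IsConcat p a b)
    {f : Fin (2 * n) → Fin N} (hf : ∀ u v, (concatGraph p a).Adj u v → f u = f v)
    (ha : Compat a (fun i => f (rightPt i))) : Compat b (fun i => f (leftPt i)) := by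
  constructor
  · intro i
    by_cases hi : b.partner i = i
    · rw [hi]
    · exact (eq_of_reachable hf ((hb i _ (Ne.symm hi)).1 rfl)).symm
  · intro i j hi hj hij
    obtain ⟨s, hs, his⟩ := (hb.through_iff i).1 hi
    obtain ⟨t, ht, hjt⟩ := (hb.through_iff j).1 hj
    have : s = t := ha.through s t hs ht
      ((eq_of_reachable hf his).symm.trans (hij.trans (eq_of_reachable hf hjt)))
    subst this
    by_contra hne
    exact hne (hi.symm.trans ((hb i j hne).2 (his.trans hjt.symm)))

theorem IsConcat.compat_right (hb : IsConcat p a b) (hj : ¬ concatJoinsThrough p a)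
    {f : Fin (2 * n) → Fin N} (hf : ∀ u v, (concatGraph p a).Adj u v → f u = f v)
    (hx : Compat b (fun i => f (leftPt i))) : Compat a (fun i => f (rightPt i)) := by
  refine ⟨((concat_const_iff p a f).1 hf).2, fun s t hs ht hst => ?_⟩
  obtain ⟨i, hi⟩ := concat_through_reaches_left hj hs
  obtain ⟨j, hj'⟩ := concat_through_reaches_left hj ht
  have : i = j := hx.through i j ((hb.through_iff i).2 ⟨s, hs, hi⟩)
    ((hb.through_iff j).2 ⟨t, ht, hj'⟩)
    ((eq_of_reachable hf hi).trans (hst.trans (eq_of_reachable hf hj').symm))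
  subst this
  by_contra hne
  exact hj ⟨s, t, hne, hs, ht, hi.symm.trans hj'⟩

theorem IsConcat.exists_extension (hb : IsConcat p a b) {x : Fin n → Fin N} (hx : Compat b x) :
    ∃ f : Fin (2 * n) → Fin N, (∀ u v, (concatGraph p a).Adj u v → f u = f v) ∧
      ∀ i, f (leftPt i) = x i := by
  classical
  have key : ∀ i j, (concatGraph p a).Reachable (leftPt i) (leftPt j) → x i = x j := by
    intro i j hij
    by_cases h : i = j
    · rw [h]
    · rw [← (hb i j h).2 hij, hx.pair]
  refine ⟨fun v => if h : ∃ i, (concatGraph p a).Reachable (leftPt i) v then x h.choose else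
    x ⟨0, by have := v.isLt; omega⟩, ?_, ?_⟩
  · intro u v huv
    dsimp only
    have e : (∃ i, (concatGraph p a).Reachable (leftPt i) u) ↔
        ∃ i, (concatGraph p a).Reachable (leftPt i) v :=
      exists_congr fun i => ⟨fun h => h.trans huv.reachable, fun h => h.trans huv.symm.reachable⟩
    by_cases h : ∃ i, (concatGraph p a).Reachable (leftPt i) u
    · rw [dif_pos h, dif_pos (e.1 h)]
      exact key _ _ (h.choose_spec.trans (huv.reachable.trans (e.1 h).choose_spec.symm))
    · rw [dif_neg h, dif_neg (fun h' => h (e.2 h'))]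
  · intro i
    have h : ∃ j, (concatGraph p a).Reachable (leftPt j) (leftPt i) :=
      ⟨i, SimpleGraph.Reachable.refl _⟩
    dsimp only
    rw [dif_pos h]
    exact key _ _ h.choose_spec

/-- The sum counts the colourings of the concatenation that extend `x`. Joined through-strings leave
none, as they would need different colours. Otherwise `x` must be compatible with the remaining
half-diagram, and each closed loop has `N` free colours. -/
theorem sum_ind_join (p : Pairing n) (a : HalfDiagram n) (x : Fin n → Fin N) :
    ∑ y : Fin n → Fin N, ind p.1 (joinCol x y) * ind a y = colour N (actBasis N p a) x := by
  classical
  have hsum : ∑ y : Fin n → Fin N, ind p.1 (joinCol x y) * ind a y =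
      (Nat.card {y : Fin n → Fin N // Compat p.1 (joinCol x y) ∧ Compat a y} : ℂ) := by
    rw [Nat.card_eq_fintype_card, Fintype.card_subtype, Finset.card_filter, Nat.cast_sum]
    apply Finset.sum_congr rfl
    intro y _
    unfold ind
    by_cases h1 : Compat p.1 (joinCol x y) <;> by_cases h2 : Compat a y <;> simp [h1, h2]
  have hconst : ∀ y, Compat p.1 (joinCol x y) ∧ Compat a y →
      ∀ u v, (concatGraph p a).Adj u v → joinCol x y u = joinCol x y v := by
    rintro y ⟨h1, h2⟩
    rw [concat_const_iff]
    exact ⟨h1.pair, fun i => by rw [joinCol_right, joinCol_right, h2.pair]⟩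
  have hright : ∀ y : Fin n → Fin N, (fun i => joinCol x y (rightPt i)) = y := fun y =>
    funext fun i => joinCol_right x y i
  have hleft : ∀ y : Fin n → Fin N, (fun i => joinCol x y (leftPt i)) = x := fun y =>
    funext fun i => joinCol_left x y i
  rw [hsum]
  by_cases hj : concatJoinsThrough p a
  · rw [actBasis_of_joins _ hj, map_zero, Pi.zero_apply, Nat.cast_eq_zero]
    have : IsEmpty {y : Fin n → Fin N // Compat p.1 (joinCol x y) ∧ Compat a y} := by
      refine ⟨fun ⟨y, hy⟩ => ?_⟩
      obtain ⟨s, t, hst, hs, ht, h⟩ := hj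
      have := eq_of_reachable (hconst y hy) h
      rw [joinCol_right, joinCol_right] at this
      exact hst (hy.2.through s t hs ht this)
    exact Nat.card_of_isEmpty
  obtain ⟨b, hb⟩ := exists_isConcat p a
  rw [actBasis_of_isConcat _ hj hb, colour_single]
  by_cases hx : Compat b x
  · rw [ind, if_pos hx, mul_one]
    obtain ⟨f₀, hf₀, hf₀x⟩ := hb.exists_extension hx
    have hcard := card_colourings (concatGraph p a) (Set.range leftPt) f₀ hf₀
    -- Each through-string reaches a left point here, so the closed loops are exactly the components
    -- without left points.
    have hset : {K : (concatGraph p a).ConnectedComponent | ∀ v ∈ Set.range leftPt,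
        (concatGraph p a).connectedComponentMk v ≠ K} =
        {K : (concatGraph p a).ConnectedComponent |
          (∀ i : Fin n, (concatGraph p a).connectedComponentMk (leftPt i) ≠ K) ∧
          ∀ s : Fin n, a.partner s = s →
            (concatGraph p a).connectedComponentMk (rightPt s) ≠ K} := by
      ext K
      simp only [Set.forall_mem_range, Set.mem_ofPred_eq]
      refine ⟨fun h => ⟨h, fun s hs => ?_⟩, fun h => h.1⟩
      obtain ⟨i, hi⟩ := concat_through_reaches_left hj hs
      rw [← SimpleGraph.ConnectedComponent.sound hi]
      exact h i
    rw [hset] at hcard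
    rw [concatLoops]
    have : (((N : ℝ) : ℂ)) = ((N : ℕ) : ℂ) := by simp
    rw [this, ← Nat.cast_pow, ← hcard]
    congr 1
    refine Nat.card_congr
      { toFun := fun y => ⟨joinCol x y.1, hconst y.1 y.2, ?_⟩
        invFun := fun f => ⟨fun i => f.1 (rightPt i), ?_, ?_⟩
        left_inv := ?_
        right_inv := ?_ }
    · rintro _ ⟨i, rfl⟩
      rw [joinCol_left, hf₀x]
    · have : joinCol x (fun i => f.1 (rightPt i)) = f.1 := by
        funext v
        revert v
        rw [forall_left_right]
        refine ⟨fun i => ?_, fun i => joinCol_right _ _ _⟩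
        rw [joinCol_left, f.2.2 _ ⟨i, rfl⟩, hf₀x]
      rw [this, compat_pairing_iff]
      exact ((concat_const_iff p a f.1).1 f.2.1).1
    · refine hb.compat_right hj f.2.1 ?_
      have : (fun i => f.1 (leftPt i)) = x := by
        funext i
        rw [f.2.2 _ ⟨i, rfl⟩, hf₀x]
      rw [this]
      exact hx
    · intro y
      exact Subtype.ext (hright y.1)
    · intro f
      apply Subtype.ext
      funext v
      revert v
      rw [forall_left_right]
      refine ⟨fun i => ?_, fun i => joinCol_right _ _ _⟩
      refine (joinCol_left _ _ _).trans ?_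
      rw [f.2.2 _ ⟨i, rfl⟩, hf₀x]
  · rw [ind, if_neg hx, mul_zero, Nat.cast_eq_zero]
    have : IsEmpty {y : Fin n → Fin N // Compat p.1 (joinCol x y) ∧ Compat a y} := by
      refine ⟨fun ⟨y, hy⟩ => hx ?_⟩
      have := hb.compat (hconst y hy) (by rw [hright]; exact hy.2)
      rwa [hleft] at this
    exact Nat.card_of_isEmpty

theorem act_single_single (q : ℝ) (p : Pairing n) (a : HalfDiagram n) (c d : ℂ) :
    act q (Finsupp.single p c) (Finsupp.single a d) = (c * d) • actBasis q p a := by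
  simp [act, Finsupp.linearCombination_single, smul_smul]

theorem colour_act_single (p : Pairing n) (z : U n) (x : Fin n → Fin N) :
    colour N (act N (Finsupp.single p 1) z) x = ∑ y, ind p.1 (joinCol x y) * colour N z y := by
  induction z using Finsupp.induction_linear with
  | zero => simp
  | add z w hz hw =>
    rw [map_add, map_add, Pi.add_apply, hz, hw, ← Finset.sum_add_distrib]
    apply Finset.sum_congr rfl
    intro y _
    rw [map_add, Pi.add_apply, mul_add]
  | single b c =>
    rw [act_single_single, map_smul, Pi.smul_apply, ← sum_ind_join, Finset.smul_sum]
    apply Finset.sum_congr rfl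
    intro y _
    rw [colour_single, smul_eq_mul]
    ring

end Join

/-! ### Colourings and the sesquilinear form -/

section Form

variable {n N : ℕ} {a b : HalfDiagram n}

/-- The component of `e` has exactly one through-string of `b`, hence an odd number of
through-strings of `a`. -/
theorem glue_through_reaches (hj : ¬ glueJoinsThrough a b) {e : Fin n} (he : b.partner e = e) :
    ∃ s, a.partner s = s ∧ (glueGraph a b).Reachable e s := by
  have h := card_through_glueComponent (a := a) (b := b) e
  have h2 : (glueComponent a b e).filter (fun y => b.partner y = y) = {e} := by
    ext y
    rw [Finset.mem_filter, mem_glueComponent, Finset.mem_singleton]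
    constructor
    · rintro ⟨hy, hy'⟩
      by_contra hne
      exact hj ⟨e, y, Ne.symm hne, hy, Or.inr ⟨he, hy'⟩⟩
    · rintro rfl
      exact ⟨SimpleGraph.Reachable.refl _, he⟩
  rw [h2, Finset.card_singleton] at h
  have : ((glueComponent a b e).filter fun y => a.partner y = y).Nonempty := by
    rw [Finset.nonempty_iff_ne_empty]
    intro h'
    rw [h'] at h
    simp at h
  obtain ⟨s, hs⟩ := this
  rw [Finset.mem_filter, mem_glueComponent] at hs
  exact ⟨s, hs.2, hs.1⟩

theorem glue_const_iff (a b : HalfDiagram n) (f : Fin n → Fin N) :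
    (∀ u v, (glueGraph a b).Adj u v → f u = f v) ↔
      (∀ v, f (a.partner v) = f v) ∧ ∀ v, f (b.partner v) = f v := by
  constructor
  · intro h
    exact ⟨fun v => (eq_of_reachable h (glueGraph_reachable_left v)).symm,
      fun i => (eq_of_reachable h (glueGraph_reachable_right i)).symm⟩
  · rintro ⟨h1, h2⟩ u v huv
    rcases glueGraph_adj huv with rfl | rfl
    · exact (h1 u).symm
    · exact (h2 u).symm

theorem glue_exists_extension (hN : n ≤ N) (hj : ¬ glueJoinsThrough a b)
    (φ : a.through → Fin N) :
    ∃ f : Fin n → Fin N, (∀ u v, (glueGraph a b).Adj u v → f u = f v) ∧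
      ∀ s : a.through, f s = φ s := by
  classical
  have key : ∀ s t : a.through, (glueGraph a b).Reachable s t → s = t := by
    intro s t h
    by_contra hne
    exact hj ⟨s, t, fun h' => hne (Subtype.ext h'), h,
      Or.inl ⟨HalfDiagram.mem_through.1 s.2, HalfDiagram.mem_through.1 t.2⟩⟩
  -- Components without a through-string of `a` get colour 0, which exists because `v.val < n ≤ N`.
  refine ⟨fun v => if h : ∃ s : a.through, (glueGraph a b).Reachable s v then φ h.choose else
    ⟨0, by have := v.isLt; omega⟩, ?_, ?_⟩
  · intro u v huv
    dsimp only
    have e : (∃ s : a.through, (glueGraph a b).Reachable s u) ↔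
        ∃ s : a.through, (glueGraph a b).Reachable s v :=
      exists_congr fun i => ⟨fun h => h.trans huv.reachable, fun h => h.trans huv.symm.reachable⟩
    by_cases h : ∃ s : a.through, (glueGraph a b).Reachable s u
    · rw [dif_pos h, dif_pos (e.1 h)]
      rw [key _ _ (h.choose_spec.trans (huv.reachable.trans (e.1 h).choose_spec.symm))]
    · rw [dif_neg h, dif_neg (fun h' => h (e.2 h'))]
  · intro s
    have h : ∃ t : a.through, (glueGraph a b).Reachable t s :=
      ⟨s, SimpleGraph.Reachable.refl _⟩
    dsimp only
    rw [dif_pos h, key _ _ h.choose_spec]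

/-- Distinct colours for the through-strings of `a` can be chosen in `N.descFactorial` ways, and
each closed loop has `N` more choices. The through-strings of `b` impose nothing new, since each of
them is connected to its own through-string of `a`. -/
theorem sum_ind_mul_ind (hN : n ≤ N) (a b : HalfDiagram n) :
    ∑ x : Fin n → Fin N, ind a x * ind b x =
      (N.descFactorial a.through.card : ℂ) * formBasis N a b := by
  classical
  have hsum : ∑ x : Fin n → Fin N, ind a x * ind b x =
      (Nat.card {x : Fin n → Fin N // Compat a x ∧ Compat b x} : ℂ) := by
    rw [Nat.card_eq_fintype_card, Fintype.card_subtype, Finset.card_filter, Nat.cast_sum]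
    apply Finset.sum_congr rfl
    intro y _
    unfold ind
    by_cases h1 : Compat a y <;> by_cases h2 : Compat b y <;> simp [h1, h2]
  have hconst : ∀ x : Fin n → Fin N, Compat a x ∧ Compat b x →
      ∀ u v, (glueGraph a b).Adj u v → x u = x v := fun x h =>
    (glue_const_iff a b x).2 ⟨h.1.pair, h.2.pair⟩
  rw [hsum, formBasis]
  split_ifs with hj
  · rw [mul_zero, Nat.cast_eq_zero]
    have : IsEmpty {x : Fin n → Fin N // Compat a x ∧ Compat b x} := by
      refine ⟨fun ⟨x, hx⟩ => ?_⟩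
      obtain ⟨s, t, hst, h, ⟨h1, h2⟩ | ⟨h1, h2⟩⟩ := hj
      · exact hst (hx.1.through s t h1 h2 (eq_of_reachable (hconst x hx) h))
      · exact hst (hx.2.through s t h1 h2 (eq_of_reachable (hconst x hx) h))
    exact Nat.card_of_isEmpty
  · have hset : {K : (glueGraph a b).ConnectedComponent | ∀ s ∈ (a.through : Set (Fin n)),
        (glueGraph a b).connectedComponentMk s ≠ K} =
        {K : (glueGraph a b).ConnectedComponent |
          ∀ s : Fin n, (a.partner s = s ∨ b.partner s = s) →
            (glueGraph a b).connectedComponentMk s ≠ K} := by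
      ext K
      simp only [Set.mem_ofPred_eq, Finset.mem_coe, HalfDiagram.mem_through]
      refine ⟨fun h s hs => ?_, fun h s hs => h s (Or.inl hs)⟩
      rcases hs with hs | hs
      · exact h s hs
      · obtain ⟨t, ht, hst⟩ := glue_through_reaches hj hs
        rw [SimpleGraph.ConnectedComponent.sound hst]
        exact h t ht
    have hfib : ∀ φ : a.through ↪ Fin N, Nat.card {f : Fin n → Fin N //
        (∀ u v, (glueGraph a b).Adj u v → f u = f v) ∧ ∀ s : a.through, f s = φ s} =
        N ^ glueLoops a b := by
      intro φ
      obtain ⟨f₀, hf₀, hφ⟩ := glue_exists_extension hN hj φ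
      have hcard := card_colourings (glueGraph a b) (a.through : Set (Fin n)) f₀ hf₀
      rw [hset] at hcard
      rw [glueLoops, ← hcard]
      apply Nat.card_congr
      apply Equiv.subtypeEquivRight
      intro f
      refine and_congr_right fun _ => ?_
      constructor
      · intro h s hs
        rw [h ⟨s, hs⟩, hφ ⟨s, hs⟩]
      · intro h s
        rw [h s s.2, hφ]
    have hequiv : {x : Fin n → Fin N // Compat a x ∧ Compat b x} ≃
        Σ φ : a.through ↪ Fin N, {f : Fin n → Fin N //
          (∀ u v, (glueGraph a b).Adj u v → f u = f v) ∧ ∀ s : a.through, f s = φ s} :=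
      { toFun := fun x => ⟨⟨fun s => x.1 s, fun s t h => Subtype.ext (x.2.1.through _ _
            (HalfDiagram.mem_through.1 s.2) (HalfDiagram.mem_through.1 t.2) h)⟩,
          ⟨x.1, hconst x.1 x.2, fun s => rfl⟩⟩
        invFun := fun f => ⟨f.2.1, by
          obtain ⟨φ, f, hf, hfφ⟩ := f
          have hc := (glue_const_iff a b f).1 hf
          refine ⟨⟨hc.1, fun s t hs ht hst => ?_⟩, ⟨hc.2, fun s t hs ht hst => ?_⟩⟩
          · dsimp only at hst
            have h1 := hfφ ⟨s, HalfDiagram.mem_through.2 hs⟩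
            have h2 := hfφ ⟨t, HalfDiagram.mem_through.2 ht⟩
            dsimp only at h1 h2
            rw [h1, h2] at hst
            exact congrArg Subtype.val (φ.injective hst)
          · obtain ⟨s', hs', hr⟩ := glue_through_reaches hj hs
            obtain ⟨t', ht', hr'⟩ := glue_through_reaches hj ht
            have h1 := hfφ ⟨s', HalfDiagram.mem_through.2 hs'⟩
            have h2 := hfφ ⟨t', HalfDiagram.mem_through.2 ht'⟩
            dsimp only at h1 h2 hst
            rw [eq_of_reachable hf hr, eq_of_reachable hf hr', h1, h2] at hst
            have h3 : s' = t' := congrArg Subtype.val (φ.injective hst)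
            subst h3
            by_contra hne
            exact hj ⟨s, t, hne, hr.trans hr'.symm, Or.inr ⟨hs, ht⟩⟩⟩
        left_inv := fun x => rfl
        right_inv := by
          rintro ⟨φ, f, hf, hfφ⟩
          refine Sigma.subtype_ext ?_ rfl
          ext1 s
          exact hfφ s }
    rw [Nat.card_congr hequiv, Nat.card_sigma]
    simp only [hfib]
    rw [Finset.sum_const, Finset.card_univ, Fintype.card_embedding_eq, Fintype.card_fin,
      Fintype.card_coe]
    push_cast
    rw [nsmul_eq_mul]
    push_cast
    rfl

end Form


/-! ### Identities which are polynomial in `q` -/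

/-- A polynomial function of `q`. -/
def IsPoly (f : ℝ → ℂ) : Prop := ∃ P : Polynomial ℂ, ∀ q : ℝ, f q = P.eval (q : ℂ)

theorem IsPoly.const (c : ℂ) : IsPoly fun _ => c := ⟨Polynomial.C c, by simp⟩

theorem IsPoly.id_pow (k : ℕ) : IsPoly fun q => (q : ℂ) ^ k := ⟨Polynomial.X ^ k, by simp⟩

theorem IsPoly.add {f g : ℝ → ℂ} (hf : IsPoly f) (hg : IsPoly g) :
    IsPoly fun q => f q + g q := by
  obtain ⟨P, hP⟩ := hf
  obtain ⟨Q, hQ⟩ := hg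
  exact ⟨P + Q, fun q => by simp only [hP, hQ, Polynomial.eval_add]⟩

theorem IsPoly.mul {f g : ℝ → ℂ} (hf : IsPoly f) (hg : IsPoly g) :
    IsPoly fun q => f q * g q := by
  obtain ⟨P, hP⟩ := hf
  obtain ⟨Q, hQ⟩ := hg
  exact ⟨P * Q, fun q => by simp only [hP, hQ, Polynomial.eval_mul]⟩

theorem IsPoly.sum {ι : Type*} (s : Finset ι) {f : ι → ℝ → ℂ} (hf : ∀ i ∈ s, IsPoly (f i)) :
    IsPoly fun q => ∑ i ∈ s, f i q := by
  classical
  induction s using Finset.induction_on with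
  | empty => simpa using IsPoly.const 0
  | insert i s hi ih =>
    simp only [Finset.sum_insert hi]
    exact (hf i (Finset.mem_insert_self i s)).add
      (ih fun j hj => hf j (Finset.mem_insert_of_mem hj))

/-- Polynomials that agree at infinitely many points are equal. The bound `N₀` leaves room for a
colour model that is faithful only for large `N`. -/
theorem IsPoly.ext {f g : ℝ → ℂ} (hf : IsPoly f) (hg : IsPoly g) {N₀ : ℕ}
    (h : ∀ N : ℕ, N₀ ≤ N → f N = g N) : f = g := by
  obtain ⟨P, hP⟩ := hf
  obtain ⟨Q, hQ⟩ := hg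
  have : P = Q := by
    apply Polynomial.eq_of_infinite_eval_eq
    refine Set.Infinite.mono (s := (fun N : ℕ => (N : ℂ)) '' Set.Ici N₀) ?_
      ((Set.Ici_infinite N₀).image Nat.cast_injective.injOn)
    rintro _ ⟨N, hN, rfl⟩
    have := h N hN
    rw [hP, hQ] at this
    simpa using this
  funext q
  rw [hP, hQ, this]

/-- A family of vectors with polynomial coefficients. -/
def IsPolyVec {α : Type*} (f : ℝ → α →₀ ℂ) : Prop := ∀ a, IsPoly fun q => f q a

theorem IsPolyVec.const {α : Type*} (z : α →₀ ℂ) : IsPolyVec fun _ => z := fun a =>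
  IsPoly.const (z a)

theorem IsPolyVec.smul {α : Type*} {c : ℝ → ℂ} {f : ℝ → α →₀ ℂ} (hc : IsPoly c)
    (hf : IsPolyVec f) : IsPolyVec fun q => c q • f q := fun a => hc.mul (hf a)

theorem IsPolyVec.ext {α : Type*} {f g : ℝ → α →₀ ℂ} (hf : IsPolyVec f) (hg : IsPolyVec g)
    {N₀ : ℕ} (h : ∀ N : ℕ, N₀ ≤ N → f N = g N) : f = g := by
  funext q
  ext a
  exact congrFun ((hf a).ext (hg a) fun N hN => by rw [h N hN]) q

instance {n : ℕ} : Finite (HalfDiagram n) :=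
  Finite.of_injective HalfDiagram.partner fun _ _ h => HalfDiagram.ext h

instance {n : ℕ} : Finite (Pairing n) := Subtype.finite

theorem isPolyVec_actBasis {n : ℕ} (p : Pairing n) (a : HalfDiagram n) :
    IsPolyVec fun q => actBasis q p a := by
  intro b
  by_cases hj : concatJoinsThrough p a
  · simpa [actBasis_of_joins _ hj] using IsPoly.const 0
  · obtain ⟨c, hc⟩ := exists_isConcat p a
    simp only [actBasis_of_isConcat _ hj hc]
    by_cases h : c = b
    · subst h
      simpa using IsPoly.id_pow _
    · simpa [Finsupp.single_eq_of_ne (Ne.symm h)] using IsPoly.const 0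

theorem act_eq_sum (q : ℝ) {n : ℕ} (w : TL n) (z : U n) :
    act q w z = w.sum fun p c => z.sum fun a d => (c * d) • actBasis q p a := by
  rw [act, Finsupp.linearCombination_apply, Finsupp.sum, Finsupp.sum, LinearMap.sum_apply]
  apply Finset.sum_congr rfl
  intro p _
  rw [LinearMap.smul_apply, Finsupp.linearCombination_apply, Finsupp.smul_sum]
  simp only [smul_smul]

theorem IsPolyVec.act {n : ℕ} {w : ℝ → TL n} {z : ℝ → U n} (hw : IsPolyVec w)
    (hz : IsPolyVec z) : IsPolyVec fun q => TemperleyLieb.act q (w q) (z q) := by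
  have := Fintype.ofFinite (HalfDiagram n)
  have := Fintype.ofFinite (Pairing n)
  intro b
  have e : ∀ q, TemperleyLieb.act q (w q) (z q) b =
      ∑ p, ∑ a, (w q p * z q a) * actBasis q p a b := by
    intro q
    rw [act_eq_sum, Finsupp.sum_fintype _ _ (by simp), Finsupp.finsetSum_apply]
    apply Finset.sum_congr rfl
    intro p _
    rw [Finsupp.sum_fintype _ _ (by simp), Finsupp.finsetSum_apply]
    rfl
  simp only [e]
  exact IsPoly.sum _ fun p _ => IsPoly.sum _ fun a _ =>
    ((hw p).mul (hz a)).mul (isPolyVec_actBasis p a b)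

/-! ### The generators -/

/-- The action of a generator of `TL_n` on `U(n)`. -/
noncomputable def gen (q : ℝ) {n : ℕ} (i : ℕ) (hi : i + 1 < n) : U n →ₗ[ℂ] U n :=
  act q (Finsupp.single (genDiagram i hi) 1)

theorem IsPolyVec.gen {n : ℕ} {z : ℝ → U n} (hz : IsPolyVec z) (i : ℕ) (hi : i + 1 < n) :
    IsPolyVec fun q => TemperleyLieb.gen q i hi (z q) :=
  (IsPolyVec.const _).act hz

theorem genDiagram_left {n i : ℕ} (hi : i + 1 < n) :
    (genDiagram i hi).1.partner (leftPt ⟨i, by omega⟩) = leftPt ⟨i + 1, hi⟩ := by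
  simp [genDiagram, leftPt]

theorem genDiagram_left_succ {n i : ℕ} (hi : i + 1 < n) :
    (genDiagram i hi).1.partner (leftPt ⟨i + 1, hi⟩) = leftPt ⟨i, by omega⟩ := by
  simp [genDiagram, leftPt]

theorem genDiagram_left_other {n i : ℕ} (hi : i + 1 < n) {j : Fin n} (h1 : j.val ≠ i)
    (h2 : j.val ≠ i + 1) : (genDiagram i hi).1.partner (leftPt j) = rightPt j := by
  apply Fin.ext
  simp only [genDiagram, leftPt, rightPt]
  split_ifs <;> omega

theorem genDiagram_right {n i : ℕ} (hi : i + 1 < n) :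
    (genDiagram i hi).1.partner (rightPt ⟨i, by omega⟩) = rightPt ⟨i + 1, hi⟩ := by
  apply Fin.ext
  simp only [genDiagram, rightPt]
  split_ifs <;> omega

theorem genDiagram_right_succ {n i : ℕ} (hi : i + 1 < n) :
    (genDiagram i hi).1.partner (rightPt ⟨i + 1, hi⟩) = rightPt ⟨i, by omega⟩ := by
  rw [← genDiagram_right hi, HalfDiagram.partner_partner]

theorem genDiagram_right_other {n i : ℕ} (hi : i + 1 < n) {j : Fin n} (h1 : j.val ≠ i)
    (h2 : j.val ≠ i + 1) : (genDiagram i hi).1.partner (rightPt j) = leftPt j := by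
  rw [← genDiagram_left_other hi h1 h2, HalfDiagram.partner_partner]

/-- Recolouring of two adjacent points. -/
def recolour {n N : ℕ} (x : Fin n → Fin N) (i : ℕ) (c : Fin N) (j : Fin n) : Fin N :=
  if j.val = i ∨ j.val = i + 1 then c else x j

/-- The action of a generator on functions on colourings. -/
noncomputable def mergeOp {n N : ℕ} (i : ℕ) (hi : i + 1 < n) (F : (Fin n → Fin N) → ℂ)
    (x : Fin n → Fin N) : ℂ :=
  if x ⟨i, by omega⟩ = x ⟨i + 1, hi⟩ then ∑ c, F (recolour x i c) else 0

theorem compat_genDiagram_iff {n N : ℕ} {i : ℕ} (hi : i + 1 < n) (x y : Fin n → Fin N) :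
    Compat (genDiagram i hi).1 (joinCol x y) ↔
      x ⟨i, by omega⟩ = x ⟨i + 1, hi⟩ ∧ ∃ c, y = recolour x i c := by
  rw [compat_pairing_iff]
  constructor
  · intro h
    refine ⟨?_, y ⟨i, by omega⟩, ?_⟩
    · have := h (leftPt ⟨i, by omega⟩)
      rw [genDiagram_left, joinCol_left, joinCol_left] at this
      exact this.symm
    · funext j
      unfold recolour
      split_ifs with hj
      · rcases hj with hj | hj
        · congr 1
          exact Fin.ext hj
        · have := h (rightPt ⟨i, by omega⟩)
          rw [genDiagram_right, joinCol_right, joinCol_right] at this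
          rw [← this]
          congr 1
          exact Fin.ext hj
      · push Not at hj
        have := h (leftPt j)
        rw [genDiagram_left_other hi hj.1 hj.2, joinCol_left, joinCol_right] at this
        exact this
  · rintro ⟨hx, c, rfl⟩
    rw [forall_left_right]
    constructor
    · intro j
      by_cases h1 : j.val = i
      · rw [show j = ⟨i, by omega⟩ from Fin.ext h1, genDiagram_left, joinCol_left, joinCol_left, hx]
      by_cases h2 : j.val = i + 1
      · obtain rfl : j = ⟨i + 1, hi⟩ := Fin.ext h2
        rw [genDiagram_left_succ, joinCol_left, joinCol_left, hx]
      rw [genDiagram_left_other hi h1 h2, joinCol_left, joinCol_right]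
      simp [recolour, h1, h2]
    · intro j
      by_cases h1 : j.val = i
      · rw [show j = ⟨i, by omega⟩ from Fin.ext h1, genDiagram_right, joinCol_right, joinCol_right]
        simp [recolour]
      by_cases h2 : j.val = i + 1
      · obtain rfl : j = ⟨i + 1, hi⟩ := Fin.ext h2
        rw [genDiagram_right_succ, joinCol_right, joinCol_right]
        simp [recolour]
      rw [genDiagram_right_other hi h1 h2, joinCol_left, joinCol_right]
      simp [recolour, h1, h2]

/-- The colourings compatible with the generator have one common colour at the two left points and a
second, independent one at the two right points; the sum runs over the second. -/
theorem sum_ind_genDiagram {n N : ℕ} {i : ℕ} (hi : i + 1 < n) (F : (Fin n → Fin N) → ℂ)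
    (x : Fin n → Fin N) :
    ∑ y, ind (genDiagram i hi).1 (joinCol x y) * F y = mergeOp i hi F x := by
  classical
  unfold mergeOp
  split_ifs with hx
  · symm
    refine Finset.sum_of_injOn (fun c => recolour x i c) ?_ (fun _ _ => Finset.mem_coe.2
      (Finset.mem_univ _)) ?_ ?_
    · intro c _ d _ h
      have := congrFun h ⟨i, by omega⟩
      simpa [recolour] using this
    · intro y _ hy
      rw [ind, if_neg, zero_mul]
      rw [compat_genDiagram_iff]
      rintro ⟨_, c, rfl⟩
      exact hy ⟨c, Finset.mem_coe.2 (Finset.mem_univ _), rfl⟩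
    · intro c _
      rw [ind, if_pos, one_mul]
      rw [compat_genDiagram_iff]
      exact ⟨hx, c, rfl⟩
  · apply Finset.sum_eq_zero
    intro y _
    rw [ind, if_neg, zero_mul]
    rw [compat_genDiagram_iff]
    exact fun h => hx h.1

theorem colour_gen {n N : ℕ} {i : ℕ} (hi : i + 1 < n) (z : U n) :
    colour N (gen N i hi z) = mergeOp i hi (colour N z) := by
  funext x
  rw [gen, colour_act_single, sum_ind_genDiagram]

section Relations

variable {n N : ℕ}

theorem recolour_recolour (x : Fin n → Fin N) (i : ℕ) (c d : Fin N) :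
    recolour (recolour x i c) i d = recolour x i d := by
  funext j
  unfold recolour
  split_ifs <;> rfl

theorem mergeOp_mergeOp {i : ℕ} (hi : i + 1 < n) (F : (Fin n → Fin N) → ℂ) :
    mergeOp i hi (mergeOp i hi F) = (N : ℂ) • mergeOp i hi F := by
  funext x
  rw [Pi.smul_apply]
  unfold mergeOp
  simp only [recolour_recolour]
  split_ifs with h
  · simp [recolour]
  · simp

theorem mergeOp_comm {i j : ℕ} (hi : i + 1 < n) (hj : j + 1 < n) (hij : i + 1 < j)
    (F : (Fin n → Fin N) → ℂ) :
    mergeOp i hi (mergeOp j hj F) = mergeOp j hj (mergeOp i hi F) := by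
  funext x
  have e1 : ∀ c d, recolour (recolour x i c) j d = recolour (recolour x j d) i c := by
    intro c d
    funext k
    unfold recolour
    split_ifs <;> first | rfl | omega
  have e2 : ∀ c, recolour x i c ⟨j, by omega⟩ = x ⟨j, by omega⟩ := fun c => by
    rw [recolour, if_neg]; dsimp only; omega
  have e3 : ∀ c, recolour x i c ⟨j + 1, hj⟩ = x ⟨j + 1, hj⟩ := fun c => by
    rw [recolour, if_neg]; dsimp only; omega
  have e4 : ∀ c, recolour x j c ⟨i, by omega⟩ = x ⟨i, by omega⟩ := fun c => by
    rw [recolour, if_neg]; dsimp only; omega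
  have e5 : ∀ c, recolour x j c ⟨i + 1, hi⟩ = x ⟨i + 1, hi⟩ := fun c => by
    rw [recolour, if_neg]; dsimp only; omega
  unfold mergeOp
  simp only [e2, e3, e4, e5, e1]
  split_ifs with h1 h2
  · exact Finset.sum_comm
  all_goals simp

theorem mergeOp_braid_up {i : ℕ} (hi : i + 1 < n) (hj : i + 1 + 1 < n)
    (F : (Fin n → Fin N) → ℂ) :
    mergeOp i hi (mergeOp (i + 1) hj (mergeOp i hi F)) = mergeOp i hi F := by
  funext x
  have e1 : ∀ c, recolour x i c ⟨i + 1, hi⟩ = c := fun c => by simp [recolour]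
  have e2 : ∀ c, recolour x i c ⟨i + 1 + 1, hj⟩ = x ⟨i + 1 + 1, hj⟩ := fun c => by
    simp [recolour]; omega
  have e3 : ∀ c d, recolour (recolour x i c) (i + 1) d ⟨i, by omega⟩ = c := fun c d => by
    simp [recolour]; omega
  have e4 : ∀ c d, recolour (recolour x i c) (i + 1) d ⟨i + 1, hi⟩ = d := fun c d => by
    simp [recolour]
  -- The middle operators force both summed colours to be that of the point `i + 2`. The
  -- recolourings then leave that point unchanged and compose to a single one.
  have e5 : ∀ d, recolour (recolour (recolour x i (x ⟨i + 1 + 1, hj⟩)) (i + 1)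
      (x ⟨i + 1 + 1, hj⟩)) i d = recolour x i d := by
    intro d
    funext k
    unfold recolour
    split_ifs <;> first | rfl | omega | (congr 1; apply Fin.ext; dsimp only; omega)
  unfold mergeOp
  simp only [e1, e2, e3, e4]
  split_ifs with h
  · simp only [Finset.sum_ite_eq, Finset.sum_ite_eq', Finset.mem_univ, if_true, e5]
  · rfl

theorem mergeOp_braid_down {i : ℕ} (hi : i + 1 < n) (hj : i + 1 + 1 < n)
    (F : (Fin n → Fin N) → ℂ) :
    mergeOp (i + 1) hj (mergeOp i hi (mergeOp (i + 1) hj F)) = mergeOp (i + 1) hj F := by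
  funext x
  have e1 : ∀ c, recolour x (i + 1) c ⟨i + 1, hi⟩ = c := fun c => by simp [recolour]
  have e2 : ∀ c, recolour x (i + 1) c ⟨i, by omega⟩ = x ⟨i, by omega⟩ := fun c => by
    simp [recolour]; omega
  have e3 : ∀ c d, recolour (recolour x (i + 1) c) i d ⟨i + 1 + 1, hj⟩ = c := fun c d => by
    simp [recolour]; omega
  have e4 : ∀ c d, recolour (recolour x (i + 1) c) i d ⟨i + 1, hi⟩ = d := fun c d => by
    simp [recolour]
  have e5 : ∀ d, recolour (recolour (recolour x (i + 1) (x ⟨i, by omega⟩)) i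
      (x ⟨i, by omega⟩)) (i + 1) d = recolour x (i + 1) d := by
    intro d
    funext k
    unfold recolour
    split_ifs <;> first | rfl | omega | (congr 1; apply Fin.ext; dsimp only; omega)
  unfold mergeOp
  simp only [e1, e2, e3, e4]
  split_ifs with h
  · simp only [Finset.sum_ite_eq, Finset.sum_ite_eq', Finset.mem_univ, if_true, e5]
  · rfl

/-- This is the pattern for all relations: both sides are polynomial in `q`, and for `q = N ≥ n`
they are compared in the faithful colour model. -/
theorem gen_gen (q : ℝ) {i : ℕ} (hi : i + 1 < n) (z : U n) :
    gen q i hi (gen q i hi z) = (q : ℂ) • gen q i hi z := by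
  have hz := IsPolyVec.const z
  refine congrFun (IsPolyVec.ext (f := fun q => gen q i hi (gen q i hi z))
    (g := fun q => (q : ℂ) • gen q i hi z) ((hz.gen i hi).gen i hi)
    (IsPolyVec.smul ⟨Polynomial.X, by simp⟩ (hz.gen i hi)) (N₀ := n) fun N hN => ?_) q
  apply colour_injective hN
  rw [colour_gen, colour_gen, mergeOp_mergeOp, map_smul, colour_gen]
  simp

theorem gen_comm (q : ℝ) {i j : ℕ} (hi : i + 1 < n) (hj : j + 1 < n)
    (hij : i + 1 < j ∨ j + 1 < i) (z : U n) :
    gen q i hi (gen q j hj z) = gen q j hj (gen q i hi z) := by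
  have hz := IsPolyVec.const z
  refine congrFun (IsPolyVec.ext (f := fun q => gen q i hi (gen q j hj z))
    (g := fun q => gen q j hj (gen q i hi z)) ((hz.gen j hj).gen i hi)
    ((hz.gen i hi).gen j hj) (N₀ := n) fun N hN => ?_) q
  apply colour_injective hN
  rw [colour_gen, colour_gen, colour_gen, colour_gen]
  rcases hij with h | h
  · exact mergeOp_comm hi hj h _
  · exact (mergeOp_comm hj hi h _).symm

theorem gen_braid_up (q : ℝ) {i : ℕ} (hi : i + 1 < n) (hj : i + 1 + 1 < n) (z : U n) :
    gen q i hi (gen q (i + 1) hj (gen q i hi z)) = gen q i hi z := by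
  have hz := IsPolyVec.const z
  refine congrFun (IsPolyVec.ext (f := fun q => gen q i hi (gen q (i + 1) hj (gen q i hi z)))
    (g := fun q => gen q i hi z) (((hz.gen i hi).gen (i + 1) hj).gen i hi)
    (hz.gen i hi) (N₀ := n) fun N hN => ?_) q
  apply colour_injective hN
  rw [colour_gen, colour_gen, colour_gen, mergeOp_braid_up]

theorem gen_braid_down (q : ℝ) {i : ℕ} (hi : i + 1 < n) (hj : i + 1 + 1 < n) (z : U n) :
    gen q (i + 1) hj (gen q i hi (gen q (i + 1) hj z)) = gen q (i + 1) hj z := by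
  have hz := IsPolyVec.const z
  refine congrFun (IsPolyVec.ext
    (f := fun q => gen q (i + 1) hj (gen q i hi (gen q (i + 1) hj z)))
    (g := fun q => gen q (i + 1) hj z) (((hz.gen (i + 1) hj).gen i hi).gen (i + 1) hj)
    (hz.gen (i + 1) hj) (N₀ := n) fun N hN => ?_) q
  apply colour_injective hN
  rw [colour_gen, colour_gen, colour_gen, mergeOp_braid_down]

end Relations


/-! ### The generators on basis elements -/

section GenBasis

variable {n : ℕ}

theorem gen_single (q : ℝ) {i : ℕ} (hi : i + 1 < n) (a : HalfDiagram n) :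
    gen q i hi (Finsupp.single a 1) = actBasis q (genDiagram i hi) a := by
  rw [gen, act_single_single, mul_one, one_smul]

/-- Neither the alternative nor `b` and `k` depend on `q`, and the number of through-strings is
kept. -/
theorem gen_single_monomial {i : ℕ} (hi : i + 1 < n) (a : HalfDiagram n) :
    (∀ q, gen q i hi (Finsupp.single a 1) = 0) ∨
      ∃ (b : HalfDiagram n) (k : ℕ), b.through.card = a.through.card ∧
        ∀ q : ℝ, gen q i hi (Finsupp.single a 1) = Finsupp.single b ((q : ℂ) ^ k) := by
  by_cases hj : concatJoinsThrough (genDiagram i hi) a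
  · exact Or.inl fun q => by rw [gen_single, actBasis_of_joins q hj]
  · obtain ⟨b, hb⟩ := exists_isConcat (genDiagram i hi) a
    exact Or.inr ⟨b, _, hb.card_through hj, fun q => by
      rw [gen_single, actBasis_of_isConcat q hj hb]⟩

theorem colour_single_one {N : ℕ} (a : HalfDiagram n) :
    colour N (Finsupp.single a 1) = ind a := by
  funext x
  rw [colour_single, one_mul]

theorem gen_single_of_through (q : ℝ) {i : ℕ} (hi : i + 1 < n) {a : HalfDiagram n}
    (h1 : a.partner ⟨i, by omega⟩ = ⟨i, by omega⟩) (h2 : a.partner ⟨i + 1, hi⟩ = ⟨i + 1, hi⟩) :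
    gen q i hi (Finsupp.single a 1) = 0 := by
  rw [gen_single, actBasis_of_joins]
  refine ⟨_, _, ?_, h1, h2, ?_⟩
  · simp [Fin.ext_iff]
  · have := concatGraph_reachable_left (p := genDiagram i hi) (a := a) (rightPt ⟨i, by omega⟩)
    rwa [genDiagram_right] at this

theorem gen_single_of_pair (q : ℝ) {i : ℕ} (hi : i + 1 < n) {a : HalfDiagram n}
    (h : a.partner ⟨i, by omega⟩ = ⟨i + 1, hi⟩) :
    gen q i hi (Finsupp.single a 1) = (q : ℂ) • Finsupp.single a 1 := by
  have h' : a.partner ⟨i + 1, hi⟩ = ⟨i, by omega⟩ := by rw [← h, a.partner_partner]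
  have hz := IsPolyVec.const (Finsupp.single a (1 : ℂ))
  refine congrFun (IsPolyVec.ext (f := fun q => gen q i hi (Finsupp.single a 1))
    (g := fun q => (q : ℂ) • Finsupp.single a 1) (hz.gen i hi)
    (IsPolyVec.smul ⟨Polynomial.X, by simp⟩ hz) (N₀ := n) fun N hN => ?_) q
  apply colour_injective hN
  rw [colour_gen, map_smul, colour_single_one]
  funext x
  have hoff : ∀ j : Fin n, j.val ≠ i → j.val ≠ i + 1 →
      (a.partner j).val ≠ i ∧ (a.partner j).val ≠ i + 1 := by
    intro j hj1 hj2
    constructor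
    · intro hj
      have h3 : a.partner j = ⟨i, by omega⟩ := Fin.ext hj
      have : j = ⟨i + 1, hi⟩ := by rw [← h, ← h3, a.partner_partner]
      exact hj2 (congrArg Fin.val this)
    · intro hj
      have h3 : a.partner j = ⟨i + 1, hi⟩ := Fin.ext hj
      have : j = ⟨i, by omega⟩ := by rw [← h', ← h3, a.partner_partner]
      exact hj1 (congrArg Fin.val this)
  have hthr : ∀ s : Fin n, a.partner s = s → s.val ≠ i ∧ s.val ≠ i + 1 := by
    intro s hs
    constructor
    · intro h3
      have h4 : s = ⟨i, by omega⟩ := Fin.ext h3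
      rw [h4, h] at hs
      simp [Fin.ext_iff] at hs
    · intro h3
      have h4 : s = ⟨i + 1, hi⟩ := Fin.ext h3
      rw [h4, h'] at hs
      simp [Fin.ext_iff] at hs
  by_cases hx : x ⟨i, by omega⟩ = x ⟨i + 1, hi⟩
  · have key : ∀ c, ind a (recolour x i c) = ind a x := by
      intro c
      unfold ind
      congr 1
      apply propext
      constructor
      · rintro ⟨hp, ht⟩
        refine ⟨fun j => ?_, fun s t hs ht' hst => ?_⟩
        · by_cases h1 : j.val = i
          · rw [show j = ⟨i, by omega⟩ from Fin.ext h1, h, hx]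
          by_cases h2 : j.val = i + 1
          · rw [show j = ⟨i + 1, hi⟩ from Fin.ext h2, h', hx]
          have := hp j
          have h3 := hoff j h1 h2
          simpa [recolour, h1, h2, h3.1, h3.2] using this
        · apply ht s t hs ht'
          simp [recolour, hthr s hs, hthr t ht', hst]
      · rintro ⟨hp, ht⟩
        refine ⟨fun j => ?_, fun s t hs ht' hst => ?_⟩
        · by_cases h1 : j.val = i
          · rw [show j = ⟨i, by omega⟩ from Fin.ext h1, h]
            simp [recolour]
          by_cases h2 : j.val = i + 1
          · rw [show j = ⟨i + 1, hi⟩ from Fin.ext h2, h']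
            simp [recolour]
          have h3 := hoff j h1 h2
          simp [recolour, h1, h2, h3.1, h3.2, hp j]
        · apply ht s t hs ht'
          simpa [recolour, hthr s hs, hthr t ht'] using hst
    rw [mergeOp, if_pos hx]
    simp [key]
  · rw [mergeOp, if_neg hx, Pi.smul_apply, ind, if_neg, smul_zero]
    intro hc
    have := hc.pair ⟨i, by omega⟩
    rw [h] at this
    exact hx this.symm

/-- The colouring which separates the blocks of a half-diagram except for those of two points. -/
def HalfDiagram.mergedCol {N : ℕ} (a : HalfDiagram n) (h : n ≤ N) (u v : Fin n) (j : Fin n) :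
    Fin N :=
  if a.canon h j = a.canon h v then a.canon h u else a.canon h j

/-- Giving two blocks the same colour violates compatibility only if both are through-strings. -/
theorem HalfDiagram.compat_mergedCol {N : ℕ} (a : HalfDiagram n) (h : n ≤ N) {u v : Fin n}
    (huv : ¬ (a.partner u = u ∧ a.partner v = v)) : Compat a (a.mergedCol h u v) := by
  have hc := (compat_canon_iff a a h).2 rfl
  have hthr : ∀ s w, a.partner s = s → a.canon h s = a.canon h w → w = s := by
    intro s w hs hsw
    rcases (a.canon_eq_iff h).1 hsw with h' | h'
    · exact h'.symm
    · rw [← h', hs]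
  refine ⟨fun j => ?_, fun s t hs ht hst => ?_⟩
  · unfold HalfDiagram.mergedCol
    rw [hc.pair]
  · unfold HalfDiagram.mergedCol at hst
    split_ifs at hst with h1 h2 h2
    · exact (hthr s v hs h1).symm.trans (hthr t v ht h2)
    · have e1 := hthr s v hs h1
      have e2 := hthr t u ht hst.symm
      subst e1 e2
      exact absurd ⟨ht, hs⟩ huv
    · have e1 := hthr t v ht h2
      have e2 := hthr s u hs hst
      subst e1 e2
      exact absurd ⟨hs, ht⟩ huv
    · exact hc.through s t hs ht hst

/-- One of the two points has its partner `u` elsewhere. Recolouring does not touch `u`, so only the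
original colour gives a compatible colouring. -/
theorem mergeOp_ind_mergedCol {N : ℕ} (a : HalfDiagram n) (h : n ≤ N) {i : ℕ} (hi : i + 1 < n)
    (h1 : a.partner ⟨i, by omega⟩ ≠ ⟨i + 1, hi⟩)
    (h2 : ¬ (a.partner ⟨i, by omega⟩ = ⟨i, by omega⟩ ∧
      a.partner ⟨i + 1, hi⟩ = ⟨i + 1, hi⟩)) :
    mergeOp i hi (ind a) (a.mergedCol h ⟨i, by omega⟩ ⟨i + 1, hi⟩) = 1 := by
  set I : Fin n := ⟨i, by omega⟩ with hI
  set J : Fin n := ⟨i + 1, hi⟩ with hJ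
  set y := a.mergedCol h I J with hy
  have hcompat : Compat a y := a.compat_mergedCol h h2
  have h1' : a.partner J ≠ I := fun h' => h1 (by rw [← h', a.partner_partner])
  have hyJ : y J = a.canon h I := by simp [hy, HalfDiagram.mergedCol]
  have hyI : y I = a.canon h I := by simp [hy, HalfDiagram.mergedCol]
  have hIJ : y I = y J := hyI.trans hyJ.symm
  obtain ⟨u, hu1, hu2, hu⟩ : ∃ u : Fin n, u.val ≠ i ∧ u.val ≠ i + 1 ∧
      (a.partner u = I ∨ a.partner u = J) := by
    by_cases h3 : a.partner I = I
    · have h4 : a.partner J ≠ J := fun h4 => h2 ⟨h3, h4⟩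
      exact ⟨a.partner J, fun h => h1' (Fin.ext h), fun h => h4 (Fin.ext h),
        Or.inr (a.partner_partner J)⟩
    · exact ⟨a.partner I, fun h => h3 (Fin.ext h), fun h => h1 (Fin.ext h),
        Or.inl (a.partner_partner I)⟩
  have hyu : y u = y I := by
    rcases hu with hu | hu
    · rw [← hu, hcompat.pair]
    · rw [hIJ, ← hu, hcompat.pair]
  rw [mergeOp, if_pos hIJ, Finset.sum_eq_single_of_mem (y I) (Finset.mem_univ _)]
  · have : recolour y i (y I) = y := by
      funext j
      unfold recolour
      split_ifs with hj
      · rcases hj with hj | hj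
        · rw [show j = I from Fin.ext hj]
        · rw [show j = J from Fin.ext hj, hIJ]
      · rfl
    rw [this, ind, if_pos hcompat]
  · intro c _ hc
    rw [ind, if_neg]
    intro hcc
    have := hcc.pair u
    apply hc
    rcases hu with hu | hu <;> rw [hu] at this <;>
      simp only [recolour, hu1, hu2, hI, hJ, true_or, or_true, or_false, if_true, if_false] at this
    · rw [this, ← hyu]
    · rw [this, ← hyu]

/-- The excluded cases are those with a closed loop or with joined through-strings. In the colour
model the result takes the value 1 at one colouring, so its coefficient is neither 0 nor a positive
power of `N`. The remaining clauses follow the paths through the generator. -/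
theorem exists_gen_single {i : ℕ} (hi : i + 1 < n) (a : HalfDiagram n) {I J : Fin n}
    (hI : I = ⟨i, by omega⟩) (hJ : J = ⟨i + 1, hi⟩)
    (h1 : a.partner I ≠ J) (h2 : ¬ (a.partner I = I ∧ a.partner J = J)) :
    ∃ b : HalfDiagram n, (∀ q, gen q i hi (Finsupp.single a 1) = Finsupp.single b 1) ∧
      b.partner I = J ∧
      (∀ u, u ≠ I → u ≠ J → a.partner u ≠ I → a.partner u ≠ J → b.partner u = a.partner u) ∧
      (∀ u v, u ≠ J → v ≠ I → u ≠ I → v ≠ J → a.partner u = I → a.partner v = J →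
        b.partner u = v) ∧
      (∀ u, u ≠ I → u ≠ J → a.partner u = I → a.partner J = J → b.partner u = u) ∧
      (∀ v, v ≠ I → v ≠ J → a.partner v = J → a.partner I = I → b.partner v = v) := by
  obtain ⟨b, hb⟩ := exists_isConcat (genDiagram i hi) a
  have hIJ : I ≠ J := by rw [hI, hJ]; simp [Fin.ext_iff]
  have hmain : ∀ (N : ℕ) (hN : n ≤ N),
      colour N (actBasis N (genDiagram i hi) a) (a.mergedCol hN I J) = 1 := by
    intro N hN
    rw [← gen_single, colour_gen, colour_single_one]
    subst hI hJ
    exact mergeOp_ind_mergedCol a hN hi h1 h2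
  have hj : ¬ concatJoinsThrough (genDiagram i hi) a := by
    intro hj
    have := hmain n le_rfl
    rw [actBasis_of_joins _ hj] at this
    simp at this
  have hloops : concatLoops (genDiagram i hi) a = 0 := by
    -- With at least two colours, a power of the number of colours is 1 only for exponent 0.
    have := hmain (n + 2) (by omega)
    rw [actBasis_of_isConcat _ hj hb, colour_single, ind] at this
    split_ifs at this
    · rw [mul_one] at this
      have h3 : ((((n + 2 : ℕ) : ℝ)) : ℂ) = ((n + 2 : ℕ) : ℂ) := by simp
      rw [h3, ← Nat.cast_pow, Nat.cast_eq_one] at this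
      rcases Nat.pow_eq_one.1 this with h | h
      · omega
      · exact h
    · simp at this
  have r1 : (concatGraph (genDiagram i hi) a).Reachable (leftPt I) (leftPt J) := by
    have := concatGraph_reachable_left (p := genDiagram i hi) (a := a) (leftPt ⟨i, by omega⟩)
    rwa [genDiagram_left, ← hI, ← hJ] at this
  have r2 : (concatGraph (genDiagram i hi) a).Reachable (rightPt I) (rightPt J) := by
    have := concatGraph_reachable_left (p := genDiagram i hi) (a := a) (rightPt ⟨i, by omega⟩)
    rwa [genDiagram_right, ← hI, ← hJ] at this
  have r3 : ∀ u, u ≠ I → u ≠ J →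
      (concatGraph (genDiagram i hi) a).Reachable (leftPt u) (rightPt u) := by
    intro u hu1 hu2
    have := concatGraph_reachable_left (p := genDiagram i hi) (a := a) (leftPt u)
    rwa [genDiagram_left_other hi (fun h => hu1 (by rw [hI]; exact Fin.ext h))
      (fun h => hu2 (by rw [hJ]; exact Fin.ext h))] at this
  have r4 : ∀ u, (concatGraph (genDiagram i hi) a).Reachable (rightPt u)
    (rightPt (a.partner u)) := fun u => concatGraph_reachable_right u
  refine ⟨b, fun q => ?_, (hb I J hIJ).2 r1, ?_, ?_, ?_, ?_⟩
  · rw [gen_single, actBasis_of_isConcat q hj hb, hloops, pow_zero]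
  · intro u hu1 hu2 hu3 hu4
    by_cases hu : a.partner u = u
    · rw [hu]
      exact (hb.through_iff u).2 ⟨u, hu, r3 u hu1 hu2⟩
    · exact (hb u _ (Ne.symm hu)).2 (((r3 u hu1 hu2).trans (r4 u)).trans (r3 _ hu3 hu4).symm)
  · intro u v hu2 hv1 hu1 hv2 hu hv
    have huv : u ≠ v := by
      rintro rfl
      exact hIJ (hu.symm.trans hv)
    refine (hb u v huv).2 ((r3 u hu1 hu2).trans (((r4 u).trans ?_).trans (r3 v hv1 hv2).symm))
    rw [hu]
    refine r2.trans ?_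
    rw [← hv]
    exact (r4 v).symm
  · intro u hu1 hu2 hu hJJ
    refine (hb.through_iff u).2 ⟨J, hJJ, (r3 u hu1 hu2).trans ((r4 u).trans ?_)⟩
    rw [hu]
    exact r2
  · intro v hv1 hv2 hv hII
    refine (hb.through_iff v).2 ⟨I, hII, (r3 v hv1 hv2).trans ((r4 v).trans ?_)⟩
    rw [hv]
    exact r2.symm

theorem closeSum_lt_of_move {a b : HalfDiagram n} {x y : Fin n} (hxy : x < y)
    (hax : a.Opens x) (hay : ¬ a.Opens y) (hbx : ¬ b.Opens x) (hby : b.Opens y)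
    (h : ∀ j, j ≠ x → j ≠ y → (b.Opens j ↔ a.Opens j)) : b.closeSum < a.closeSum := by
  unfold HalfDiagram.closeSum
  have hyx : y ∈ Finset.univ.erase x := by simp [hxy.ne']
  rw [← Finset.add_sum_erase _ _ (Finset.mem_univ x), ← Finset.add_sum_erase _ _ hyx,
    ← Finset.add_sum_erase (Finset.univ) (fun j : Fin n => if a.Opens j then 0 else j.val)
      (Finset.mem_univ x), ← Finset.add_sum_erase _ _ hyx,
    if_neg hbx, if_pos hby, if_pos hax, if_neg hay]
  have hs : ∑ j ∈ (Finset.univ.erase x).erase y, (if b.Opens j then 0 else j.val)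
      = ∑ j ∈ (Finset.univ.erase x).erase y, (if a.Opens j then 0 else j.val) := by
    apply Finset.sum_congr rfl
    intro j hj
    simp only [Finset.mem_erase, Finset.mem_univ, and_true] at hj
    simp only [h j hj.2 hj.1]
  rw [hs]
  rw [Fin.lt_def] at hxy
  omega

theorem gen_single_of_peak (q : ℝ) {i : ℕ} (hi : i + 1 < n) {a : HalfDiagram n}
    (h1 : a.up i) (h2 : ¬ a.up (i + 1)) :
    gen q i hi (Finsupp.single a 1) = (q : ℂ) • Finsupp.single a 1 :=
  gen_single_of_pair q hi (a.partner_of_peak hi h1 h2)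

/-- The partner of `i` lies to its left, and `i + 1` is a through-string or has its partner to its
right. Connecting these two strings leaves all brackets other than those at `i` and `i + 1` as they
were. -/
theorem gen_single_of_valley {i : ℕ} (hi : i + 1 < n) {a : HalfDiagram n}
    (h1 : ¬ a.up i) (h2 : a.up (i + 1)) :
    ∃ b, IsBoxAddition a i hi b ∧
      ∀ q, gen q i hi (Finsupp.single a 1) = Finsupp.single b 1 := by
  obtain ⟨I, hI⟩ : ∃ I : Fin n, I = ⟨i, by omega⟩ := ⟨_, rfl⟩
  obtain ⟨J, hJ⟩ : ∃ J : Fin n, J = ⟨i + 1, hi⟩ := ⟨_, rfl⟩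
  rw [a.up_of_lt (by omega), ← hI] at h1
  rw [a.up_of_lt hi, ← hJ] at h2
  have hIJ : I < J := by rw [hI, hJ, Fin.lt_def]; simp
  have hk := a.partner_lt h1
  have hl : J ≤ a.partner J := h2
  obtain ⟨b, hb, hb1, hb2, hb3, hb4, hb5⟩ := exists_gen_single hi a hI hJ
    (fun h => lt_asymm hIJ (h ▸ hk)) (fun h => hk.ne h.1)
  have hbJ : b.partner J = I := by rw [← hb1, b.partner_partner]
  refine ⟨b, ?_, hb⟩
  constructor
  · rwa [← hI]
  · rwa [← hJ]
  · rw [← hI]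
    change I ≤ b.partner I
    rw [hb1]
    exact hIJ.le
  · rw [← hJ]
    change ¬ J ≤ b.partner J
    rw [hbJ]
    exact hIJ.not_ge
  · intro u hu1 hu2
    have hu1 : u ≠ I := fun h => hu1 (by rw [h, hI])
    have hu2 : u ≠ J := fun h => hu2 (by rw [h, hJ])
    unfold HalfDiagram.Opens
    by_cases hu3 : a.partner u = I
    · have e : u = a.partner I := by rw [← hu3, a.partner_partner]
      have hao : u ≤ a.partner u := by rw [hu3, e]; exact hk.le
      refine iff_of_true ?_ hao
      by_cases hJJ : a.partner J = J
      · rw [hb4 u hu1 hu2 hu3 hJJ]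
      · rw [hb3 u (a.partner J) hu2 (fun h => (hIJ.trans_le hl).ne' h) hu1 hJJ hu3
          (a.partner_partner J)]
        rw [e]
        exact (hk.trans (hIJ.trans_le hl)).le
    by_cases hu4 : a.partner u = J
    · have e : u = a.partner J := by rw [← hu4, a.partner_partner]
      have hkI : a.partner I ≠ I := hk.ne
      have hao : ¬ u ≤ a.partner u := by
        rw [hu4, e]
        rw [e] at hu2
        exact (lt_of_le_of_ne hl (Ne.symm hu2)).not_ge
      refine iff_of_false ?_ hao
      have e2 : b.partner u = a.partner I := by
        rw [← hb3 (a.partner I) u (hk.trans hIJ).ne hu1 hkI hu2 (a.partner_partner I) hu4,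
          b.partner_partner]
      rw [e2, e]
      exact (hk.trans (hIJ.trans_le hl)).not_ge
    rw [hb2 u hu1 hu2 hu3 hu4]

/-- One closing bracket moves to the left. For two opening brackets it moves from the partner of `i
+ 1` to `i + 1`; for two closing ones, from `i` to the partner of `i`. -/
theorem gen_single_of_slope {i : ℕ} (hi : i + 1 < n) {a : HalfDiagram n}
    (h : a.up i ↔ a.up (i + 1)) :
    (∀ q, gen q i hi (Finsupp.single a 1) = 0) ∨ ∃ b : HalfDiagram n,
      b.closeSum < a.closeSum ∧ ∀ q, gen q i hi (Finsupp.single a 1) = Finsupp.single b 1 := by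
  obtain ⟨I, hI⟩ : ∃ I : Fin n, I = ⟨i, by omega⟩ := ⟨_, rfl⟩
  obtain ⟨J, hJ⟩ : ∃ J : Fin n, J = ⟨i + 1, hi⟩ := ⟨_, rfl⟩
  by_cases hthr : a.partner I = I ∧ a.partner J = J
  · rw [hI, hJ] at hthr
    exact Or.inl fun q => gen_single_of_through q hi hthr.1 hthr.2
  right
  rw [a.up_of_lt (by omega), a.up_of_lt hi, ← hI, ← hJ] at h
  have hIJ : I < J := by rw [hI, hJ, Fin.lt_def]; simp
  have hsucc : ∀ u : Fin n, I < u → u ≠ J → J < u := by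
    intro u hu hu'
    have := Fin.val_ne_of_ne hu'
    rw [Fin.lt_def] at *
    rw [hI] at hu
    rw [hJ] at this ⊢
    dsimp only at *
    omega
  have hnp : a.partner I ≠ J := by
    intro hp
    have hp' : a.partner J = I := by rw [← hp, a.partner_partner]
    unfold HalfDiagram.Opens at h
    rw [hp, hp'] at h
    exact hIJ.not_ge (h.1 hIJ.le)
  have hnp' : a.partner J ≠ I := fun h' => hnp (by rw [← h', a.partner_partner])
  obtain ⟨b, hb, hb1, hb2, hb3, hb4, hb5⟩ := exists_gen_single hi a hI hJ hnp hthr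
  have hbJ : b.partner J = I := by rw [← hb1, b.partner_partner]
  have hbIo : b.Opens I := by
    change I ≤ b.partner I
    rw [hb1]
    exact hIJ.le
  have hbJo : ¬ b.Opens J := by
    change ¬ J ≤ b.partner J
    rw [hbJ]
    exact hIJ.not_ge
  refine ⟨b, ?_, hb⟩
  by_cases ho : a.Opens I
  · have ho' : a.Opens J := h.1 ho
    have hJJ : a.partner J ≠ J := by
      intro hJJ
      have hII : a.partner I ≠ I := fun h' => hthr ⟨h', hJJ⟩
      have h3 : I < a.partner I := lt_of_le_of_ne ho (Ne.symm hII)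
      exact a.noncrossing_through _ _ _ hIJ (hsucc _ h3 hnp) rfl hJJ
    have hl : J < a.partner J := lt_of_le_of_ne ho' (Ne.symm hJJ)
    have hlI : a.partner J ≠ I := (hIJ.trans hl).ne'
    have hIc : a.partner I = I ∨ (a.partner J < a.partner I ∧ b.partner (a.partner I) =
        a.partner J) := by
      by_cases hII : a.partner I = I
      · exact Or.inl hII
      · right
        have h3 : I < a.partner I := lt_of_le_of_ne ho (Ne.symm hII)
        have h4 := hsucc _ h3 hnp
        refine ⟨?_, hb3 _ _ hnp hlI hII hJJ (a.partner_partner I) (a.partner_partner J)⟩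
        refine lt_of_le_of_ne (le_of_not_gt fun h5 => ?_) fun h5 => ?_
        · exact a.noncrossing _ _ _ _ hIJ h4 h5 rfl rfl
        · exact hIJ.ne' (a.partner_injective h5)
    refine closeSum_lt_of_move hl ho' ?_ hbJo ?_ ?_
    · unfold HalfDiagram.Opens
      rw [a.partner_partner]
      exact hl.not_ge
    · change a.partner J ≤ b.partner (a.partner J)
      rcases hIc with hII | ⟨h3, h4⟩
      · rw [hb5 _ hlI hJJ (a.partner_partner J) hII]
      · rw [← h4, b.partner_partner, h4]
        exact h3.le
    · intro u hu1 hu2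
      by_cases hu3 : u = I
      · rw [hu3]
        exact iff_of_true hbIo ho
      have hu4 : a.partner u ≠ J := fun h' => hu2 (by rw [← h', a.partner_partner])
      by_cases hu5 : a.partner u = I
      · have hu6 : u = a.partner I := by rw [← hu5, a.partner_partner]
        rcases hIc with hII | ⟨h3, h4⟩
        · rw [hII] at hu6
          exact absurd hu6 hu3
        · unfold HalfDiagram.Opens
          rw [hu6, h4, a.partner_partner]
          exact iff_of_false h3.not_ge (fun h' => hu3 (hu6.trans (le_antisymm h' ho)))
      unfold HalfDiagram.Opens
      rw [hb2 u hu3 hu1 hu5 hu4]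
  · have ho' : ¬ a.Opens J := fun h' => ho (h.2 h')
    have hk' := a.partner_lt ho
    have hk : a.partner J < I := by
      have := a.partner_lt ho'
      by_contra h3
      exact (hsucc _ (lt_of_le_of_ne (not_lt.1 h3) (Ne.symm hnp')) this.ne).not_gt this
    have hkk : a.partner J < a.partner I := by
      refine lt_of_le_of_ne (le_of_not_gt fun h5 => ?_) fun h5 => ?_
      · exact a.noncrossing _ _ _ _ h5 hk hIJ (a.partner_partner I) (a.partner_partner J)
      · exact hIJ.ne' (a.partner_injective h5)
    have hJJ : a.partner J ≠ J := (hk.trans hIJ).ne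
    have e : b.partner (a.partner I) = a.partner J :=
      hb3 _ _ hnp hk.ne hk'.ne hJJ (a.partner_partner I) (a.partner_partner J)
    refine closeSum_lt_of_move hk' (HalfDiagram.opens_partner ho) ho ?_ hbIo ?_
    · unfold HalfDiagram.Opens
      rw [e]
      exact hkk.not_ge
    · intro u hu1 hu2
      by_cases hu3 : u = J
      · rw [hu3]
        exact iff_of_false hbJo ho'
      have hu4 : a.partner u ≠ I := fun h' => hu1 (by rw [← h', a.partner_partner])
      by_cases hu5 : a.partner u = J
      · have hu6 : u = a.partner J := by rw [← hu5, a.partner_partner]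
        unfold HalfDiagram.Opens
        rw [hu5, hu6, ← e, b.partner_partner, e]
        exact iff_of_true hkk.le (hk.trans hIJ).le
      unfold HalfDiagram.Opens
      rw [hb2 u hu2 hu3 hu4 hu5]

end GenBasis


/-! ### The form is invariant under the generators -/

section FormInvariance

variable {n : ℕ}

theorem ind_genDiagram_symm {N i : ℕ} (hi : i + 1 < n) (x y : Fin n → Fin N) :
    ind (genDiagram i hi).1 (joinCol x y) = ind (genDiagram i hi).1 (joinCol y x) := by
  have key : ∀ x y : Fin n → Fin N, Compat (genDiagram i hi).1 (joinCol x y) →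
      Compat (genDiagram i hi).1 (joinCol y x) := by
    intro x y h
    rw [compat_genDiagram_iff] at h ⊢
    obtain ⟨hx, c, rfl⟩ := h
    refine ⟨by simp [recolour], x ⟨i, by omega⟩, ?_⟩
    funext j
    unfold recolour
    split_ifs with hj
    · rcases hj with hj | hj
      · rw [show j = ⟨i, by omega⟩ from Fin.ext hj]
      · rw [show j = ⟨i + 1, hi⟩ from Fin.ext hj, hx]
    · rfl
  unfold ind
  congr 1
  exact propext ⟨key x y, key y x⟩

/-- The kernel of a generator is symmetric in the left and right colourings. -/
theorem sum_mergeOp_mul {N i : ℕ} (hi : i + 1 < n) (F G : (Fin n → Fin N) → ℂ) :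
    ∑ x, mergeOp i hi F x * G x = ∑ x, F x * mergeOp i hi G x := by
  simp only [← sum_ind_genDiagram, Finset.sum_mul, Finset.mul_sum]
  rw [Finset.sum_comm]
  apply Finset.sum_congr rfl
  intro y _
  apply Finset.sum_congr rfl
  intro x _
  rw [ind_genDiagram_symm hi x y]
  ring

theorem form_eq_sum [Fintype (HalfDiagram n)] (q : ℝ) (x y : U n) :
    form q x y = ∑ a, ∑ b, x a * (starRingEnd ℂ) (y b) * formBasis q a b := by
  unfold form
  rw [Finsupp.sum_fintype _ _ (by simp)]
  apply Finset.sum_congr rfl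
  intro a _
  rw [Finsupp.sum_fintype _ _ (by simp)]

/-- The form as a linear functional of its first argument. -/
noncomputable def formLeft (q : ℝ) (y : U n) : U n →ₗ[ℂ] ℂ where
  toFun x := form q x y
  map_add' x x' := by
    have := Fintype.ofFinite (HalfDiagram n)
    simp only [form_eq_sum, Finsupp.add_apply, add_mul, Finset.sum_add_distrib]
  map_smul' c x := by
    have := Fintype.ofFinite (HalfDiagram n)
    simp only [form_eq_sum, Finsupp.smul_apply, smul_eq_mul, Finset.mul_sum, RingHom.id_apply,
      mul_assoc]

theorem formLeft_apply (q : ℝ) (x y : U n) : formLeft q y x = form q x y := rfl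

theorem form_add_right (q : ℝ) (x y y' : U n) :
    form q x (y + y') = form q x y + form q x y' := by
  have := Fintype.ofFinite (HalfDiagram n)
  simp only [form_eq_sum, Finsupp.add_apply, map_add, mul_add, add_mul, Finset.sum_add_distrib]

theorem form_smul_right (q : ℝ) (c : ℂ) (x y : U n) :
    form q x (c • y) = (starRingEnd ℂ) c * form q x y := by
  have := Fintype.ofFinite (HalfDiagram n)
  simp only [form_eq_sum, Finsupp.smul_apply, smul_eq_mul, map_mul, Finset.mul_sum]
  apply Finset.sum_congr rfl
  intro a _
  apply Finset.sum_congr rfl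
  intro b _
  ring

theorem form_zero_right (q : ℝ) (x : U n) : form q x 0 = 0 := by
  have := form_smul_right q 0 x 0
  rwa [zero_smul, map_zero, zero_mul] at this

theorem form_sub_right (q : ℝ) (x y y' : U n) :
    form q x (y - y') = form q x y - form q x y' := by
  have h : y - y' = y + (-1 : ℂ) • y' := by simp [sub_eq_add_neg]
  rw [h, form_add_right, form_smul_right]
  simp [sub_eq_add_neg]

theorem form_single_single (q : ℝ) (a b : HalfDiagram n) (c d : ℂ) :
    form q (Finsupp.single a c) (Finsupp.single b d) =
      c * (starRingEnd ℂ) d * formBasis q a b := by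
  unfold form
  rw [Finsupp.sum_single_index (by simp), Finsupp.sum_single_index (by simp)]

theorem IsPoly.conj {f : ℝ → ℂ} (hf : IsPoly f) : IsPoly fun q => (starRingEnd ℂ) (f q) := by
  obtain ⟨P, hP⟩ := hf
  refine ⟨P.map (starRingEnd ℂ), fun q => ?_⟩
  have := Polynomial.eval_map_apply (starRingEnd ℂ) (p := P) (q : ℂ)
  rw [Complex.conj_ofReal] at this
  simp only [this, hP]

theorem isPoly_formBasis (a b : HalfDiagram n) : IsPoly fun q => formBasis q a b := by
  unfold formBasis
  split_ifs
  · exact IsPoly.const 0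
  · exact IsPoly.id_pow _

theorem IsPolyVec.form {x y : ℝ → U n} (hx : IsPolyVec x) (hy : IsPolyVec y) :
    IsPoly fun q => TemperleyLieb.form q (x q) (y q) := by
  have := Fintype.ofFinite (HalfDiagram n)
  simp only [form_eq_sum]
  exact IsPoly.sum _ fun a _ => IsPoly.sum _ fun b _ =>
    ((hx a).mul (hy b).conj).mul (isPoly_formBasis a b)

/-- In the colour model the form is the standard bilinear pairing divided by a falling factorial,
which depends only on the number of through-strings. Generators keep this number, so both sides
carry the same factor; it is nonzero for `N ≥ n`. -/
theorem form_gen_single (q : ℝ) {i : ℕ} (hi : i + 1 < n) (a b : HalfDiagram n) :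
    form q (gen q i hi (Finsupp.single a 1)) (Finsupp.single b 1) =
      form q (Finsupp.single a 1) (gen q i hi (Finsupp.single b 1)) := by
  have ha := IsPolyVec.const (Finsupp.single a (1 : ℂ))
  have hb := IsPolyVec.const (Finsupp.single b (1 : ℂ))
  refine congrFun (IsPoly.ext
    (f := fun q => form q (gen q i hi (Finsupp.single a 1)) (Finsupp.single b 1))
    (g := fun q => form q (Finsupp.single a 1) (gen q i hi (Finsupp.single b 1)))
    ((ha.gen i hi).form hb) (ha.form (hb.gen i hi)) (N₀ := n) fun N hN => ?_) q
  have hD : (N.descFactorial a.through.card : ℂ) ≠ 0 := by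
    rw [Nat.cast_ne_zero, Nat.ne_zero_iff_zero_lt, Nat.descFactorial_pos]
    exact ((Finset.card_le_univ _).trans (by simp)).trans hN
  apply mul_left_cancel₀ hD
  have hadj := sum_mergeOp_mul hi (ind (N := N) a) (ind b)
  rw [← colour_single_one, ← colour_single_one, ← colour_gen, ← colour_gen] at hadj
  have e1 : (N.descFactorial a.through.card : ℂ) *
      form N (gen N i hi (Finsupp.single a 1)) (Finsupp.single b 1) =
      ∑ x, colour N (gen N i hi (Finsupp.single a 1)) x * colour N (Finsupp.single b 1) x := by
    rcases gen_single_monomial hi a with h | ⟨a', k, hcard, h⟩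
    · rw [h]
      simp [← formLeft_apply]
    · rw [h, form_single_single, map_one, mul_one, ← hcard, mul_left_comm,
        ← sum_ind_mul_ind hN, Finset.mul_sum]
      apply Finset.sum_congr rfl
      intro x _
      rw [colour_single, colour_single]
      ring
  have e2 : (N.descFactorial a.through.card : ℂ) *
      form N (Finsupp.single a 1) (gen N i hi (Finsupp.single b 1)) =
      ∑ x, colour N (Finsupp.single a 1) x * colour N (gen N i hi (Finsupp.single b 1)) x := by
    rcases gen_single_monomial hi b with h | ⟨b', k, -, h⟩
    · rw [h]
      simp [form_zero_right]
    · rw [h, form_single_single, map_pow, Complex.conj_ofReal, one_mul, mul_left_comm,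
        ← sum_ind_mul_ind hN, Finset.mul_sum]
      apply Finset.sum_congr rfl
      intro x _
      rw [colour_single, colour_single]
      ring
  rw [e1, e2, hadj]

theorem single_eq_smul {α : Type*} (a : α) (c : ℂ) :
    Finsupp.single a c = c • Finsupp.single a (1 : ℂ) := by
  rw [Finsupp.smul_single, smul_eq_mul, mul_one]

theorem form_gen (q : ℝ) {i : ℕ} (hi : i + 1 < n) (x y : U n) :
    form q (gen q i hi x) y = form q x (gen q i hi y) := by
  induction y using Finsupp.induction_linear with
  | zero => rw [map_zero, form_zero_right, form_zero_right]
  | add y y' hy hy' => rw [map_add, form_add_right, form_add_right, hy, hy']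
  | single b d =>
    rw [single_eq_smul b d, map_smul, form_smul_right, form_smul_right]
    congr 1
    rw [← formLeft_apply, ← formLeft_apply]
    induction x using Finsupp.induction_linear with
    | zero => simp
    | add x x' hx hx' => rw [map_add, map_add, map_add, hx, hx']
    | single a c =>
      rw [single_eq_smul a c, map_smul, map_smul, map_smul]
      congr 1
      exact form_gen_single q hi a b

end FormInvariance

/-! ### Full diagrams as half-diagrams, and the two multiplications by generators -/

section Full

variable {n : ℕ}

/-- The restriction of a linear combination of half-diagrams on `2 * n` points to the pairings. -/
noncomputable def toTL : U (2 * n) →ₗ[ℂ] TL n where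
  toFun w := Finsupp.subtypeDomain (fun d : HalfDiagram (2 * n) => ∀ x, d.partner x ≠ x) w
  map_add' _ _ := Finsupp.subtypeDomain_add
  map_smul' c w := by
    ext p
    rfl

theorem toTL_apply (w : U (2 * n)) (p : Pairing n) : toTL w p = w p.1 := rfl

theorem ePrime_eq (q : ℝ) (p : Pairing n) : ePrime q p = toTL (xiPrime q p.1) := rfl

/-- Linear combinations of pairings as linear combinations of half-diagrams. -/
noncomputable def inclTL : TL n →ₗ[ℂ] U (2 * n) :=
  Finsupp.lmapDomain ℂ ℂ fun p : Pairing n => p.1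

theorem inclTL_single (p : Pairing n) (c : ℂ) :
    inclTL (Finsupp.single p c) = Finsupp.single p.1 c := by
  simp [inclTL]

theorem toTL_single (p : Pairing n) (c : ℂ) :
    toTL (Finsupp.single p.1 c) = Finsupp.single p c := by
  classical
  ext r
  rw [toTL_apply, Finsupp.single_apply, Finsupp.single_apply]
  congr 1
  exact propext ⟨fun h => Subtype.ext h, fun h => congrArg Subtype.val h⟩

theorem toTL_single_of_not {d : HalfDiagram (2 * n)} (hd : ¬ ∀ x, d.partner x ≠ x) (c : ℂ) :
    toTL (Finsupp.single d c) = 0 := by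
  ext r
  rw [toTL_apply, Finsupp.single_eq_of_ne]
  · rfl
  · rintro rfl
    exact hd r.2

theorem pairing_iff_card {d : HalfDiagram (2 * n)} :
    (∀ x, d.partner x ≠ x) ↔ d.through.card = 0 := by
  rw [Finset.card_eq_zero, Finset.eq_empty_iff_forall_notMem]
  simp only [HalfDiagram.mem_through]

/-- Generators create no through-strings, so nothing is lost by the restriction to pairings. -/
theorem inclTL_toTL_gen (q : ℝ) {i : ℕ} (hi : i + 1 < 2 * n) (p : Pairing n) :
    inclTL (toTL (gen q i hi (Finsupp.single p.1 1))) = gen q i hi (Finsupp.single p.1 1) := by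
  rcases gen_single_monomial hi p.1 with h | ⟨b, k, hcard, h⟩
  · rw [h, map_zero, map_zero]
  · have hb : ∀ x, b.partner x ≠ x := by
      rw [pairing_iff_card, hcard, ← pairing_iff_card]
      exact p.2
    obtain ⟨r, rfl⟩ : ∃ r : Pairing n, b = r.1 := ⟨⟨b, hb⟩, rfl⟩
    rw [h, toTL_single, inclTL_single]

theorem toTL_gen_of_not (q : ℝ) {i : ℕ} (hi : i + 1 < 2 * n) {d : HalfDiagram (2 * n)}
    (hd : ¬ ∀ x, d.partner x ≠ x) : toTL (gen q i hi (Finsupp.single d 1)) = 0 := by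
  rcases gen_single_monomial hi d with h | ⟨b, k, hcard, h⟩
  · rw [h, map_zero]
  · rw [h, toTL_single_of_not]
    rw [pairing_iff_card, hcard, ← pairing_iff_card]
    exact hd

theorem colour_act {N : ℕ} (w : TL n) (z : U n) (x : Fin n → Fin N) :
    colour N (act N w z) x = ∑ y, colour N (inclTL w) (joinCol x y) * colour N z y := by
  induction w using Finsupp.induction_linear with
  | zero => simp
  | add w w' hw hw' =>
    rw [map_add, map_add, map_add, LinearMap.add_apply, map_add, Pi.add_apply, hw, hw',
      ← Finset.sum_add_distrib]
    apply Finset.sum_congr rfl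
    intro y _
    rw [Pi.add_apply, add_mul]
  | single p c =>
    rw [single_eq_smul p c, map_smul, map_smul, LinearMap.smul_apply, map_smul, map_smul,
      Pi.smul_apply, colour_act_single, Finset.smul_sum]
    apply Finset.sum_congr rfl
    intro y _
    rw [Pi.smul_apply, inclTL_single, colour_single_one, smul_eq_mul, smul_eq_mul, mul_assoc]

theorem joinCol_recolour_left {N i : ℕ} (hi : i + 1 < n) (x y : Fin n → Fin N) (c : Fin N) :
    recolour (joinCol x y) i c = joinCol (recolour x i c) y := by
  funext v
  unfold recolour joinCol
  dsimp only
  split_ifs <;> first | rfl | omega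

theorem joinCol_recolour_right {N i i' : ℕ} (hi : i + 1 < n) (h : i + i' + 2 = 2 * n)
    (x y : Fin n → Fin N) (c : Fin N) :
    recolour (joinCol x y) i' c = joinCol x (recolour y i c) := by
  funext v
  unfold recolour joinCol
  dsimp only
  have := v.isLt
  split_ifs <;> first | rfl | omega

theorem mergeOp_left {N i : ℕ} (hi : i + 1 < n) (hi' : i + 1 < 2 * n)
    (F : (Fin (2 * n) → Fin N) → ℂ) (x y : Fin n → Fin N) :
    mergeOp i hi' F (joinCol x y) = mergeOp i hi (fun x' => F (joinCol x' y)) x := by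
  unfold mergeOp
  have e1 : joinCol x y ⟨i, by omega⟩ = x ⟨i, by omega⟩ := joinCol_left x y ⟨i, by omega⟩
  have e2 : joinCol x y ⟨i + 1, by omega⟩ = x ⟨i + 1, by omega⟩ := joinCol_left x y ⟨i + 1, hi⟩
  simp only [joinCol_recolour_left hi, e1, e2]

/-- The right side is numbered backwards: its points with indices `i` and `i + 1` are the points `i'
+ 1` and `i'` of the full diagram, where `i' = 2 * n - 2 - i`. -/
theorem mergeOp_right {N i i' : ℕ} (hi : i + 1 < n) (hi' : i' + 1 < 2 * n)
    (h : i + i' + 2 = 2 * n) (F : (Fin (2 * n) → Fin N) → ℂ) (x y : Fin n → Fin N) :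
    mergeOp i' hi' F (joinCol x y) = mergeOp i hi (fun y' => F (joinCol x y')) y := by
  unfold mergeOp
  have e1 : joinCol x y ⟨i', by omega⟩ = y ⟨i + 1, by omega⟩ := by
    rw [← joinCol_right x y]
    congr 1
    apply Fin.ext
    simp only [rightPt]
    omega
  have e2 : joinCol x y ⟨i' + 1, by omega⟩ = y ⟨i, by omega⟩ := by
    rw [← joinCol_right x y]
    congr 1
    apply Fin.ext
    simp only [rightPt]
    omega
  simp only [joinCol_recolour_right hi h, e1, e2, eq_comm]

theorem isPolyVec_toTL {w : ℝ → U (2 * n)} (hw : IsPolyVec w) :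
    IsPolyVec fun q => toTL (w q) := fun p => hw p.1

theorem act_toTL_gen_left (q : ℝ) {i : ℕ} (hi : i + 1 < n) (hi' : i + 1 < 2 * n)
    (w : U (2 * n)) (z : U n) :
    act q (toTL (gen q i hi' w)) z = gen q i hi (act q (toTL w) z) := by
  induction w using Finsupp.induction_linear with
  | zero => simp
  | add w w' hw hw' => simp only [map_add, LinearMap.add_apply, hw, hw']
  | single d c =>
    rw [single_eq_smul d c]
    simp only [map_smul, LinearMap.smul_apply]
    congr 1
    by_cases hd : ∀ x, d.partner x ≠ x
    · obtain ⟨p, rfl⟩ : ∃ p : Pairing n, d = p.1 := ⟨⟨d, hd⟩, rfl⟩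
      rw [toTL_single]
      have hz := IsPolyVec.const z
      have hp := IsPolyVec.const (Finsupp.single p (1 : ℂ))
      have hp' := IsPolyVec.const (Finsupp.single p.1 (1 : ℂ))
      refine congrFun (IsPolyVec.ext
        (f := fun q => act q (toTL (gen q i hi' (Finsupp.single p.1 1))) z)
        (g := fun q => gen q i hi (act q (Finsupp.single p 1) z))
        ((isPolyVec_toTL (hp'.gen i hi')).act hz) ((hp.act hz).gen i hi)
        (N₀ := n) fun N hN => ?_) q
      apply colour_injective hN
      funext x
      rw [colour_act, inclTL_toTL_gen, colour_gen, colour_gen, colour_single_one]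
      simp only [mergeOp_left hi hi']
      simp only [mergeOp, colour_act_single]
      split_ifs
      · simp only [Finset.sum_mul]
        exact Finset.sum_comm
      · simp
    · rw [toTL_gen_of_not q hi' hd, toTL_single_of_not hd]
      simp

/-- A generator at right points is multiplication from the right. In the colour model it acts on the
summed variable of the kernel, from where symmetry moves it to `z`. -/
theorem act_toTL_gen_right (q : ℝ) {i i' : ℕ} (hi : i + 1 < n) (hi' : i' + 1 < 2 * n)
    (h : i + i' + 2 = 2 * n) (w : U (2 * n)) (z : U n) :
    act q (toTL (gen q i' hi' w)) z = act q (toTL w) (gen q i hi z) := by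
  induction w using Finsupp.induction_linear with
  | zero => simp
  | add w w' hw hw' => simp only [map_add, LinearMap.add_apply, hw, hw']
  | single d c =>
    rw [single_eq_smul d c]
    simp only [map_smul, LinearMap.smul_apply]
    congr 1
    by_cases hd : ∀ x, d.partner x ≠ x
    · obtain ⟨p, rfl⟩ : ∃ p : Pairing n, d = p.1 := ⟨⟨d, hd⟩, rfl⟩
      rw [toTL_single]
      have hz := IsPolyVec.const z
      have hp := IsPolyVec.const (Finsupp.single p (1 : ℂ))
      have hp' := IsPolyVec.const (Finsupp.single p.1 (1 : ℂ))
      refine congrFun (IsPolyVec.ext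
        (f := fun q => act q (toTL (gen q i' hi' (Finsupp.single p.1 1))) z)
        (g := fun q => act q (Finsupp.single p 1) (gen q i hi z))
        ((isPolyVec_toTL (hp'.gen i' hi')).act hz) (hp.act (hz.gen i hi))
        (N₀ := n) fun N hN => ?_) q
      apply colour_injective hN
      funext x
      rw [colour_act, inclTL_toTL_gen, colour_gen, colour_act_single, colour_gen,
        colour_single_one]
      simp only [mergeOp_right hi hi' h]
      exact sum_mergeOp_mul hi _ _
    · rw [toTL_gen_of_not q hi' hd, toTL_single_of_not hd]
      simp

theorem throughIso_self {m : HalfDiagram n} (h : m.through.card = m.through.card)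
    (s : m.through) : throughIso h s = s := by
  have : throughIso h = OrderIso.refl _ := Subsingleton.elim _ _
  rw [this]
  rfl

theorem throughIso_symm_self {m : HalfDiagram n} (h : m.through.card = m.through.card)
    (s : m.through) : (throughIso h).symm s = s := by
  rw [OrderIso.symm_apply_eq, throughIso_self]

theorem compat_tensor_self_iff {N : ℕ} {m : HalfDiagram n}
    (h : m.through.card = m.through.card) (x y : Fin n → Fin N) :
    Compat (tensor m m h).1 (joinCol x y) ∧ Compat m y ↔
      Compat m x ∧ (∀ i, y (m.partner i) = y i) ∧ ∀ s ∈ m.through, y s = x s := by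
  rw [compat_pairing_iff, forall_left_right]
  change ((∀ i, joinCol x y (tensorPartner m m h (leftPt i)) = joinCol x y (leftPt i)) ∧
    ∀ i, joinCol x y (tensorPartner m m h (rightPt i)) = joinCol x y (rightPt i)) ∧ _ ↔ _
  constructor
  · rintro ⟨⟨h1, -⟩, hy⟩
    have hthr : ∀ s ∈ m.through, y s = x s := by
      intro s hs
      have := h1 s
      rw [tensorPartner_leftPt_of_mem h hs, throughIso_self, joinCol_left, joinCol_right] at this
      exact this
    refine ⟨⟨fun i => ?_, fun s t hs ht hst => ?_⟩, hy.pair, hthr⟩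
    · by_cases hi : i ∈ m.through
      · rw [HalfDiagram.mem_through.1 hi]
      · have := h1 i
        rwa [tensorPartner_leftPt_of_notMem h hi, joinCol_left, joinCol_left] at this
    · apply hy.through s t hs ht
      rw [hthr s (HalfDiagram.mem_through.2 hs), hthr t (HalfDiagram.mem_through.2 ht), hst]
  · rintro ⟨hx, hy, hthr⟩
    refine ⟨⟨fun i => ?_, fun i => ?_⟩, hy, fun s t hs ht hst => ?_⟩
    · by_cases hi : i ∈ m.through
      · rw [tensorPartner_leftPt_of_mem h hi, throughIso_self, joinCol_left, joinCol_right]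
        exact hthr i hi
      · rw [tensorPartner_leftPt_of_notMem h hi, joinCol_left, joinCol_left, hx.pair]
    · by_cases hi : i ∈ m.through
      · rw [tensorPartner_rightPt_of_mem h hi, throughIso_symm_self, joinCol_left, joinCol_right]
        exact (hthr i hi).symm
      · rw [tensorPartner_rightPt_of_notMem h hi, joinCol_right, joinCol_right, hy]
    · apply hx.through s t hs ht
      rw [← hthr s (HalfDiagram.mem_through.2 hs), ← hthr t (HalfDiagram.mem_through.2 ht), hst]

theorem not_glueJoinsThrough_self (m : HalfDiagram n) : ¬ glueJoinsThrough m m := by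
  rintro ⟨s, t, hst, hr, h⟩
  have hs : m.partner s = s := by rcases h with h | h <;> exact h.1
  have : t = s := glueGraph_induction (P := fun t => t = s) (by rintro _ rfl; exact hs)
    (by rintro _ rfl; exact hs) hr rfl
  exact hst this.symm

/-- The colours of the through-strings on the right are those on the left and the pairs of `m` are
free, which is the count for `m` glued to itself. -/
theorem act_tensor_self (q : ℝ) {m : HalfDiagram n} (h : m.through.card = m.through.card) :
    act q (Finsupp.single (tensor m m h) 1) (Finsupp.single m 1) =
      form q (Finsupp.single m 1) (Finsupp.single m 1) • Finsupp.single m 1 := by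
  classical
  have hm := IsPolyVec.const (Finsupp.single m (1 : ℂ))
  have hp := IsPolyVec.const (Finsupp.single (tensor m m h) (1 : ℂ))
  refine congrFun (IsPolyVec.ext
    (f := fun q => act q (Finsupp.single (tensor m m h) 1) (Finsupp.single m 1))
    (g := fun q => form q (Finsupp.single m 1) (Finsupp.single m 1) • Finsupp.single m 1)
    (hp.act hm) (IsPolyVec.smul (hm.form hm) hm) (N₀ := n) fun N hN => ?_) q
  apply colour_injective hN
  funext x
  rw [colour_act_single, map_smul, Pi.smul_apply, colour_single_one, form_single_single, formBasis,
    if_neg (not_glueJoinsThrough_self m)]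
  have hsum : ∑ y : Fin n → Fin N, ind (tensor m m h).1 (joinCol x y) * ind m y =
      (Nat.card {y : Fin n → Fin N // Compat (tensor m m h).1 (joinCol x y) ∧ Compat m y} : ℂ) := by
    rw [Nat.card_eq_fintype_card, Fintype.card_subtype, Finset.card_filter, Nat.cast_sum]
    apply Finset.sum_congr rfl
    intro y _
    unfold ind
    by_cases h1 : Compat (tensor m m h).1 (joinCol x y) <;> by_cases h2 : Compat m y <;>
      simp [h1, h2]
  rw [hsum]
  simp only [compat_tensor_self_iff]
  by_cases hx : Compat m x
  · have hcard := card_colourings (glueGraph m m) (m.through : Set (Fin n)) x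
      ((glue_const_iff m m x).2 ⟨hx.pair, hx.pair⟩)
    simp only [glue_const_iff, and_self, Finset.mem_coe] at hcard
    simp only [hx, true_and, hcard]
    rw [ind, if_pos hx, glueLoops]
    have hset : {K : (glueGraph m m).ConnectedComponent | ∀ s ∈ m.through,
        (glueGraph m m).connectedComponentMk s ≠ K} =
        {K : (glueGraph m m).ConnectedComponent |
          ∀ s : Fin n, (m.partner s = s ∨ m.partner s = s) →
            (glueGraph m m).connectedComponentMk s ≠ K} := by
      simp only [HalfDiagram.mem_through, or_self]
    rw [hset]
    simp
  · simp [hx, ind]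

end Full


/-! ### Half-diagrams from bracket words -/

open Classical in
/-- The height of a bracket word after `k` steps. -/
noncomputable def wordHeight (w : ℕ → Prop) (k : ℕ) : ℤ :=
  ∑ j ∈ Finset.range k, if w j then 1 else -1

theorem wordHeight_zero (w : ℕ → Prop) : wordHeight w 0 = 0 := rfl

theorem wordHeight_succ_of {w : ℕ → Prop} {k : ℕ} (h : w k) :
    wordHeight w (k + 1) = wordHeight w k + 1 := by
  rw [wordHeight, Finset.sum_range_succ, if_pos h, wordHeight]

theorem wordHeight_succ_of_not {w : ℕ → Prop} {k : ℕ} (h : ¬ w k) :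
    wordHeight w (k + 1) = wordHeight w k - 1 := by
  rw [wordHeight, Finset.sum_range_succ, if_neg h, wordHeight]
  rfl

theorem HalfDiagram.wordHeight_up {n : ℕ} (a : HalfDiagram n) {k : ℕ} (hk : k ≤ n) :
    wordHeight a.up k = a.height k := by
  induction k with
  | zero => rw [wordHeight_zero, a.height_zero]
  | succ k ih =>
    by_cases h : a.up k
    · rw [wordHeight_succ_of h, a.height_succ_of_up h, ih (by omega)]
    · rw [wordHeight_succ_of_not h, a.height_succ_of_not_up (by omega) h, ih (by omega)]

/-- The word with the brackets at `i`, `i + 1` replaced by a closing and an opening one. -/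
def lowerPeak (w : ℕ → Prop) (i j : ℕ) : Prop := j ≠ i ∧ (j = i + 1 ∨ w j)

theorem wordHeight_lowerPeak {w : ℕ → Prop} {i : ℕ} (h1 : w i) (h2 : ¬ w (i + 1)) (k : ℕ) :
    wordHeight (lowerPeak w i) k = wordHeight w k - if k = i + 1 then 2 else 0 := by
  induction k with
  | zero => simp [wordHeight_zero]
  | succ k ih =>
    rcases eq_or_ne k i with rfl | hk
    · rw [wordHeight_succ_of_not (by simp [lowerPeak]), wordHeight_succ_of h1, ih]
      simp
      ring
    rcases eq_or_ne k (i + 1) with rfl | hk'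
    · rw [wordHeight_succ_of (by simp [lowerPeak]), wordHeight_succ_of_not h2, ih]
      simp
      ring
    · have : lowerPeak w i k ↔ w k := by simp [lowerPeak, hk, hk']
      rw [if_neg hk', sub_zero] at ih
      rw [if_neg (by omega), sub_zero]
      by_cases hw : w k
      · rw [wordHeight_succ_of hw, wordHeight_succ_of (this.2 hw), ih]
      · rw [wordHeight_succ_of_not hw, wordHeight_succ_of_not (fun h => hw (this.1 h)), ih]

theorem wordHeight_lowerPeak_nonneg {n : ℕ} {w : ℕ → Prop}
    (hw : ∀ k ≤ n, 0 ≤ wordHeight w k) {i : ℕ} (h1 : w i) (h2 : ¬ w (i + 1))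
    (h3 : 1 ≤ wordHeight w i) : ∀ k ≤ n, 0 ≤ wordHeight (lowerPeak w i) k := by
  intro k hk
  rw [wordHeight_lowerPeak h1 h2]
  split_ifs with h
  · subst h
    rw [wordHeight_succ_of h1]
    omega
  · rw [sub_zero]
    exact hw k hk

/-- Every closing bracket leads from height 1 to height 0. A second one directly after it would make
the height negative. -/
theorem closing_of_no_high_peak {n : ℕ} {w : ℕ → Prop} (hw : ∀ k ≤ n, 0 ≤ wordHeight w k)
    (hp : ∀ i, i + 1 < n → w i → ¬ w (i + 1) → wordHeight w i = 0) (x : ℕ) (hx : x < n)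
    (hwx : ¬ w x) : wordHeight w x = 1 ∧ 1 ≤ x ∧ w (x - 1) := by
  induction x with
  | zero =>
    have := hw 1 hx
    rw [wordHeight_succ_of_not hwx, wordHeight_zero] at this
    omega
  | succ x ih =>
    by_cases h : w x
    · have := hp x hx h hwx
      rw [wordHeight_succ_of h, this]
      exact ⟨by ring, by omega, h⟩
    · have h1 := (ih (by omega) h).1
      have h2 := hw (x + 2) (by omega)
      rw [wordHeight_succ_of_not hwx, wordHeight_succ_of_not h] at h2
      omega

-- Such a word consists of blocks `()` and unmatched opening brackets. All arcs join neighbours, so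
-- planarity is automatic.
open Classical in
theorem exists_halfDiagram_of_no_high_peak {n : ℕ} {w : ℕ → Prop}
    (hw : ∀ k ≤ n, 0 ≤ wordHeight w k)
    (hp : ∀ i, i + 1 < n → w i → ¬ w (i + 1) → wordHeight w i = 0) :
    ∃ a : HalfDiagram n, ∀ k < n, a.up k ↔ w k := by
  have hc := closing_of_no_high_peak hw hp
  let f : Fin n → Fin n := fun x => if ¬ w x.val then ⟨x.val - 1, by omega⟩ else
    if h : x.val + 1 < n ∧ ¬ w (x.val + 1) then ⟨x.val + 1, h.1⟩ else x
  have f1 : ∀ x : Fin n, ¬ w x.val → (f x).val = x.val - 1 := fun x hx => by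
    simp only [f, if_pos hx]
  have f2 : ∀ x : Fin n, w x.val → x.val + 1 < n → ¬ w (x.val + 1) → (f x).val = x.val + 1 :=
    fun x hx h h' => by simp only [f, if_neg (not_not.2 hx), dif_pos (And.intro h h')]
  have f3 : ∀ x : Fin n, w x.val → ¬ (x.val + 1 < n ∧ ¬ w (x.val + 1)) → f x = x :=
    fun x hx h => by simp only [f, if_neg (not_not.2 hx), dif_neg h]
  have fnear : ∀ x : Fin n, (f x).val ≤ x.val + 1 := by
    intro x
    by_cases hx : w x.val
    · by_cases h : x.val + 1 < n ∧ ¬ w (x.val + 1)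
      · rw [f2 x hx h.1 h.2]
      · rw [f3 x hx h]; omega
    · rw [f1 x hx]; omega
  refine ⟨⟨f, fun x => ?_, fun i j k l hik hkj hjl hij _ => ?_, fun i j k hik hkj hij _ => ?_⟩,
    fun k hk => ?_⟩
  · apply Fin.ext
    by_cases hx : w x.val
    · by_cases h : x.val + 1 < n ∧ ¬ w (x.val + 1)
      · have e := f2 x hx h.1 h.2
        rw [f1 _ (by rw [e]; exact h.2), e]
        omega
      · rw [f3 x hx h, f3 x hx h]
    · obtain ⟨-, h1, h2⟩ := hc x.val x.2 hx
      have e := f1 x hx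
      have e' : (f x).val + 1 = x.val := by omega
      rw [f2 _ (by rw [e]; exact h2) (by rw [e']; exact x.2) (by rw [e']; exact hx), e']
  · have := fnear i
    rw [hij] at this
    rw [Fin.lt_def] at hik hkj
    omega
  · have := fnear i
    rw [hij] at this
    rw [Fin.lt_def] at hik hkj
    omega
  · rw [HalfDiagram.up_of_lt _ hk]
    change k ≤ (f ⟨k, hk⟩).val ↔ w k
    by_cases hx : w k
    · refine iff_of_true ?_ hx
      by_cases h : k + 1 < n ∧ ¬ w (k + 1)
      · rw [f2 ⟨k, hk⟩ hx h.1 h.2]; simp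
      · rw [f3 ⟨k, hk⟩ hx h]
    · refine iff_of_false ?_ hx
      rw [f1 ⟨k, hk⟩ hx]
      have := (hc k hk hx).2.1
      dsimp only
      omega

theorem isBoxAddition_of_lowerPeak {n i : ℕ} (hi : i + 1 < n) {w : ℕ → Prop} (h1 : w i)
    (h2 : ¬ w (i + 1)) {b a : HalfDiagram n} (hb : ∀ k < n, b.up k ↔ lowerPeak w i k)
    (ha : ∀ k < n, a.up k ↔ w k) : IsBoxAddition b i hi a := by
  rw [isBoxAddition_iff]
  refine ⟨?_, ?_, ?_, ?_, fun j hj hj' => ?_⟩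
  · rw [hb i (by omega)]
    simp [lowerPeak]
  · rw [hb _ hi]
    simp [lowerPeak]
  · rwa [ha i (by omega)]
  · rwa [ha _ hi]
  · by_cases hjn : j < n
    · rw [hb j hjn, ha j hjn]
      simp [lowerPeak, hj, hj']
    · exact iff_of_false (fun h => hjn h.1) (fun h => hjn h.1)

/-- Induction on the area under the path: a peak with positive base height is lowered, and the
generator at the resulting valley restores the box. No matching of brackets has to be built by hand.
-/
theorem exists_halfDiagram {n : ℕ} (w : ℕ → Prop) (hw : ∀ k ≤ n, 0 ≤ wordHeight w k) :
    ∃ a : HalfDiagram n, ∀ k < n, a.up k ↔ w k := by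
  induction hs : ∑ k ∈ Finset.range (n + 1), (wordHeight w k).toNat using Nat.strong_induction_on
    generalizing w with
  | _ s ih =>
    subst hs
    by_cases hp : ∀ i, i + 1 < n → w i → ¬ w (i + 1) → wordHeight w i = 0
    · exact exists_halfDiagram_of_no_high_peak hw hp
    · push Not at hp
      obtain ⟨i, hi, h1, h2, h3⟩ := hp
      have h0 := hw i (by omega)
      have h3 : 1 ≤ wordHeight w i := by omega
      obtain ⟨b, hb⟩ := ih _ (by
        refine Finset.sum_lt_sum (fun k _ => ?_) ⟨i + 1, Finset.mem_range.2 (by omega), ?_⟩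
        · rw [wordHeight_lowerPeak h1 h2]
          split_ifs <;> omega
        · rw [wordHeight_lowerPeak h1 h2, if_pos rfl, wordHeight_succ_of h1]
          omega) (lowerPeak w i) (wordHeight_lowerPeak_nonneg hw h1 h2 h3) rfl
      obtain ⟨a, ha, -⟩ := gen_single_of_valley hi (a := b)
        (by rw [hb i (by omega)]; simp [lowerPeak]) (by rw [hb _ hi]; simp [lowerPeak])
      refine ⟨a, fun k hk => ?_⟩
      rw [isBoxAddition_iff] at ha
      by_cases hk1 : k = i
      · subst hk1; exact iff_of_true ha.2.2.1 h1
      by_cases hk2 : k = i + 1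
      · subst hk2; exact iff_of_false ha.2.2.2.1 h2
      rw [ha.2.2.2.2 k hk1 hk2, hb k hk]
      simp [lowerPeak, hk1, hk2]

theorem exists_box_removal {n i : ℕ} (hi : i + 1 < n) {a : HalfDiagram n} (h1 : a.up i)
    (h2 : ¬ a.up (i + 1)) (h3 : 1 ≤ a.height i) : ∃ b, IsBoxAddition b i hi a := by
  have hw : ∀ k ≤ n, 0 ≤ wordHeight a.up k := fun k hk => by
    rw [a.wordHeight_up hk]
    exact a.height_nonneg k
  rw [← a.wordHeight_up (by omega)] at h3
  obtain ⟨b, hb⟩ := exists_halfDiagram _ (wordHeight_lowerPeak_nonneg hw h1 h2 h3)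
  exact ⟨b, isBoxAddition_of_lowerPeak hi h1 h2 hb fun _ _ => Iff.rfl⟩

/-! ### Minimal half-diagrams -/

section Minimal

variable {n : ℕ} {m : HalfDiagram n}

theorem minimal_peak_height (hm : IsEmpty (BoxRemoval m)) {i : ℕ} (hi : i + 1 < n)
    (h1 : m.up i) (h2 : ¬ m.up (i + 1)) : m.height i = 0 := by
  by_contra h
  have := m.height_nonneg i
  obtain ⟨b, hb⟩ := exists_box_removal hi h1 h2 (by omega)
  exact hm.false ⟨b, i, hi, hb⟩

/-- A peak with positive base height could be lowered, so the minimal words are `()()…()((…(`. -/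
theorem minimal_closing (hm : IsEmpty (BoxRemoval m)) {x : ℕ} (hx : x < n) (h : ¬ m.up x) :
    m.height x = 1 ∧ 1 ≤ x ∧ m.up (x - 1) := by
  have := closing_of_no_high_peak (n := n) (w := m.up)
    (fun k hk => by rw [m.wordHeight_up hk]; exact m.height_nonneg k)
    (fun i hi h1 h2 => by
      rw [m.wordHeight_up (by omega)]
      exact minimal_peak_height hm hi h1 h2) x hx h
  rwa [m.wordHeight_up hx.le] at this

theorem minimal_through (hm : IsEmpty (BoxRemoval m)) {i : ℕ} (hi : i < n) (h1 : m.up i)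
    (h2 : i + 1 < n → m.up (i + 1)) : m.partner ⟨i, hi⟩ = ⟨i, hi⟩ := by
  by_contra hne
  have ho := (m.up_of_lt hi).1 h1
  have hlt : (⟨i, hi⟩ : Fin n) < m.partner ⟨i, hi⟩ := lt_of_le_of_ne ho (Ne.symm hne)
  set y := m.partner ⟨i, hi⟩ with hy
  have hyc : ¬ m.up y.val := by
    rw [m.up_val]
    unfold HalfDiagram.Opens
    rw [hy, m.partner_partner]
    exact hlt.not_ge
  obtain ⟨-, h3, h4⟩ := minimal_closing hm y.2 hyc
  have e : y.val - 1 + 1 = y.val := by omega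
  have h5 := m.partner_of_peak (i := y.val - 1) (by omega) h4 (by rwa [e])
  have h6 : (⟨y.val - 1 + 1, by omega⟩ : Fin n) = m.partner ⟨i, hi⟩ := Fin.ext e
  rw [h6] at h5
  have h7 := congrArg Fin.val (m.partner_injective h5)
  dsimp only at h7
  apply hyc
  rw [← e, h7]
  exact h2 (by omega)

theorem minimal_slope_through (hm : IsEmpty (BoxRemoval m)) {i : ℕ} (hi : i + 1 < n)
    (h1 : m.up i) (h2 : m.up (i + 1)) :
    m.partner ⟨i, by omega⟩ = ⟨i, by omega⟩ ∧ m.partner ⟨i + 1, hi⟩ = ⟨i + 1, hi⟩ := by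
  refine ⟨minimal_through hm _ h1 fun _ => h2, minimal_through hm _ h2 fun hi2 => ?_⟩
  by_contra h3
  have h4 := minimal_peak_height hm hi2 h2 h3
  rw [m.height_succ_of_up h1] at h4
  have := m.height_nonneg i
  omega

theorem gen_single_minimal_slope (q : ℝ) (hm : IsEmpty (BoxRemoval m)) {i : ℕ} (hi : i + 1 < n)
    (h : m.up i ↔ m.up (i + 1)) : gen q i hi (Finsupp.single m 1) = 0 := by
  by_cases h1 : m.up i
  · obtain ⟨h2, h3⟩ := minimal_slope_through hm hi h1 (h.1 h1)
    exact gen_single_of_through q hi h2 h3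
  · have h2 : ¬ m.up (i + 1) := fun h' => h1 (h.2 h')
    exact absurd (minimal_closing hm hi h2).2.2 h1

end Minimal

/-! ### The second basis -/

section XiPrime

variable {n : ℕ}

theorem xiPrime_of_minimal (q : ℝ) {a : HalfDiagram n} (h : IsEmpty (BoxRemoval a)) :
    xiPrime q a = Finsupp.single a 1 := by
  rw [xiPrime, dif_neg]
  exact not_nonempty_iff.2 h

/-- The vector does not depend on the chosen box: two different removable peaks are at least two
steps apart, so both boxes can be removed in either order, with unchanged coefficients and commuting
generators. -/
theorem xiPrime_of_box (q : ℝ) {a b : HalfDiagram n} {i : ℕ} {hi : i + 1 < n}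
    (h : IsBoxAddition b i hi a) :
    xiPrime q a = gen q i hi (xiPrime q b) -
      (chebMu q (b.height (i + 1) + 1) : ℂ) • xiPrime q b := by
  induction hs : a.closeSum using Nat.strong_induction_on generalizing a b i with
  | _ s ih =>
    subst hs
    have hne : Nonempty (BoxRemoval a) := ⟨⟨b, i, hi, h⟩⟩
    have hx : xiPrime q a = gen q hne.some.idx hne.some.idx_lt (xiPrime q hne.some.base) -
        (chebMu q (hne.some.base.height (hne.some.idx + 1) + 1) : ℂ) •
          xiPrime q hne.some.base := by
      rw [xiPrime, dif_pos hne]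
      rfl
    rw [hx]
    generalize hne.some = r
    obtain ⟨b', j, hj, h'⟩ := r
    dsimp only
    rcases eq_or_ne i j with rfl | hij
    · rw [h.base_unique h']
    have h1 := (isBoxAddition_iff hi).1 h
    have h2 := (isBoxAddition_iff hj).1 h'
    have hne1 : i ≠ j + 1 := by
      rintro rfl
      exact h2.2.2.2.1 h1.2.2.1
    have hne2 : j ≠ i + 1 := by
      rintro rfl
      exact h1.2.2.2.1 h2.2.2.1
    have hbj : b.up j := (h1.2.2.2.2 j hij.symm hne2).1 h2.2.2.1
    have hbj' : ¬ b.up (j + 1) := fun hb =>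
      h2.2.2.2.1 ((h1.2.2.2.2 (j + 1) (by omega) (by omega)).2 hb)
    have hht : 1 ≤ b.height j := by
      rw [← h.height hne2, h'.height_left]
      have := b'.height_nonneg (j + 1)
      omega
    -- `d` is `a` without both boxes; both orders of adding them back are compared over `d`.
    obtain ⟨d, hd⟩ := exists_box_removal hj hbj hbj' hht
    have h3 := (isBoxAddition_iff hj).1 hd
    have hd' : IsBoxAddition d i hi b' := by
      rw [isBoxAddition_iff]
      refine ⟨fun hdi => h1.1 ((h3.2.2.2.2 i hij hne1).2 hdi),
        (h3.2.2.2.2 (i + 1) (by omega) (by omega)).1 h1.2.1,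
        (h2.2.2.2.2 i hij hne1).1 h1.2.2.1,
        fun hb => h1.2.2.2.1 ((h2.2.2.2.2 (i + 1) (by omega) (by omega)).2 hb),
        fun k hk1 hk2 => ?_⟩
      by_cases hk3 : k = j
      · subst hk3
        exact iff_of_false h2.1 h3.1
      by_cases hk4 : k = j + 1
      · subst hk4
        exact iff_of_true h2.2.1 h3.2.1
      rw [← h2.2.2.2.2 k hk3 hk4, h1.2.2.2.2 k hk1 hk2, h3.2.2.2.2 k hk3 hk4]
    have e1 := ih _ h.closeSum_lt hd rfl
    have e2 := ih _ h'.closeSum_lt hd' rfl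
    rw [e1, e2, hd.height (k := i + 1) (by omega), hd'.height (k := j + 1) (by omega)]
    simp only [map_sub, map_smul]
    rw [gen_comm q hi hj (by omega)]
    module

theorem xiPrime_box_eq (q : ℝ) {a b : HalfDiagram n} {i : ℕ} {hi : i + 1 < n}
    (h : IsBoxAddition b i hi a) : gen q i hi (xiPrime q b) =
      xiPrime q a + (chebMu q (b.height (i + 1) + 1) : ℂ) • xiPrime q b := by
  rw [xiPrime_of_box q h]
  module

theorem gen_xiPrime_box (q : ℝ) {a b : HalfDiagram n} {i : ℕ} {hi : i + 1 < n}
    (h : IsBoxAddition b i hi a) : gen q i hi (xiPrime q a) =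
      ((q : ℂ) - chebMu q (b.height (i + 1) + 1)) •
        (xiPrime q a + (chebMu q (b.height (i + 1) + 1) : ℂ) • xiPrime q b) := by
  rw [← xiPrime_box_eq q h, xiPrime_of_box q h, map_sub, gen_gen, map_smul]
  module

/-- A half-diagram is minimal or a box addition. -/
theorem minimal_or_box (a : HalfDiagram n) :
    IsEmpty (BoxRemoval a) ∨ ∃ (b : HalfDiagram n) (i : ℕ) (hi : i + 1 < n),
      IsBoxAddition b i hi a := by
  rcases isEmpty_or_nonempty (BoxRemoval a) with h | ⟨⟨b, i, hi, h⟩⟩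
  · exact Or.inl h
  · exact Or.inr ⟨b, i, hi, h⟩

theorem closeSum_induction {P : HalfDiagram n → Prop}
    (h : ∀ a, (∀ b : HalfDiagram n, b.closeSum < a.closeSum → P b) → P a) (a : HalfDiagram n) :
    P a := by
  induction hs : a.closeSum using Nat.strong_induction_on generalizing a with
  | _ s ih =>
    subst hs
    exact h a fun b hb => ih _ hb b rfl

/-- A peak standing on height 0 carries no box, and removable peaks are not adjacent to it. So any
box is added by a generator that commutes with this one. -/
theorem gen_xiPrime_low_peak (q : ℝ) (a : HalfDiagram n) {i : ℕ} (hi : i + 1 < n) (h1 : a.up i)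
    (h2 : ¬ a.up (i + 1)) (h3 : a.height i = 0) :
    gen q i hi (xiPrime q a) = (q : ℂ) • xiPrime q a := by
  induction a using closeSum_induction with
  | h a ih =>
    rcases minimal_or_box a with h | ⟨b, j, hj, h⟩
    · rw [xiPrime_of_minimal q h, gen_single_of_peak q hi h1 h2]
    · have hb := (isBoxAddition_iff hj).1 h
      have hij : i ≠ j := by
        rintro rfl
        rw [h.height_left] at h3
        have := b.height_nonneg (i + 1)
        omega
      have hij1 : i ≠ j + 1 := by
        rintro rfl
        exact hb.2.2.2.1 h1
      have hij2 : j ≠ i + 1 := by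
        rintro rfl
        exact h2 hb.2.2.1
      have := ih b h.closeSum_lt ((hb.2.2.2.2 i hij hij1).1 h1)
        (fun h' => h2 ((hb.2.2.2.2 (i + 1) (by omega) (by omega)).2 h'))
        (by rw [← h.height hij1, h3])
      rw [xiPrime_of_box q h, map_sub, map_smul, gen_comm q hi hj (by omega), this, map_smul]
      module

/-- The Chebyshev values `Δ_1, …, Δ_{M-1}` do not vanish. -/
def Generic (q : ℝ) (M : ℕ) : Prop := ∀ k : ℕ, 1 ≤ k → k < M → chebDelta q k ≠ 0

theorem chebDelta_zero (q : ℝ) : chebDelta q 0 = 1 := by simp [chebDelta]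

theorem chebDelta_one (q : ℝ) : chebDelta q 1 = q := by simp [chebDelta]

theorem chebMu_one (q : ℝ) : chebMu q 1 = q⁻¹ := by
  simp [chebMu, chebDelta_zero, chebDelta_one]

/-- This is the recursion divided by Δ_h: q - μ_h = Δ_{h+1}/Δ_h. -/
theorem chebMu_mul {q : ℝ} {h : ℤ} (h0 : chebDelta q h ≠ 0) (h1 : chebDelta q (h + 1) ≠ 0) :
    chebMu q (h + 1) * (q - chebMu q h) = 1 := by
  have hrec : chebDelta q (h + 1) = q * chebDelta q h - chebDelta q (h - 1) := by
    have := Polynomial.Chebyshev.S_add_two ℝ (h - 1)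
    unfold chebDelta
    rw [show h + 1 = h - 1 + 2 by ring, this]
    simp
  unfold chebMu
  rw [show h + 1 - 1 = h by ring]
  field_simp
  linarith

/-- Induction over boxes. A box far from `i` commutes with the generator. If the box is at a
neighbour `j`, its removal leaves a peak at `i`, and the coefficient μ is exactly the one for which
the braid relation produces cancellation. -/
theorem gen_xiPrime_slope {q : ℝ} (hq : 0 < q) {M : ℕ} (hM : Generic q M) (a : HalfDiagram n)
    (ha : ∀ k, a.height k ≤ M) {i : ℕ} (hi : i + 1 < n) (h : a.up i ↔ a.up (i + 1)) :
    gen q i hi (xiPrime q a) = 0 := by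
  induction a using closeSum_induction generalizing i with
  | h a ih =>
    rcases minimal_or_box a with hm | ⟨b, j, hj, hb⟩
    · rw [xiPrime_of_minimal q hm, gen_single_minimal_slope q hm hi h]
    have h1 := (isBoxAddition_iff hj).1 hb
    have hbM : ∀ k, b.height k ≤ M := fun k => (hb.height_base_le k).trans (ha k)
    have hij : i ≠ j := by
      rintro rfl
      exact h1.2.2.2.1 (h.1 h1.2.2.1)
    by_cases hfar : i + 1 < j ∨ j + 1 < i
    · have := ih b hb.closeSum_lt hbM hi (by
        rw [← h1.2.2.2.2 i (by omega) (by omega),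
          ← h1.2.2.2.2 (i + 1) (by omega) (by omega)]
        exact h)
      rw [xiPrime_of_box q hb, map_sub, map_smul, gen_comm q hi hj hfar, this, map_zero,
        smul_zero, sub_zero]
    · -- the peak of `a` at `j` is next to `i`, and `b` has a peak at `i`
      have hbraid : ∀ z : U n, gen q i hi (gen q j hj (gen q i hi z)) = gen q i hi z := by
        intro z
        rcases (show j = i + 1 ∨ i = j + 1 by omega) with rfl | rfl
        · exact gen_braid_up q hi hj z
        · exact gen_braid_down q hj hi z
      have hbi : b.up i ∧ ¬ b.up (i + 1) ∧ b.height i = b.height (j + 1) := by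
        rcases (show j = i + 1 ∨ i = j + 1 by omega) with rfl | rfl
        · have hai : a.up i := h.2 h1.2.2.1
          have hbi : b.up i := (h1.2.2.2.2 i (by omega) (by omega)).1 hai
          refine ⟨hbi, h1.1, ?_⟩
          rw [b.height_succ_of_not_up (by omega) h1.1, b.height_succ_of_up hbi]
          ring
        · refine ⟨h1.2.1, fun hbi => ?_, rfl⟩
          exact h1.2.2.2.1 (h.2 ((h1.2.2.2.2 (j + 1 + 1) (by omega) (by omega)).2 hbi))
      obtain ⟨hb1, hb2, hb3⟩ := hbi
      -- With h the height of the valley at `j`, the box rises to h + 2, so Δ_h and Δ_{h+1} are in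
      -- the range covered by `hM` when h ≥ 1.
      have hMj : b.height (j + 1) + 2 ≤ M := by
        rw [← hb.height_mid]
        exact ha _
      have hnn := b.height_nonneg i
      rw [xiPrime_of_box q hb, map_sub, map_smul]
      rcases eq_or_lt_of_le hnn with h0 | h0
      · have hlow := gen_xiPrime_low_peak q b hi hb1 hb2 h0.symm
        have hz : xiPrime q b = (q : ℂ)⁻¹ • gen q i hi (xiPrime q b) := by
          rw [hlow, smul_smul, inv_mul_cancel₀ (by exact_mod_cast hq.ne'), one_smul]
        rw [← hb3, ← h0, zero_add, chebMu_one, hz]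
        simp only [map_smul, hbraid, gen_gen]
        push_cast
        have hqc : (q : ℂ) ≠ 0 := by exact_mod_cast hq.ne'
        rw [smul_smul, smul_smul, mul_assoc, inv_mul_cancel₀ hqc, mul_one, sub_self]
      -- `c` is `b` without its peak at `i`. It has a slope at `j`, so e_j ξ'_c = 0 by induction,
      -- and what remains is (1 - μ_{h+1}(q - μ_h)) e_i ξ'_c.
      · obtain ⟨c, hc⟩ := exists_box_removal hi hb1 hb2 (by omega)
        have h2 := (isBoxAddition_iff hi).1 hc
        have hcM : ∀ k, c.height k ≤ M := fun k => (hc.height_base_le k).trans (hbM k)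
        have hcj : gen q j hj (xiPrime q c) = 0 := by
          refine ih c (hc.closeSum_lt.trans hb.closeSum_lt) hcM hj ?_
          rcases (show j = i + 1 ∨ i = j + 1 by omega) with rfl | rfl
          · exact iff_of_true h2.2.1 ((h2.2.2.2.2 _ (by omega) (by omega)).1 h1.2.1)
          · exact iff_of_false (fun h' => h1.1 ((h2.2.2.2.2 _ (by omega) (by omega)).2 h')) h2.1
        have hch : c.height (i + 1) + 1 = b.height (j + 1) := by
          rw [← hb3, hc.height_left]
        obtain ⟨k, hk⟩ := Int.eq_ofNat_of_zero_le (b.height_nonneg (j + 1))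
        have hmul : chebMu q (b.height (j + 1) + 1) * (q - chebMu q (b.height (j + 1))) = 1 := by
          apply chebMu_mul
          · rw [hk]
            exact hM k (by omega) (by omega)
          · rw [hk]
            exact_mod_cast hM (k + 1) (by omega) (by omega)
        have hmul' : (chebMu q (b.height (j + 1) + 1) : ℂ) *
            ((q : ℂ) - chebMu q (b.height (j + 1))) = 1 := by exact_mod_cast hmul
        rw [xiPrime_of_box q hc, hch]
        simp only [map_sub, map_smul, hcj, smul_zero, sub_zero, hbraid, gen_gen]
        rw [← sub_smul, smul_smul, hmul', one_smul, sub_self]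

end XiPrime


/-! ### Triangularity and orthogonality of the second basis -/

section Orthogonality

variable {n : ℕ}

theorem IsBoxAddition.closeSum_eq {b a : HalfDiagram n} {i : ℕ} {hi : i + 1 < n}
    (h : IsBoxAddition b i hi a) : a.closeSum = b.closeSum + 1 := by
  unfold HalfDiagram.closeSum
  set x : Fin n := ⟨i, by omega⟩ with hx
  set y : Fin n := ⟨i + 1, hi⟩ with hy
  have hxy : y ∈ Finset.univ.erase x := by
    simp [hx, hy, Fin.ext_iff]
  rw [← Finset.add_sum_erase _ _ (Finset.mem_univ x), ← Finset.add_sum_erase _ _ hxy,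
    ← Finset.add_sum_erase (Finset.univ) (fun j : Fin n => if b.Opens j then 0 else j.val)
      (Finset.mem_univ x), ← Finset.add_sum_erase _ _ hxy,
    if_neg h.close_left, if_pos h.open_right, if_pos h.open_left, if_neg h.close_right]
  have hs : ∑ j ∈ (Finset.univ.erase x).erase y, (if a.Opens j then 0 else j.val)
      = ∑ j ∈ (Finset.univ.erase x).erase y, (if b.Opens j then 0 else j.val) := by
    apply Finset.sum_congr rfl
    intro j hj
    simp only [Finset.mem_erase, Finset.mem_univ, and_true, hx, hy, ne_eq, Fin.ext_iff] at hj
    simp only [h.other j hj.2 hj.1]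
  rw [hs]
  simp only [hx, hy]
  ring

/-- The combinations of half-diagrams whose closing brackets have index sum less than `s`. -/
noncomputable def lowerSpan (n s : ℕ) : Submodule ℂ (U n) :=
  Finsupp.supported ℂ ℂ {b : HalfDiagram n | b.closeSum < s}

theorem lowerSpan_eq (n s : ℕ) : lowerSpan n s =
    Submodule.span ℂ ((fun b => Finsupp.single b 1) '' {b : HalfDiagram n | b.closeSum < s}) :=
  Finsupp.supported_eq_span_single ℂ _

theorem single_mem_lowerSpan {b : HalfDiagram n} {s : ℕ} (h : b.closeSum < s) :
    (Finsupp.single b 1 : U n) ∈ lowerSpan n s :=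
  Finsupp.single_mem_supported ℂ _ h

theorem lowerSpan_mono {s t : ℕ} (h : s ≤ t) : lowerSpan n s ≤ lowerSpan n t :=
  Finsupp.supported_mono fun _ hb => lt_of_lt_of_le hb h

theorem gen_single_mem_lowerSpan (q : ℝ) {i : ℕ} (hi : i + 1 < n) (a : HalfDiagram n) {s : ℕ}
    (h : a.closeSum < s) : gen q i hi (Finsupp.single a 1) ∈ lowerSpan n (s + 1) := by
  by_cases hslope : a.up i ↔ a.up (i + 1)
  · rcases gen_single_of_slope hi hslope with h' | ⟨b, hb, h'⟩
    · rw [h']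
      exact Submodule.zero_mem _
    · rw [h']
      exact single_mem_lowerSpan (by omega)
  by_cases hup : a.up i
  · rw [gen_single_of_peak q hi hup fun h' => hslope (iff_of_true hup h')]
    exact Submodule.smul_mem _ _ (single_mem_lowerSpan (by omega))
  · have hup' : a.up (i + 1) := by
      by_contra h'
      exact hslope (iff_of_false hup h')
    obtain ⟨b, hb, h'⟩ := gen_single_of_valley hi hup hup'
    rw [h']
    exact single_mem_lowerSpan (by rw [hb.closeSum_eq]; omega)

theorem gen_mem_lowerSpan (q : ℝ) {i : ℕ} (hi : i + 1 < n) {s : ℕ} {z : U n}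
    (hz : z ∈ lowerSpan n s) : gen q i hi z ∈ lowerSpan n (s + 1) := by
  rw [lowerSpan_eq] at hz
  induction hz using Submodule.span_induction with
  | mem x hx =>
    obtain ⟨b, hb, rfl⟩ := hx
    exact gen_single_mem_lowerSpan q hi b hb
  | zero =>
    rw [map_zero]
    exact Submodule.zero_mem _
  | add x y _ _ hx hy =>
    rw [map_add]
    exact Submodule.add_mem _ hx hy
  | smul c x _ hx =>
    rw [map_smul]
    exact Submodule.smul_mem _ _ hx

/-- A box raises `closeSum` by exactly 1 and a generator raises it by at most 1, so the lower terms
stay lower. -/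
theorem xiPrime_sub_single_mem (q : ℝ) (a : HalfDiagram n) :
    xiPrime q a - Finsupp.single a 1 ∈ lowerSpan n a.closeSum := by
  induction a using closeSum_induction with
  | h a ih =>
    rcases minimal_or_box a with hm | ⟨b, i, hi, hb⟩
    · rw [xiPrime_of_minimal q hm, sub_self]
      exact Submodule.zero_mem _
    · have hz := ih b hb.closeSum_lt
      have hbw := (isBoxAddition_iff hi).1 hb
      obtain ⟨a', ha', hgen⟩ := gen_single_of_valley hi hbw.1 hbw.2.1
      rw [ha'.result_unique hb] at hgen
      have e : xiPrime q a - Finsupp.single a 1 =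
          gen q i hi (xiPrime q b - Finsupp.single b 1) -
          (chebMu q (b.height (i + 1) + 1) : ℂ) •
            ((xiPrime q b - Finsupp.single b 1) + Finsupp.single b 1) := by
        rw [xiPrime_of_box q hb, map_sub, hgen, sub_add_cancel]
        abel
      rw [e, hb.closeSum_eq]
      exact Submodule.sub_mem _ (gen_mem_lowerSpan q hi hz) (Submodule.smul_mem _ _
        (Submodule.add_mem _ (lowerSpan_mono (Nat.le_succ _) hz)
          (single_mem_lowerSpan (Nat.lt_succ_self _))))

theorem xiPrime_apply_self (q : ℝ) (a : HalfDiagram n) : xiPrime q a a = 1 := by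
  have h := xiPrime_sub_single_mem q a
  rw [lowerSpan, Finsupp.mem_supported'] at h
  have := h a (by simp)
  rw [Finsupp.sub_apply, Finsupp.single_eq_same, sub_eq_zero] at this
  exact this

theorem xiPrime_span (q : ℝ) (x : U n) :
    x ∈ Submodule.span ℂ (Set.range fun a : HalfDiagram n => xiPrime q a) := by
  have key : ∀ a : HalfDiagram n, (Finsupp.single a 1 : U n) ∈
      Submodule.span ℂ (Set.range fun a : HalfDiagram n => xiPrime q a) := by
    intro a
    induction a using closeSum_induction with
    | h a ih =>
      have h := xiPrime_sub_single_mem q a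
      rw [lowerSpan_eq] at h
      have h' := Submodule.span_le.2 (by
        rintro _ ⟨b, hb, rfl⟩
        exact ih b hb) h
      have e : (Finsupp.single a 1 : U n) =
          xiPrime q a - (xiPrime q a - Finsupp.single a 1) := by abel
      rw [e]
      exact Submodule.sub_mem _ (Submodule.subset_span ⟨a, rfl⟩) h'
  induction x using Finsupp.induction_linear with
  | zero => exact Submodule.zero_mem _
  | add x y hx hy => exact Submodule.add_mem _ hx hy
  | single a c =>
    rw [single_eq_smul]
    exact Submodule.smul_mem _ _ (key a)

/-- A linear map on which the generators act as on a minimal half-diagram vanishes at the other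
vectors of the second basis. -/
theorem map_xiPrime_eq_zero {V : Type*} [AddCommGroup V] [Module ℂ V] {q : ℝ} (hq : 0 < q)
    (hgen : Generic q n) {m : HalfDiagram n} (hm : IsEmpty (BoxRemoval m)) (L : U n →ₗ[ℂ] V)
    (h1 : ∀ i (hi : i + 1 < n), m.up i → ¬ m.up (i + 1) → ∀ x,
      L (gen q i hi x) = (q : ℂ) • L x)
    (h2 : ∀ i (hi : i + 1 < n), m.up i → m.up (i + 1) → ∀ x, L (gen q i hi x) = 0)
    (c : HalfDiagram n) (hc : c ≠ m) : L (xiPrime q c) = 0 := by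
  classical
  have hqc : (q : ℂ) ≠ 0 := by exact_mod_cast hq.ne'
  induction c using closeSum_induction with
  | h c ih =>
    have hex : ∃ j, j < n ∧ ¬ (c.up j ↔ m.up j) := by
      by_contra h
      push Not at h
      exact hc (HalfDiagram.ext_up h)
    obtain ⟨hjn, hj⟩ := Nat.find_spec hex
    have hagree : ∀ k < Nat.find hex, c.up k ↔ m.up k := by
      intro k hk
      have := Nat.find_min hex hk
      by_contra h
      exact this ⟨by omega, h⟩
    set j := Nat.find hex with hjdef
    have hheight : c.height j = m.height j := HalfDiagram.height_congr hagree
    by_cases hmj : m.up j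
    -- At the first difference `m` opens and `c` closes. Then `c` has a peak one step earlier, at
    -- `i`, where `m` rises twice, so `L` kills the image of e_i.
    · have hcj : ¬ c.up j := fun h => hj (iff_of_true h hmj)
      have hpos : 1 ≤ c.height j := by
        have := c.height_nonneg (j + 1)
        rw [c.height_succ_of_not_up hjn hcj] at this
        omega
      obtain ⟨i, hi⟩ : ∃ i, j = i + 1 := by
        rcases Nat.eq_zero_or_eq_succ_pred j with h | h
        · rw [h, c.height_zero] at hpos
          omega
        · exact ⟨_, h⟩
      rw [hi] at hmj hcj hpos hheight hjn
      have hmi : m.up i := by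
        by_contra h
        have h3 := (minimal_closing hm (by omega) h).1
        rw [hheight, m.height_succ_of_not_up (by omega) h, h3] at hpos
        omega
      have hci : c.up i := (hagree i (by omega)).2 hmi
      by_cases h0 : c.height i = 0
      · have := h2 i hjn hmi hmj (xiPrime q c)
        rw [gen_xiPrime_low_peak q c hjn hci hcj h0, map_smul] at this
        exact (smul_eq_zero.1 this).resolve_left hqc
      · have := c.height_nonneg i
        -- e_i ξ'_d = ξ'_c + μ ξ'_d is killed by `L`, and so is ξ'_d by induction; `d ≠ m` because
        -- `d` closes at `i`.
        obtain ⟨d, hd⟩ := exists_box_removal hjn hci hcj (by omega)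
        have hdw := (isBoxAddition_iff hjn).1 hd
        have h3 := h2 i hjn hmi hmj (xiPrime q d)
        rw [xiPrime_box_eq q hd, map_add, map_smul,
          ih d hd.closeSum_lt (fun h => hdw.1 (h ▸ hmi)), smul_zero, add_zero] at h3
        exact h3
    -- Here `m` has a peak at `i = j - 1` where `c` has a slope: `L` takes e_i to the factor `q`,
    -- while e_i ξ'_c = 0.
    · have hcj : c.up j := by
        by_contra h
        exact hj (iff_of_false h hmj)
      obtain ⟨-, h3, h4⟩ := minimal_closing hm hjn hmj
      obtain ⟨i, hi⟩ : ∃ i, j = i + 1 := ⟨j - 1, by omega⟩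
      rw [hi] at hmj hcj hjn h4
      rw [Nat.add_sub_cancel] at h4
      have := h1 i hjn h4 hmj (xiPrime q c)
      rw [gen_xiPrime_slope hq hgen c c.height_le hjn
        (iff_of_true ((hagree i (by omega)).2 h4) hcj), map_zero] at this
      exact (smul_eq_zero.1 this.symm).resolve_left hqc

/-! ### Orthogonality of the second basis. -/

theorem form_xiPrime_minimal {q : ℝ} (hq : 0 < q) (hgen : Generic q n) {m : HalfDiagram n}
    (hm : IsEmpty (BoxRemoval m)) {c : HalfDiagram n} (hc : c ≠ m) :
    form q (xiPrime q c) (Finsupp.single m 1) = 0 := by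
  rw [← formLeft_apply]
  refine map_xiPrime_eq_zero hq hgen hm (formLeft q (Finsupp.single m 1)) ?_ ?_ c hc
  · intro i hi h1 h2 x
    rw [formLeft_apply, form_gen, gen_single_of_peak q hi h1 h2, form_smul_right,
      Complex.conj_ofReal, formLeft_apply, smul_eq_mul]
  · intro i hi h1 h2 x
    rw [formLeft_apply, form_gen, gen_single_minimal_slope q hm hi (iff_of_true h1 h2),
      form_zero_right]

theorem form_xiPrime_box (q : ℝ) {b c : HalfDiagram n} {i : ℕ} {hi : i + 1 < n}
    (h : IsBoxAddition c i hi b) (x : U n) :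
    form q x (xiPrime q b) = form q (gen q i hi x) (xiPrime q c) -
      (chebMu q (c.height (i + 1) + 1) : ℂ) * form q x (xiPrime q c) := by
  rw [xiPrime_of_box q h, form_sub_right, form_smul_right, Complex.conj_ofReal, form_gen]

/-- With `b` a box over `c`, self-adjointness gives ⟨ξ'_a, ξ'_b⟩ = ⟨(e_i - μ) ξ'_a, ξ'_c⟩. The
vector e_i ξ'_a involves only ξ'_a and the vectors of `a` with a box added or removed at `i`, so
induction applies to every term that is not a multiple of ξ'_c. -/
theorem form_xiPrime_of_ne {q : ℝ} (hq : 0 < q) (hgen : Generic q n) {a b : HalfDiagram n}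
    (hab : a ≠ b) : form q (xiPrime q a) (xiPrime q b) = 0 := by
  induction b using closeSum_induction generalizing a with
  | h b ih =>
    rcases minimal_or_box b with hm | ⟨c, i, hi, hb⟩
    · rw [xiPrime_of_minimal q hm]
      exact form_xiPrime_minimal hq hgen hm hab
    have ih' : ∀ {d : HalfDiagram n}, d ≠ c → form q (xiPrime q d) (xiPrime q c) = 0 :=
      fun hd => ih c hb.closeSum_lt hd
    have hbw := (isBoxAddition_iff hi).1 hb
    rw [form_xiPrime_box q hb]
    by_cases hslope : a.up i ↔ a.up (i + 1)
    · have hac : a ≠ c := by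
        rintro rfl
        exact hbw.1 (hslope.2 hbw.2.1)
      rw [gen_xiPrime_slope hq hgen a a.height_le hi hslope, ih' hac, ← formLeft_apply]
      simp
    by_cases hup : a.up i
    · have hup' : ¬ a.up (i + 1) := fun h => hslope (iff_of_true hup h)
      have hac : a ≠ c := by
        rintro rfl
        exact hbw.1 hup
      rw [ih' hac, mul_zero, sub_zero, ← formLeft_apply]
      by_cases h0 : a.height i = 0
      · rw [gen_xiPrime_low_peak q a hi hup hup' h0, map_smul, formLeft_apply, ih' hac, smul_zero]
      · have := a.height_nonneg i
        obtain ⟨d, hd⟩ := exists_box_removal hi hup hup' (by omega)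
        have hdc : d ≠ c := by
          rintro rfl
          exact hab (hd.result_unique hb)
        rw [gen_xiPrime_box q hd, map_smul, map_add, map_smul, formLeft_apply, formLeft_apply,
          ih' hac, ih' hdc]
        simp
    · have hup' : a.up (i + 1) := by
        by_contra h'
        exact hslope (iff_of_false hup h')
      obtain ⟨a', ha', -⟩ := gen_single_of_valley hi hup hup'
      have ha'w := (isBoxAddition_iff hi).1 ha'
      have ha'c : a' ≠ c := by
        rintro rfl
        exact hbw.1 ha'w.2.2.1
      rw [xiPrime_box_eq q ha', ← formLeft_apply, map_add, map_smul, formLeft_apply,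
        formLeft_apply, ih' ha'c]
      -- For `a = c` the box coefficient in e_i ξ'_c is the same μ as in ξ'_b, and the two terms
      -- with ⟨ξ'_c, ξ'_c⟩ cancel.
      by_cases hac : a = c
      · subst hac
        simp
      · rw [ih' hac]
        simp

end Orthogonality

/-! ### The diagrams `a ⊗ b` -/

section Tensor

variable {n : ℕ} {a b : HalfDiagram n}

theorem tensor_up_left (h : a.through.card = b.through.card) {k : ℕ} (hk : k < n) :
    (tensor a b h).1.up k ↔ a.up k := by
  rw [(tensor a b h).1.up_of_lt (show k < 2 * n by omega), a.up_of_lt hk]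
  change leftPt ⟨k, hk⟩ ≤ tensorPartner a b h (leftPt ⟨k, hk⟩) ↔ _
  by_cases hi : (⟨k, hk⟩ : Fin n) ∈ a.through
  · rw [tensorPartner_leftPt_of_mem h hi]
    exact iff_of_true leftPt_lt_rightPt.le (HalfDiagram.mem_through.1 hi).ge
  · rw [tensorPartner_leftPt_of_notMem h hi]
    exact Iff.rfl

/-- The right side is read backwards, which exchanges opening and closing. A through-string of `b`,
opening in `b`, ends on the right and so closes. -/
theorem tensor_up_right (h : a.through.card = b.through.card) {k j : ℕ} (hk : k < n)
    (hj : j + k + 1 = 2 * n) : (tensor a b h).1.up j ↔ ¬ b.up k := by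
  rw [(tensor a b h).1.up_of_lt (show j < 2 * n by omega), b.up_of_lt hk]
  have e : (⟨j, by omega⟩ : Fin (2 * n)) = rightPt ⟨k, hk⟩ := by
    apply Fin.ext
    simp only [rightPt]
    omega
  rw [e]
  change rightPt ⟨k, hk⟩ ≤ tensorPartner a b h (rightPt ⟨k, hk⟩) ↔ _
  by_cases hi : (⟨k, hk⟩ : Fin n) ∈ b.through
  · rw [tensorPartner_rightPt_of_mem h hi]
    exact iff_of_false leftPt_lt_rightPt.not_ge
      (not_not.2 (HalfDiagram.mem_through.1 hi).ge)
  · rw [tensorPartner_rightPt_of_notMem h hi, ← not_lt, rightPt_lt_rightPt]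
    have hne : b.partner ⟨k, hk⟩ ≠ ⟨k, hk⟩ := fun h' => hi (HalfDiagram.mem_through.2 h')
    exact not_congr ⟨le_of_lt, fun h' => lt_of_le_of_ne h' hne.symm⟩

theorem wordHeight_congr {w w' : ℕ → Prop} {k : ℕ} (h : ∀ j < k, w j ↔ w' j) :
    wordHeight w k = wordHeight w' k := by
  unfold wordHeight
  apply Finset.sum_congr rfl
  intro j hj
  have e := h j (Finset.mem_range.1 hj)
  by_cases hw : w j
  · rw [if_pos hw, if_pos (e.1 hw)]
  · rw [if_neg hw, if_neg fun h' => hw (e.2 h')]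

theorem tensor_height_left (h : a.through.card = b.through.card) {k : ℕ} (hk : k ≤ n) :
    (tensor a b h).1.height k = a.height k := by
  rw [← HalfDiagram.wordHeight_up _ (show k ≤ 2 * n by omega), ← a.wordHeight_up hk]
  exact wordHeight_congr fun j hj => tensor_up_left h (by omega)

theorem Pairing.height_total (p : Pairing n) : p.1.height (2 * n) = 0 := by
  rw [p.1.height_total, pairing_iff_card.1 p.2]
  rfl

theorem Pairing.height_right (p : Pairing n) {k : ℕ} (hk : k ≤ n)
    (h : ∀ j < k, p.1.up (2 * n - 1 - j) ↔ ¬ b.up j) : p.1.height (2 * n - k) = b.height k := by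
  induction k with
  | zero => rw [Nat.sub_zero, p.height_total, b.height_zero]
  | succ k ih =>
    have h1 := ih (by omega) fun j hj => h j (by omega)
    have h2 := h k (by omega)
    have e : 2 * n - k = 2 * n - (k + 1) + 1 := by omega
    have e' : 2 * n - 1 - k = 2 * n - (k + 1) := by omega
    rw [e] at h1
    rw [e'] at h2
    by_cases hb : b.up k
    · rw [p.1.height_succ_of_not_up (by omega) (fun h' => h2.1 h' hb)] at h1
      rw [b.height_succ_of_up hb]
      omega
    · rw [p.1.height_succ_of_up (h2.2 hb)] at h1
      rw [b.height_succ_of_not_up (by omega) hb]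
      omega

theorem tensor_height_right (h : a.through.card = b.through.card) {k : ℕ} (hk : k ≤ n) :
    (tensor a b h).1.height (2 * n - k) = b.height k :=
  (tensor a b h).height_right hk fun _ hj => tensor_up_right h (by omega) (by omega)

/-- The path starts and ends at 0 and has 2n steps. This is why Δ_1, …, Δ_{n-1} suffice also for the
second basis of TL_n, although it lives on 2n points. -/
theorem Pairing.height_le (p : Pairing n) (k : ℕ) : p.1.height k ≤ n := by
  rcases le_total k n with h | h
  · have := p.1.height_le_self k
    omega
  rcases le_total k (2 * n) with h' | h'
  · have := p.1.height_le_add k (2 * n - k) (by omega)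
    rw [show k + (2 * n - k) = 2 * n by omega, p.height_total] at this
    omega
  · rw [p.1.height_le_of_le h', p.height_total]
    omega

theorem tensor_box_left {a₁ : HalfDiagram n} {i : ℕ} {hi : i + 1 < n}
    (hbox : IsBoxAddition a₁ i hi a) (h : a.through.card = b.through.card)
    (h₁ : a₁.through.card = b.through.card) :
    IsBoxAddition (tensor a₁ b h₁).1 i (by omega) (tensor a b h).1 := by
  rw [isBoxAddition_iff] at hbox ⊢
  rw [tensor_up_left h₁ (by omega), tensor_up_left h₁ hi, tensor_up_left h (by omega),
    tensor_up_left h hi]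
  refine ⟨hbox.1, hbox.2.1, hbox.2.2.1, hbox.2.2.2.1, fun j hj hj' => ?_⟩
  by_cases hjn : j < n
  · rw [tensor_up_left h hjn, tensor_up_left h₁ hjn, hbox.2.2.2.2 j hj hj']
  by_cases hjn' : j < 2 * n
  · rw [tensor_up_right h (k := 2 * n - 1 - j) (by omega) (by omega),
      tensor_up_right h₁ (k := 2 * n - 1 - j) (by omega) (by omega)]
  · exact iff_of_false (fun h' => hjn' h'.1) (fun h' => hjn' h'.1)

/-- Reversal together with exchange of brackets maps a valley to a valley and a peak to a peak. -/
theorem tensor_box_right {b₁ : HalfDiagram n} {i i' : ℕ} {hi : i + 1 < n}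
    (hbox : IsBoxAddition b₁ i hi b) (h : a.through.card = b.through.card)
    (h₁ : a.through.card = b₁.through.card) (hi' : i' + 1 < 2 * n) (hii : i + i' + 2 = 2 * n) :
    IsBoxAddition (tensor a b₁ h₁).1 i' hi' (tensor a b h).1 := by
  rw [isBoxAddition_iff] at hbox ⊢
  rw [tensor_up_right h₁ (k := i + 1) hi (by omega),
    tensor_up_right h₁ (k := i) (by omega) (by omega),
    tensor_up_right h (k := i + 1) hi (by omega),
    tensor_up_right h (k := i) (by omega) (by omega)]
  refine ⟨not_not.2 hbox.2.1, hbox.1, hbox.2.2.2.1, not_not.2 hbox.2.2.1, fun j hj hj' => ?_⟩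
  by_cases hjn : j < n
  · rw [tensor_up_left h hjn, tensor_up_left h₁ hjn]
  by_cases hjn' : j < 2 * n
  · rw [tensor_up_right h (k := 2 * n - 1 - j) (by omega) (by omega),
      tensor_up_right h₁ (k := 2 * n - 1 - j) (by omega) (by omega),
      hbox.2.2.2.2 (2 * n - 1 - j) (by omega) (by omega)]
  · exact iff_of_false (fun h' => hjn' h'.1) (fun h' => hjn' h'.1)

/-! ### Minimal half-diagrams with equally many through-strings -/

theorem minimal_up_of_slope {m : HalfDiagram n} (hm : IsEmpty (BoxRemoval m)) {i : ℕ}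
    (h1 : m.up i) (h2 : m.up (i + 1)) {k : ℕ} (hik : i + k + 1 < n) :
    m.up (i + k) ∧ m.up (i + k + 1) := by
  induction k with
  | zero => exact ⟨h1, h2⟩
  | succ k ih =>
    obtain ⟨h3, h4⟩ := ih (by omega)
    refine ⟨h4, ?_⟩
    by_contra h5
    have h6 := minimal_peak_height hm (i := i + k + 1) (by omega) h4 h5
    rw [m.height_succ_of_up h3] at h6
    have := m.height_nonneg (i + k)
    omega

theorem HalfDiagram.height_add_le (m : HalfDiagram n) (k j : ℕ) :
    m.height (k + j) ≤ m.height k + j := by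
  induction j with
  | zero => simp
  | succ j ih =>
    by_cases hk : k + j < n
    · by_cases h : m.up (k + j)
      · rw [← add_assoc, m.height_succ_of_up h]; push_cast; omega
      · rw [← add_assoc, m.height_succ_of_not_up hk h]; push_cast; omega
    · rw [m.height_le_of_le (show n ≤ k + (j + 1) by omega)]
      rw [m.height_le_of_le (show n ≤ k + j by omega)] at ih
      push_cast; omega

theorem HalfDiagram.height_eq_of_up (m : HalfDiagram n) {k j : ℕ}
    (h : ∀ l < j, m.up (k + l)) : m.height (k + j) = m.height k + j := by
  induction j with
  | zero => simp
  | succ j ih =>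
    rw [← add_assoc, m.height_succ_of_up (h j (by omega)), ih fun l hl => h l (by omega)]
    push_cast
    ring

/-- At the first difference `m` opens for the second time in a row. From there on it can only open,
so it ends strictly higher. -/
theorem minimal_height_lt {m m' : HalfDiagram n} (hm : IsEmpty (BoxRemoval m))
    (hm' : IsEmpty (BoxRemoval m')) {j : ℕ} (hj : j < n) (hagree : ∀ k < j, m.up k ↔ m'.up k)
    (h1 : m.up j) (h2 : ¬ m'.up j) : m'.height n < m.height n := by
  obtain ⟨-, h3, h4⟩ := minimal_closing hm' hj h2
  obtain ⟨i, rfl⟩ : ∃ i, j = i + 1 := ⟨j - 1, by omega⟩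
  rw [Nat.add_sub_cancel] at h4
  have h5 := (hagree i (by omega)).2 h4
  have h6 : ∀ l < n - (i + 1), m.up (i + 1 + l) := by
    intro l hl
    have := (minimal_up_of_slope hm h5 h1 (k := l) (by omega)).2
    rwa [show i + 1 + l = i + l + 1 by ring]
  have h7 := m.height_eq_of_up h6
  rw [show i + 1 + (n - (i + 1)) = n by omega, HalfDiagram.height_congr hagree] at h7
  have h8 := m'.height_add_le (i + 1 + 1) (n - (i + 1 + 1))
  rw [show i + 1 + 1 + (n - (i + 1 + 1)) = n by omega, m'.height_succ_of_not_up hj h2] at h8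
  omega

theorem minimal_unique {m m' : HalfDiagram n} (hm : IsEmpty (BoxRemoval m))
    (hm' : IsEmpty (BoxRemoval m')) (h : m.through.card = m'.through.card) : m = m' := by
  classical
  by_contra hne
  have hex : ∃ j, j < n ∧ ¬ (m.up j ↔ m'.up j) := by
    by_contra h
    push Not at h
    exact hne (HalfDiagram.ext_up h)
  obtain ⟨hjn, hj⟩ := Nat.find_spec hex
  have hagree : ∀ k < Nat.find hex, m.up k ↔ m'.up k := by
    intro k hk
    have := Nat.find_min hex hk
    by_contra h
    exact this ⟨by omega, h⟩
  have hh : m.height n = m'.height n := by rw [m.height_total, m'.height_total, h]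
  by_cases h1 : m.up (Nat.find hex)
  · have h2 : ¬ m'.up (Nat.find hex) := fun h2 => hj (iff_of_true h1 h2)
    have := minimal_height_lt hm hm' hjn hagree h1 h2
    omega
  · have h2 : m'.up (Nat.find hex) := by
      by_contra h2
      exact hj (iff_of_false h1 h2)
    have := minimal_height_lt hm' hm hjn (fun k hk => (hagree k hk).symm) h2 h1
    omega

/-! ### The action of the second basis -/

/-- The image of e_i is spanned by half-diagrams that pair `i` with `i + 1`. -/
theorem gen_apply_eq_zero (q : ℝ) {i : ℕ} (hi : i + 1 < n) (z : U n) {d : HalfDiagram n}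
    (hd : d.partner ⟨i, by omega⟩ ≠ ⟨i + 1, hi⟩) : gen q i hi z d = 0 := by
  induction z using Finsupp.induction_linear with
  | zero => simp
  | add x y hx hy => rw [map_add, Finsupp.add_apply, hx, hy, add_zero]
  | single a c =>
    rw [single_eq_smul, map_smul, Finsupp.smul_apply, gen_single]
    by_cases hj : concatJoinsThrough (genDiagram i hi) a
    · rw [actBasis_of_joins q hj]
      simp
    · obtain ⟨b, hb⟩ := exists_isConcat (genDiagram i hi) a
      rw [actBasis_of_isConcat q hj hb, Finsupp.single_eq_of_ne, smul_zero]
      rintro rfl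
      apply hd
      refine (hb _ _ (by simp [Fin.ext_iff])).2 ?_
      have := concatGraph_reachable_left (p := genDiagram i hi) (a := a) (leftPt ⟨i, by omega⟩)
      rwa [genDiagram_left] at this

theorem peak_of_gen_eq {q : ℝ} (hq : 0 < q) {i : ℕ} (hi : i + 1 < n) {z : U n}
    (hz : gen q i hi z = (q : ℂ) • z) {d : HalfDiagram n} (hd : z d ≠ 0) :
    d.up i ∧ ¬ d.up (i + 1) := by
  apply d.up_of_partner hi
  by_contra h
  have := gen_apply_eq_zero q hi z h
  rw [hz, Finsupp.smul_apply, smul_eq_zero] at this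
  rcases this with h' | h'
  · exact hq.ne' (by exact_mod_cast h')
  · exact hd h'

theorem gen_xiPrime_tensor_left (q : ℝ) {m : HalfDiagram n} (hm : IsEmpty (BoxRemoval m))
    (h : m.through.card = m.through.card) {i : ℕ} (hi : i + 1 < n) (h1 : m.up i)
    (h2 : ¬ m.up (i + 1)) :
    gen q i (by omega) (xiPrime q (tensor m m h).1) = (q : ℂ) • xiPrime q (tensor m m h).1 := by
  refine gen_xiPrime_low_peak q _ _ ((tensor_up_left h (by omega)).2 h1)
    (fun h' => h2 ((tensor_up_left h hi).1 h')) ?_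
  rw [tensor_height_left h (by omega), minimal_peak_height hm hi h1 h2]

theorem gen_xiPrime_tensor_right (q : ℝ) {m : HalfDiagram n} (hm : IsEmpty (BoxRemoval m))
    (h : m.through.card = m.through.card) {i i' : ℕ} (hi : i + 1 < n) (hi' : i' + 1 < 2 * n)
    (hii : i + i' + 2 = 2 * n) (h1 : m.up i) (h2 : ¬ m.up (i + 1)) :
    gen q i' hi' (xiPrime q (tensor m m h).1) = (q : ℂ) • xiPrime q (tensor m m h).1 := by
  refine gen_xiPrime_low_peak q _ hi' ((tensor_up_right h hi (by omega)).2 h2)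
    (fun h' => (tensor_up_right h (k := i) (by omega) (by omega)).1 h' h1) ?_
  rw [show i' = 2 * n - (i + 2) by omega, tensor_height_right h (by omega),
    m.height_succ_of_not_up hi h2, m.height_succ_of_up h1, minimal_peak_height hm hi h1 h2]
  ring

theorem gen_xiPrime_tensor_slope {q : ℝ} (hq : 0 < q) (hgen : Generic q n) {m : HalfDiagram n}
    (h : m.through.card = m.through.card) {i i' : ℕ} (hi : i + 1 < n) (hi' : i' + 1 < 2 * n)
    (hii : i + i' + 2 = 2 * n) (h1 : m.up i) (h2 : m.up (i + 1)) :
    gen q i' hi' (xiPrime q (tensor m m h).1) = 0 := by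
  refine gen_xiPrime_slope hq hgen _ (tensor m m h).height_le hi' (iff_of_false ?_ ?_)
  · rw [tensor_up_right h hi (by omega)]
    exact not_not.2 h2
  · rw [tensor_up_right h (k := i) (by omega) (by omega)]
    exact not_not.2 h1

/-- ξ'_{m⊗m} is an eigenvector, with eigenvalue `q`, of the generators at the pairs of both copies
of `m`, so every `p` in its support contains these pairs. If moreover no through-strings of `m` are
joined, the word of `p` is forced. -/
theorem joins_of_ne_tensor {q : ℝ} (hq : 0 < q) {m : HalfDiagram n}
    (hm : IsEmpty (BoxRemoval m)) (h : m.through.card = m.through.card) {p : Pairing n}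
    (hp : xiPrime q (tensor m m h).1 p.1 ≠ 0) (hne : p ≠ tensor m m h) :
    concatJoinsThrough p m := by
  classical
  by_contra hj
  apply hne
  have hleft : ∀ i, i + 1 < n → m.up i → ¬ m.up (i + 1) → p.1.up i ∧ ¬ p.1.up (i + 1) :=
    fun i hi h1 h2 => peak_of_gen_eq hq (by omega) (gen_xiPrime_tensor_left q hm h hi h1 h2) hp
  have hright : ∀ i i', i + 1 < n → i + i' + 2 = 2 * n → m.up i → ¬ m.up (i + 1) →
      p.1.up i' ∧ ¬ p.1.up (i' + 1) := fun i i' hi hii h1 h2 =>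
    peak_of_gen_eq hq (by omega) (gen_xiPrime_tensor_right q hm h hi (by omega) hii h1 h2) hp
  -- A peak of `p` at these right points would be a pair that joins two neighbouring through-strings
  -- of `m`.
  have hthr : ∀ i i', i + 1 < n → i + i' + 2 = 2 * n → m.up i → m.up (i + 1) →
      p.1.up i' → p.1.up (i' + 1) := by
    intro i i' hi hii h1 h2 h3
    by_contra h4
    obtain ⟨h5, h6⟩ := minimal_slope_through hm hi h1 h2
    refine hj ⟨⟨i + 1, hi⟩, ⟨i, by omega⟩, by simp [Fin.ext_iff], h6, h5, ?_⟩
    have h7 := p.1.partner_of_peak (by omega) h3 h4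
    have e1 : (⟨i', by omega⟩ : Fin (2 * n)) = rightPt ⟨i + 1, hi⟩ := by
      apply Fin.ext
      simp only [rightPt]
      omega
    have e2 : (⟨i' + 1, by omega⟩ : Fin (2 * n)) = rightPt ⟨i, by omega⟩ := by
      apply Fin.ext
      simp only [rightPt]
      omega
    rw [e1, e2] at h7
    rw [← h7]
    exact concatGraph_reachable_left _
  have hR : ∀ i, i < n → (p.1.up (2 * n - 1 - i) ↔ ¬ m.up i) := by
    intro i
    induction i using Nat.strong_induction_on with
    | _ i ih =>
      intro hi
      by_cases h1 : m.up i
      · refine iff_of_false (fun h2 => ?_) (not_not.2 h1)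
        have h3 := p.height_right hi.le fun j hj => ih j hj (by omega)
        rw [show 2 * n - i = 2 * n - 1 - i + 1 by omega, p.1.height_succ_of_up h2] at h3
        have h4 := p.1.height_nonneg (2 * n - 1 - i)
        rcases Nat.eq_zero_or_eq_succ_pred i with h0 | h0
        · subst h0
          rw [m.height_zero] at h3
          omega
        obtain ⟨l, rfl⟩ : ∃ l, i = l + 1 := ⟨_, h0⟩
        by_cases h5 : m.up l
        · have h6 := hthr l (2 * n - 1 - (l + 1)) hi (by omega) h5 h1 h2
          rw [show 2 * n - 1 - (l + 1) + 1 = 2 * n - 1 - l by omega,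
            ih l (by omega) (by omega)] at h6
          exact h6 h5
        · have h6 := (minimal_closing hm (by omega) h5).1
          rw [m.height_succ_of_not_up (by omega) h5, h6] at h3
          omega
      · refine iff_of_true ?_ h1
        obtain ⟨-, h2, h3⟩ := minimal_closing hm hi h1
        obtain ⟨l, rfl⟩ : ∃ l, i = l + 1 := ⟨i - 1, by omega⟩
        exact (hright l _ hi (by omega) h3 h1).1
  have hn := p.height_right le_rfl fun j hj => hR j hj
  rw [show 2 * n - n = n by omega] at hn
  have hle : ∀ i < n, p.1.up i → m.up i := by
    intro i hi h1
    by_contra h2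
    obtain ⟨-, h3, h4⟩ := minimal_closing hm hi h2
    obtain ⟨l, rfl⟩ : ∃ l, i = l + 1 := ⟨i - 1, by omega⟩
    exact (hleft l hi h4 h2).2 h1
  -- `p` opens only where `m` does, and by `hn` both reach the same height at the middle, so the
  -- words agree.
  have hL : ∀ i < n, (p.1.up i ↔ m.up i) := by
    intro i hi
    refine ⟨hle i hi, fun h1 => ?_⟩
    by_contra h2
    rw [← HalfDiagram.wordHeight_up _ (show n ≤ 2 * n by omega), ← m.wordHeight_up le_rfl] at hn
    refine absurd hn (ne_of_lt (Finset.sum_lt_sum (fun k hk => ?_) ⟨i, Finset.mem_range.2 hi, ?_⟩))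
    · have := hle k (Finset.mem_range.1 hk)
      by_cases h3 : p.1.up k
      · simp [h3, this h3]
      · simp only [h3, if_false]
        split_ifs <;> omega
    · simp [h1, h2]
  apply Subtype.ext
  apply HalfDiagram.ext_up
  intro j hj
  by_cases hjn : j < n
  · rw [hL j hjn, tensor_up_left h hjn]
  · rw [tensor_up_right h (k := 2 * n - 1 - j) (by omega) (by omega),
      ← hR (2 * n - 1 - j) (by omega), show 2 * n - 1 - (2 * n - 1 - j) = j by omega]

theorem act_xiPrime_tensor_minimal {q : ℝ} (hq : 0 < q)
    {m : HalfDiagram n} (hm : IsEmpty (BoxRemoval m)) (h : m.through.card = m.through.card) :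
    act q (toTL (xiPrime q (tensor m m h).1)) (Finsupp.single m 1) =
      form q (Finsupp.single m 1) (Finsupp.single m 1) • Finsupp.single m 1 := by
  classical
  set w := toTL (xiPrime q (tensor m m h).1) with hw
  have hw0 : w (tensor m m h) = 1 := by
    rw [hw, toTL_apply, xiPrime_apply_self]
  have hsum : act q w (Finsupp.single m 1) =
      ∑ p ∈ w.support, w p • act q (Finsupp.single p 1) (Finsupp.single m 1) := by
    conv_lhs => rw [← Finsupp.sum_single w, Finsupp.sum, map_sum, LinearMap.sum_apply]
    apply Finset.sum_congr rfl
    intro p _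
    rw [single_eq_smul p (w p), map_smul, LinearMap.smul_apply]
  rw [hsum, Finset.sum_eq_single (tensor m m h)]
  · rw [hw0, one_smul, act_tensor_self]
  · intro p hp hne
    rw [act_single_single, actBasis_of_joins, smul_zero, smul_zero]
    have hp' : w p ≠ 0 := Finsupp.mem_support_iff.1 hp
    rw [hw, toTL_apply] at hp'
    exact joins_of_ne_tensor hq hm h hp' hne
  · intro h'
    rw [Finsupp.notMem_support_iff, hw0] at h'
    exact absurd h' one_ne_zero

/-- It suffices to take x = ξ'_c. For c ≠ m both sides vanish: a generator applied to x can be moved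
into ξ'_{m⊗m} as its mirror image, which acts there by `q` at a peak of `m` and by 0 where `m` rises
twice. -/
theorem act_xiPrime_tensor_minimal_eq {q : ℝ} (hq : 0 < q) (hgen : Generic q n)
    {m : HalfDiagram n} (hm : IsEmpty (BoxRemoval m)) (h : m.through.card = m.through.card)
    (x : U n) : act q (toTL (xiPrime q (tensor m m h).1)) x =
      form q x (xiPrime q m) • xiPrime q m := by
  rw [xiPrime_of_minimal q hm, ← formLeft_apply]
  have hx := xiPrime_span q x
  induction hx using Submodule.span_induction with
  | zero => simp
  | add x y _ _ hx hy => rw [map_add, map_add, hx, hy, add_smul]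
  | smul c x _ hx => rw [map_smul, map_smul, hx, smul_smul, smul_eq_mul]
  | mem x hx =>
    obtain ⟨c, rfl⟩ := hx
    by_cases hc : c = m
    · subst hc
      dsimp only
      rw [xiPrime_of_minimal q hm, act_xiPrime_tensor_minimal hq hm h, formLeft_apply]
    · dsimp only
      rw [formLeft_apply, form_xiPrime_minimal hq hgen hm hc, zero_smul]
      refine map_xiPrime_eq_zero hq hgen hm _ ?_ ?_ c hc
      · intro i hi h1 h2 x
        rw [← act_toTL_gen_right q hi (i' := 2 * n - 2 - i) (by omega) (by omega),
          gen_xiPrime_tensor_right q hm h hi (by omega) (by omega) h1 h2, map_smul, map_smul,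
          LinearMap.smul_apply]
      · intro i hi h1 h2 x
        rw [← act_toTL_gen_right q hi (i' := 2 * n - 2 - i) (by omega) (by omega),
          gen_xiPrime_tensor_slope hq hgen h hi (by omega) (by omega) h1 h2, map_zero, map_zero,
          LinearMap.zero_apply]

/-- A box of `b` is a right multiplication, which moves to `x` and then across the form to ξ'_b. The
induction is over all `x`, because it is applied to e_i x. -/
theorem act_xiPrime_tensor_of_minimal {q : ℝ} (hq : 0 < q) (hgen : Generic q n)
    {m : HalfDiagram n} (hm : IsEmpty (BoxRemoval m)) (b : HalfDiagram n)
    (h : m.through.card = b.through.card) (x : U n) :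
    act q (toTL (xiPrime q (tensor m b h).1)) x = form q x (xiPrime q b) • xiPrime q m := by
  induction b using closeSum_induction generalizing x with
  | h b ih =>
    rcases minimal_or_box b with hb | ⟨b₁, i, hi, hb⟩
    · obtain rfl := minimal_unique hm hb h
      exact act_xiPrime_tensor_minimal_eq hq hgen hm h x
    · have h₁ : m.through.card = b₁.through.card := h.trans hb.card_through
      have hbox := tensor_box_right hb h h₁ (i' := 2 * n - 2 - i) (by omega) (by omega)
      have hheight : (tensor m b₁ h₁).1.height (2 * n - 2 - i + 1) = b₁.height (i + 1) := by
        rw [show 2 * n - 2 - i + 1 = 2 * n - (i + 1) by omega,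
          tensor_height_right h₁ (by omega)]
      rw [xiPrime_of_box q hbox, map_sub, map_sub, LinearMap.sub_apply, map_smul, map_smul,
        LinearMap.smul_apply, act_toTL_gen_right q hi _ (by omega), hheight,
        ih b₁ hb.closeSum_lt h₁, ih b₁ hb.closeSum_lt h₁, form_xiPrime_box q hb, sub_smul,
        mul_smul]

/-- A box of `a` is a left multiplication, and the heights of `a ⊗ b` on the left are those of `a`,
so both sides obey the same recursion with the same μ. -/
theorem act_xiPrime_tensor {q : ℝ} (hq : 0 < q) (hgen : Generic q n) (a b : HalfDiagram n)
    (h : a.through.card = b.through.card) (x : U n) :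
    act q (toTL (xiPrime q (tensor a b h).1)) x = form q x (xiPrime q b) • xiPrime q a := by
  induction a using closeSum_induction with
  | h a ih =>
    rcases minimal_or_box a with ha | ⟨a₁, i, hi, ha⟩
    · exact act_xiPrime_tensor_of_minimal hq hgen ha b h x
    · have h₁ : a₁.through.card = b.through.card := ha.card_through.symm.trans h
      rw [xiPrime_of_box q (tensor_box_left ha h h₁), map_sub, map_sub, LinearMap.sub_apply,
        map_smul, map_smul, LinearMap.smul_apply, act_toTL_gen_left q hi,
        ih a₁ ha.closeSum_lt h₁, tensor_height_left h₁ (by omega), map_smul,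
        xiPrime_of_box q ha, smul_sub, smul_comm]

end Tensor

end TemperleyLieb

open TemperleyLieb in
theorem mainTheorem6 (n : ℕ) (q : ℝ) (hq : 0 < q)
    (hΔ : ∀ k : ℕ, 1 ≤ k → k < n → chebDelta q k ≠ 0)
    (a b : HalfDiagram n) (hab : a.through.card = b.through.card) :
    (∀ c : HalfDiagram n, c ≠ b →
      act q (ePrime q (tensor a b hab)) (xiPrime q c) = 0) ∧
    act q (ePrime q (tensor a b hab)) (xiPrime q b) =
      form q (xiPrime q b) (xiPrime q b) • xiPrime q a := by
  rw [ePrime_eq]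
  refine ⟨fun c hc => ?_, act_xiPrime_tensor hq hΔ a b hab _⟩
  rw [act_xiPrime_tensor hq hΔ, form_xiPrime_of_ne hq hΔ hc, zero_smul]
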